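/- Let $k$ be a non-archimedean local field of characteristic different from $2$. A distribution on a locally compact totally disconnected space $X$ is a linear functional on the space of locally constant, compactly supported functions $X\to\mathbb{C}$; for a homeomorphism $e$ of $X$ put $(e\cdot T)(f)=T(f\circ e)$, and call $T$ invariant under $e$ if $e\cdot T=T$. Put $$d_1=\begin{pmatrix}1&0\\0&-1\end{pmatrix},\quad d_2=\begin{pmatrix}0&1\\1&0\end{pmatrix},\quad j=\begin{pmatrix}0&0&0&1\\0&0&1&0\\0&-1&0&0\\-1&0&0&0\end{pmatrix},\quad d=\begin{pmatrix}-1&0&0&0\\0&0&1&0\\0&1&0&0\\0&0&0&1\end{pmatrix},\quad w''=\begin{pmatrix}0&0&0&1\\0&1&0&0\\0&0&1&0\\-1&0&0&0\end{pmatrix}.$$ Let $\mathrm{GSp}(4)=\{g\in \mathrm{GL}_4(k) : {}^t g\,j\,g=\lambda(g)\,j \text{ for some } \lambda(g)\in k^\times\}$, and for $\lambda\in k^\times$, $A\in\mathrm{GL}_2(k)$, $v=(v_1,v_2)\in k^2$, $z\in k$ let $$\mathsf m(\lambda,A)=\begin{pmatrix}\lambda&&\\&A&\\&&\lambda^{-1}\det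 A\end{pmatrix},\qquad \mathsf h(v,z)=\begin{pmatrix}1&v_1&v_2&z\\0&1&0&v_2\\0&0&1&-v_1\\0&0&0&1\end{pmatrix}.$$ Let $P=\{\mathsf m(\lambda,A)\mathsf h(v,z)\}$ be the Klingen parabolic subgroup of $\mathrm{GSp}(4)$, let $J=\{\mathsf m(1,A)\mathsf h(v,z) : A\in \mathrm{SL}_2(k)\}$, and let $\tau(g)=d^{-1}j^{-1}\,{}^t g\,j\,d$, an anti-automorphism of order two of $\mathrm{GSp}(4)$ which preserves the double coset $Pw''P$. Then: (a) Every distribution on $\mathrm{GL}_2(k)\times k^2$ that is invariant under $(g,v)\mapsto(sgs^{-1},sv)$ for all $s\in\mathrm{SL}_2(k)$ is invariant under $(g,v)\mapsto(d_1^{-1}\,{}^t g\,d_1,\;d_2v)$. (b) Let $\psi:k\to\mathbb{C}^\times$ be a nontrivial continuous character, and let $T$ be a distribution on $Pw''P$ that is invariant under $g\mapsto tgt^{-1}$ for all $t\in J$ and satisfies $L_z\cdot T=\psi(z)T$ for all $z\in k$, where $L_z$ is the left translation $g\mapsto \mathsf h(0,z)g$. Then $T$ is invariant under $\tau$. -/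

import Mathlib

open Matrix Topology
open scoped MatrixGroups

noncomputable section

namespace FourierJacobi

/-! ### Test functions and distributions -/

section Distributions

/-- The space of locally constant, compactly supported complex functions on `X`. -/
def TestFunction (X : Type*) [TopologicalSpace X] : Submodule ℂ (X → ℂ) where
  carrier := {f | IsLocallyConstant f ∧ HasCompactSupport f}
  zero_mem' := ⟨IsLocallyConstant.const 0, HasCompactSupport.zero⟩
  add_mem' := fun hf hg => ⟨hf.1.add hg.1, hf.2.add hg.2⟩
  smul_mem' := fun c _ hf => ⟨hf.1.comp (fun y => c * y), HasCompactSupport.smul_left hf.2⟩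

/-- A distribution is an arbitrary linear functional on the space of test functions. -/
abbrev Distribution (X : Type*) [TopologicalSpace X] : Type _ :=
  Module.Dual ℂ (TestFunction X)

variable {X Y : Type*} [TopologicalSpace X] [TopologicalSpace Y]

/-- Pull-back of test functions, `f ↦ f ∘ e`. -/
def TestFunction.pullback (e : X ≃ₜ Y) : TestFunction Y →ₗ[ℂ] TestFunction X where
  toFun f := ⟨f.1 ∘ e, f.2.1.comp_continuous e.continuous, f.2.2.comp_homeomorph e⟩
  map_add' _ _ := rfl
  map_smul' _ _ := rfl

/-- Push-forward of distributions: `(Distribution.map e T) f = T (f ∘ e)`. -/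
def Distribution.map (e : X ≃ₜ Y) (T : Distribution X) : Distribution Y :=
  T.comp (TestFunction.pullback e)

/-- `T` is invariant under the homeomorphism `e`. -/
def Distribution.IsInvariant (T : Distribution X) (e : X ≃ₜ X) : Prop :=
  Distribution.map e T = T

end Distributions

/-! ### Transposition on `GL n` -/

section Transpose

variable {n : Type*} [Fintype n] [DecidableEq n] {k : Type*} [Field k]

/-- The transpose of an invertible matrix. -/
def tr (g : GL n k) : GL n k where
  val := (g : Matrix n n k)ᵀ
  inv := ((g⁻¹ : GL n k) : Matrix n n k)ᵀ
  val_inv := by rw [← transpose_mul, ← Units.val_mul]; simp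
  inv_val := by rw [← transpose_mul, ← Units.val_mul]; simp

@[simp] lemma coe_tr (g : GL n k) : (tr g : Matrix n n k) = (g : Matrix n n k)ᵀ := rfl

@[simp] lemma tr_tr (g : GL n k) : tr (tr g) = g := Units.ext (by simp)

lemma tr_mul (g h : GL n k) : tr (g * h) = tr h * tr g := Units.ext (by simp)

lemma tr_inv (g : GL n k) : tr g⁻¹ = (tr g)⁻¹ := by
  rw [eq_inv_iff_mul_eq_one, ← tr_mul]
  exact Units.ext (by simp)

lemma continuous_tr [TopologicalSpace k] : Continuous (tr : GL n k → GL n k) :=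
  Units.continuous_iff.2
    ⟨Units.continuous_val.matrix_transpose, Units.continuous_coe_inv.matrix_transpose⟩

end Transpose

/-! ### The space `GL(2) × k²` -/

section GL2

variable {k : Type*} [Field k]

/-- `d₁ = diag(1, -1)`. -/
def d₁ (k : Type*) [Field k] : GL (Fin 2) k where
  val := !![1, 0; 0, -1]
  inv := !![1, 0; 0, -1]
  val_inv := by ext i j; fin_cases i <;> fin_cases j <;> simp
  inv_val := by ext i j; fin_cases i <;> fin_cases j <;> simp

/-- `d₂`, the permutation matrix exchanging the two coordinates. -/
def d₂ (k : Type*) [Field k] : Matrix (Fin 2) (Fin 2) k := !![0, 1; 1, 0]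

lemma d₂_mul_self : d₂ k * d₂ k = 1 := by
  ext i j; fin_cases i <;> fin_cases j <;> simp [d₂]

lemma tr_d₁ : tr (d₁ k) = d₁ k := by
  apply Units.ext; ext i j; fin_cases i <;> fin_cases j <;> simp [d₁]

variable [TopologicalSpace k] [IsTopologicalRing k]

/-- The action of `s ∈ SL(2)` on `GL(2) × k²`: `(g, v) ↦ (s g s⁻¹, s v)`. -/
def slAct (s : SL(2, k)) : GL (Fin 2) k × (Fin 2 → k) ≃ₜ GL (Fin 2) k × (Fin 2 → k) where
  toFun x := ((s : GL (Fin 2) k) * x.1 * (s : GL (Fin 2) k)⁻¹,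
    (s : Matrix (Fin 2) (Fin 2) k) *ᵥ x.2)
  invFun x := ((s : GL (Fin 2) k)⁻¹ * x.1 * (s : GL (Fin 2) k),
    ((s⁻¹ : SL(2, k)) : Matrix (Fin 2) (Fin 2) k) *ᵥ x.2)
  left_inv x := Prod.ext (by simp [mul_assoc]) (by
    change (s⁻¹).val *ᵥ (s.val *ᵥ x.2) = x.2
    have hs : (s⁻¹).val * s.val = 1 := congrArg Subtype.val (inv_mul_cancel s)
    rw [mulVec_mulVec, hs, one_mulVec])
  right_inv x := Prod.ext (by simp [mul_assoc]) (by
    change s.val *ᵥ ((s⁻¹).val *ᵥ x.2) = x.2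
    have hs : s.val * (s⁻¹).val = 1 := congrArg Subtype.val (mul_inv_cancel s)
    rw [mulVec_mulVec, hs, one_mulVec])
  continuous_toFun := by
    refine Continuous.prodMk (by fun_prop) ?_
    exact continuous_const.matrix_mulVec continuous_snd
  continuous_invFun := by
    refine Continuous.prodMk (by fun_prop) ?_
    exact continuous_const.matrix_mulVec continuous_snd

/-- The involution `(g, v) ↦ (d₁⁻¹ ᵗg d₁, d₂ v)` of `GL(2) × k²`. -/
def tauPrime (k : Type*) [Field k] [TopologicalSpace k] [IsTopologicalRing k] :
    GL (Fin 2) k × (Fin 2 → k) ≃ₜ GL (Fin 2) k × (Fin 2 → k) where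
  toFun x := ((d₁ k)⁻¹ * tr x.1 * d₁ k, d₂ k *ᵥ x.2)
  invFun x := ((d₁ k)⁻¹ * tr x.1 * d₁ k, d₂ k *ᵥ x.2)
  left_inv x := Prod.ext (by simp [tr_mul, tr_inv, tr_d₁, mul_assoc])
    (by
      change d₂ k *ᵥ (d₂ k *ᵥ x.2) = x.2
      rw [mulVec_mulVec, d₂_mul_self, one_mulVec])
  right_inv x := Prod.ext (by simp [tr_mul, tr_inv, tr_d₁, mul_assoc])
    (by
      change d₂ k *ᵥ (d₂ k *ᵥ x.2) = x.2
      rw [mulVec_mulVec, d₂_mul_self, one_mulVec])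
  continuous_toFun := by
    refine Continuous.prodMk ?_ (continuous_const.matrix_mulVec continuous_snd)
    exact (continuous_const.mul (continuous_tr.comp continuous_fst)).mul continuous_const
  continuous_invFun := by
    refine Continuous.prodMk ?_ (continuous_const.matrix_mulVec continuous_snd)
    exact (continuous_const.mul (continuous_tr.comp continuous_fst)).mul continuous_const

end GL2

/-! ### The group `GSp(4)` and its subgroups -/

section GSp4

variable {k : Type*} [Field k]

/-- The matrix `j` of the symplectic form. -/
def jMat (k : Type*) [Field k] : GL (Fin 4) k where
  val := !![0, 0, 0, 1; 0, 0, 1, 0; 0, -1, 0, 0; -1, 0, 0, 0]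
  inv := !![0, 0, 0, -1; 0, 0, -1, 0; 0, 1, 0, 0; 1, 0, 0, 0]
  val_inv := by ext i j; fin_cases i <;> fin_cases j <;> simp [Matrix.mul_apply, Fin.sum_univ_four]
  inv_val := by ext i j; fin_cases i <;> fin_cases j <;> simp [Matrix.mul_apply, Fin.sum_univ_four]

/-- The matrix `d` used to define the involution `τ`. -/
def dMat (k : Type*) [Field k] : GL (Fin 4) k where
  val := !![-1, 0, 0, 0; 0, 0, 1, 0; 0, 1, 0, 0; 0, 0, 0, 1]
  inv := !![-1, 0, 0, 0; 0, 0, 1, 0; 0, 1, 0, 0; 0, 0, 0, 1]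
  val_inv := by ext i j; fin_cases i <;> fin_cases j <;> simp [Matrix.mul_apply, Fin.sum_univ_four]
  inv_val := by ext i j; fin_cases i <;> fin_cases j <;> simp [Matrix.mul_apply, Fin.sum_univ_four]

/-- `GSp(4)`: the invertible `g` with `ᵗg j g = λ(g) j` for some nonzero scalar `λ(g)`. -/
def GSp4 (k : Type*) [Field k] : Subgroup (GL (Fin 4) k) where
  carrier := {g | ∃ c : kˣ, (g : Matrix (Fin 4) (Fin 4) k)ᵀ * (jMat k : Matrix _ _ k) *
    (g : Matrix (Fin 4) (Fin 4) k) = (c : k) • (jMat k : Matrix (Fin 4) (Fin 4) k)}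
  one_mem' := ⟨1, by simp⟩
  mul_mem' := by
    rintro a b ⟨c, hc⟩ ⟨e, he⟩
    refine ⟨c * e, ?_⟩
    have : ((a * b : GL (Fin 4) k) : Matrix (Fin 4) (Fin 4) k)ᵀ * (jMat k : Matrix _ _ k) *
        ((a * b : GL (Fin 4) k) : Matrix (Fin 4) (Fin 4) k) =
        (b : Matrix (Fin 4) (Fin 4) k)ᵀ * ((a : Matrix (Fin 4) (Fin 4) k)ᵀ *
        (jMat k : Matrix _ _ k) * (a : Matrix (Fin 4) (Fin 4) k)) *
        (b : Matrix (Fin 4) (Fin 4) k) := by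
      simp [Matrix.mul_assoc]
    rw [this, hc, Matrix.mul_smul, Matrix.smul_mul, he, smul_smul, Units.val_mul]
  inv_mem' := by
    rintro a ⟨c, hc⟩
    refine ⟨c⁻¹, ?_⟩
    have h1 : (a : Matrix (Fin 4) (Fin 4) k) * ((a⁻¹ : GL (Fin 4) k) : Matrix _ _ k) = 1 := by
      rw [← Units.val_mul]; simp
    have h2 : ((a⁻¹ : GL (Fin 4) k) : Matrix (Fin 4) (Fin 4) k)ᵀ *
        (a : Matrix (Fin 4) (Fin 4) k)ᵀ = 1 := by
      rw [← transpose_mul, h1, transpose_one]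
    have h3 : (jMat k : Matrix (Fin 4) (Fin 4) k) = (c : k) •
        (((a⁻¹ : GL (Fin 4) k) : Matrix (Fin 4) (Fin 4) k)ᵀ * (jMat k : Matrix _ _ k) *
          ((a⁻¹ : GL (Fin 4) k) : Matrix _ _ k)) := by
      rw [← Matrix.smul_mul, ← Matrix.mul_smul, ← hc]
      simp only [← Matrix.mul_assoc]
      rw [h2, Matrix.one_mul, Matrix.mul_assoc, h1, Matrix.mul_one]
    conv_rhs => rw [h3]
    rw [smul_smul]
    simp

lemma jMat_mul_self :
    (jMat k : Matrix (Fin 4) (Fin 4) k) * (jMat k : Matrix (Fin 4) (Fin 4) k) = -1 := by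
  ext i j; fin_cases i <;> fin_cases j <;> simp [jMat, Matrix.mul_apply, Fin.sum_univ_four]

/-- The element of `GSp(4)` given by a matrix `M` with `ᵗM j M = c j`. -/
def GSp4.mk' (M : Matrix (Fin 4) (Fin 4) k) (c : kˣ)
    (h : Mᵀ * (jMat k : Matrix _ _ k) * M = (c : k) • (jMat k : Matrix (Fin 4) (Fin 4) k)) :
    GSp4 k :=
  have h1 : (-(((c⁻¹ : kˣ) : k) • ((jMat k : Matrix (Fin 4) (Fin 4) k) * Mᵀ * jMat k))) * M
      = 1 := by
    rw [Matrix.neg_mul, Matrix.smul_mul, Matrix.mul_assoc, Matrix.mul_assoc,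
      ← Matrix.mul_assoc Mᵀ, h, Matrix.mul_smul, smul_smul, jMat_mul_self]
    simp
  ⟨⟨M, _, mul_eq_one_comm.1 h1, h1⟩, c, h⟩

@[simp] lemma GSp4.coe_mk' (M : Matrix (Fin 4) (Fin 4) k) (c : kˣ)
    (h : Mᵀ * (jMat k : Matrix _ _ k) * M = (c : k) • (jMat k : Matrix (Fin 4) (Fin 4) k)) :
    ((GSp4.mk' M c h : GL (Fin 4) k) : Matrix (Fin 4) (Fin 4) k) = M := rfl

/-- `m(λ, A)`: block diagonal with blocks `λ`, `A`, `λ⁻¹ det A`. -/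
def m (l : kˣ) (A : GL (Fin 2) k) : GSp4 k :=
  GSp4.mk' !![(l : k), 0, 0, 0;
      0, A 0 0, A 0 1, 0;
      0, A 1 0, A 1 1, 0;
      0, 0, 0, (l : k)⁻¹ * (A : Matrix (Fin 2) (Fin 2) k).det]
    (GeneralLinearGroup.det A) (by
      have hl : (l : k) ≠ 0 := l.ne_zero
      ext i j
      fin_cases i <;> fin_cases j <;>
        simp [jMat, Matrix.mul_apply, Fin.sum_univ_four, Matrix.det_fin_two] <;> field_simp <;>
        ring)

/-- The Heisenberg element `h(v, z)`. -/
def h (v : Fin 2 → k) (z : k) : GSp4 k :=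
  GSp4.mk' !![1, v 0, v 1, z;
      0, 1, 0, v 1;
      0, 0, 1, -v 0;
      0, 0, 0, 1]
    1 (by
      ext i j
      fin_cases i <;> fin_cases j <;>
        simp [jMat, Matrix.mul_apply, Fin.sum_univ_four]
      ring)

/-- The Weyl group representative `w''`, exchanging the lines spanned by `e₁` and `e₄` and
fixing `e₂` and `e₃`. -/
def w'' (k : Type*) [Field k] : GSp4 k :=
  GSp4.mk' !![0, 0, 0, 1; 0, 1, 0, 0; 0, 0, 1, 0; -1, 0, 0, 0] 1 (by
    ext i j
    fin_cases i <;> fin_cases j <;>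
      simp [jMat, Matrix.mul_apply, Fin.sum_univ_four])

lemma GSp4.ext' {a b : GSp4 k}
    (hab : ((a : GL (Fin 4) k) : Matrix (Fin 4) (Fin 4) k) = ((b : GL (Fin 4) k) : Matrix _ _ k)) :
    a = b :=
  Subtype.ext (Units.ext hab)

lemma GSp4.mk'_mul_mk' (M N : Matrix (Fin 4) (Fin 4) k) (c e : kˣ) (hM) (hN) :
    (((GSp4.mk' M c hM * GSp4.mk' N e hN : GSp4 k) : GL (Fin 4) k) : Matrix (Fin 4) (Fin 4) k) =
      M * N := rfl

lemma m_mul (l l' : kˣ) (A B : GL (Fin 2) k) : m l A * m l' B = m (l * l') (A * B) := by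
  apply GSp4.ext'
  rw [m, m, m, GSp4.mk'_mul_mk', GSp4.coe_mk']
  ext i j
  fin_cases i <;> fin_cases j <;>
    simp [Matrix.mul_apply, Fin.sum_univ_four, Fin.sum_univ_two]
  ring

lemma m_one : m (1 : kˣ) (1 : GL (Fin 2) k) = 1 := by
  apply GSp4.ext'
  rw [m, GSp4.coe_mk']
  ext i j
  fin_cases i <;> fin_cases j <;> simp

lemma h_mul (v w : Fin 2 → k) (z y : k) :
    h v z * h w y = h (v + w) (z + y + v 0 * w 1 - v 1 * w 0) := by
  apply GSp4.ext'
  rw [h, h, h, GSp4.mk'_mul_mk', GSp4.coe_mk']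
  ext i j
  fin_cases i <;> fin_cases j <;>
    simp [Matrix.mul_apply, Fin.sum_univ_four] <;> ring

lemma h_zero : h (0 : Fin 2 → k) 0 = 1 := by
  apply GSp4.ext'
  rw [h, GSp4.coe_mk']
  ext i j
  fin_cases i <;> fin_cases j <;> simp

lemma h_mul_m (v : Fin 2 → k) (z : k) (l : kˣ) (A : GL (Fin 2) k) :
    h v z * m l A = m l A * h ((l : k)⁻¹ • (v ᵥ* (A : Matrix (Fin 2) (Fin 2) k)))
      ((l : k)⁻¹ ^ 2 * (A : Matrix (Fin 2) (Fin 2) k).det * z) := by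
  have hl : (l : k) ≠ 0 := l.ne_zero
  apply GSp4.ext'
  rw [h, m, h, GSp4.mk'_mul_mk', GSp4.mk'_mul_mk']
  ext i j
  fin_cases i <;> fin_cases j <;>
    simp [Matrix.mul_apply, Fin.sum_univ_four, Matrix.vecMul, dotProduct,
      Fin.sum_univ_two, Matrix.det_fin_two] <;> field_simp <;> ring

lemma h_inv (v : Fin 2 → k) (z : k) : (h v z)⁻¹ = h (-v) (-z) := by
  rw [inv_eq_iff_mul_eq_one, h_mul, ← h_zero]
  congr 1
  · simp
  · simp; ring

lemma m_inv (l : kˣ) (A : GL (Fin 2) k) : (m l A)⁻¹ = m l⁻¹ A⁻¹ := by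
  rw [inv_eq_iff_mul_eq_one, m_mul]; simp [m_one]

/-- The Klingen parabolic subgroup `P = M H`. -/
def P (k : Type*) [Field k] : Subgroup (GSp4 k) where
  carrier := {g | ∃ (l : kˣ) (A : GL (Fin 2) k) (v : Fin 2 → k) (z : k), g = m l A * h v z}
  one_mem' := ⟨1, 1, 0, 0, by rw [m_one, h_zero, one_mul]⟩
  mul_mem' := by
    rintro _ _ ⟨l, A, v, z, rfl⟩ ⟨l', B, w, y, rfl⟩
    rw [mul_assoc, ← mul_assoc (h v z), h_mul_m, mul_assoc, h_mul, ← mul_assoc, m_mul]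
    exact ⟨_, _, _, _, rfl⟩
  inv_mem' := by
    rintro _ ⟨l, A, v, z, rfl⟩
    rw [_root_.mul_inv_rev, m_inv, h_inv, h_mul_m]
    exact ⟨_, _, _, _, rfl⟩

/-- The Fourier-Jacobi group `J = M' H`, where `M' = {m(1, A) : A ∈ SL(2)}`. -/
def J (k : Type*) [Field k] : Subgroup (GSp4 k) where
  carrier := {g | ∃ (A : SL(2, k)) (v : Fin 2 → k) (z : k),
    g = m 1 (A : GL (Fin 2) k) * h v z}
  one_mem' := ⟨1, 0, 0, by simp [m_one, h_zero]⟩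
  mul_mem' := by
    rintro _ _ ⟨A, v, z, rfl⟩ ⟨B, w, y, rfl⟩
    rw [mul_assoc, ← mul_assoc (h v z), h_mul_m, mul_assoc, h_mul, ← mul_assoc, m_mul, mul_one,
      ← map_mul]
    exact ⟨_, _, _, rfl⟩
  inv_mem' := by
    rintro _ ⟨A, v, z, rfl⟩
    rw [_root_.mul_inv_rev, m_inv, h_inv, h_mul_m, inv_one, ← map_inv]
    exact ⟨_, _, _, rfl⟩

lemma J_le_P : J k ≤ P k := by
  rintro _ ⟨A, v, z, rfl⟩
  exact ⟨_, _, _, _, rfl⟩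

/-- The open cell `P w'' P`. -/
def openCell (k : Type*) [Field k] : Set (GSp4 k) :=
  {g | ∃ p ∈ P k, ∃ q ∈ P k, g = p * w'' k * q}

/-- The involution `τ(g) = d⁻¹ j⁻¹ ᵗg j d`, on all of `GL(4)`. -/
def tauGL (g : GL (Fin 4) k) : GL (Fin 4) k :=
  (dMat k)⁻¹ * (jMat k)⁻¹ * tr g * jMat k * dMat k

lemma tauGL_mul (a b : GL (Fin 4) k) : tauGL (a * b) = tauGL b * tauGL a := by
  simp [tauGL, tr_mul, mul_assoc]

lemma tr_jMat : tr (jMat k) = (jMat k)⁻¹ :=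
  Units.ext (by
    change (!![0, 0, 0, 1; 0, 0, 1, 0; 0, -1, 0, 0; -1, 0, 0, 0] : Matrix _ _ k)ᵀ =
      !![0, 0, 0, -1; 0, 0, -1, 0; 0, 1, 0, 0; 1, 0, 0, 0]
    ext i j; fin_cases i <;> fin_cases j <;> simp)

lemma tr_dMat : tr (dMat k) = dMat k :=
  Units.ext (by ext i j; fin_cases i <;> fin_cases j <;> simp [dMat])

lemma dMat_inv : (dMat k)⁻¹ = dMat k := rfl

lemma jMat_inv : (jMat k)⁻¹ = -jMat k :=
  Units.ext (by
    change (!![0, 0, 0, -1; 0, 0, -1, 0; 0, 1, 0, 0; 1, 0, 0, 0] : Matrix _ _ k) =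
      -!![0, 0, 0, 1; 0, 0, 1, 0; 0, -1, 0, 0; -1, 0, 0, 0]
    ext i j; fin_cases i <;> fin_cases j <;> simp)

lemma jMat_mul_dMat : ((jMat k * dMat k : GL (Fin 4) k) : Matrix (Fin 4) (Fin 4) k) =
    !![0, 0, 0, 1; 0, 1, 0, 0; 0, 0, -1, 0; 1, 0, 0, 0] := by
  ext i j
  fin_cases i <;> fin_cases j <;> simp [jMat, dMat, Matrix.mul_apply, Fin.sum_univ_four]

lemma tr_jMat_mul_dMat : tr (jMat k * dMat k) = jMat k * dMat k :=
  Units.ext (by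
    rw [coe_tr, jMat_mul_dMat]
    ext i j; fin_cases i <;> fin_cases j <;> simp)

lemma tauGL_eq (g : GL (Fin 4) k) :
    tauGL g = (jMat k * dMat k)⁻¹ * tr g * (jMat k * dMat k) := by
  simp [tauGL, mul_assoc]

lemma tauGL_tauGL (g : GL (Fin 4) k) : tauGL (tauGL g) = g := by
  have hx := tr_jMat_mul_dMat (k := k)
  rw [tauGL_eq, tauGL_eq]
  generalize jMat k * dMat k = x at hx ⊢
  rw [tr_mul, tr_mul, tr_inv, hx, tr_tr]
  group

lemma tauGL_eq_iff (g g' : GL (Fin 4) k) : tauGL g = g' ↔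
    (g : Matrix (Fin 4) (Fin 4) k)ᵀ * !![0, 0, 0, 1; 0, 1, 0, 0; 0, 0, -1, 0; 1, 0, 0, 0] =
      !![0, 0, 0, 1; 0, 1, 0, 0; 0, 0, -1, 0; 1, 0, 0, 0] * (g' : Matrix (Fin 4) (Fin 4) k) := by
  rw [tauGL_eq, mul_assoc, inv_mul_eq_iff_eq_mul, Units.ext_iff, Units.val_mul (tr g),
    Units.val_mul _ g', jMat_mul_dMat, coe_tr]

lemma tauGL_m (l : kˣ) (A : GL (Fin 2) k) :
    tauGL (m l A : GL (Fin 4) k) =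
      m (l⁻¹ * GeneralLinearGroup.det A) ((d₁ k)⁻¹ * tr A * d₁ k) := by
  have hd : (((d₁ k)⁻¹ * tr A * d₁ k : GL (Fin 2) k) : Matrix (Fin 2) (Fin 2) k) =
      !![A 0 0, -A 1 0; -A 0 1, A 1 1] := by
    change !![1, 0; 0, -1] * (A : Matrix (Fin 2) (Fin 2) k)ᵀ * !![1, 0; 0, -1] = _
    ext i j
    fin_cases i <;> fin_cases j <;> simp [Matrix.mul_apply, Matrix.vecMul, dotProduct, Fin.sum_univ_two]
  have hdet : (A : Matrix (Fin 2) (Fin 2) k).det ≠ 0 := (GeneralLinearGroup.det A).ne_zero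
  have hl : (l : k) ≠ 0 := l.ne_zero
  rw [tauGL_eq_iff, m, m, GSp4.coe_mk', GSp4.coe_mk', hd]
  have h2 : (!![A 0 0, -A 1 0; -A 0 1, A 1 1] : Matrix (Fin 2) (Fin 2) k).det =
      (A : Matrix (Fin 2) (Fin 2) k).det := by
    rw [Matrix.det_fin_two_of, Matrix.det_fin_two]; ring
  rw [h2]
  ext i j
  fin_cases i <;> fin_cases j <;> simp [Matrix.mul_apply, Fin.sum_univ_four]
  field_simp

lemma tauGL_h (v : Fin 2 → k) (z : k) :
    tauGL (h v z : GL (Fin 4) k) = h (d₂ k *ᵥ v) z := by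
  rw [tauGL_eq_iff, h, h, GSp4.coe_mk', GSp4.coe_mk']
  ext i j
  fin_cases i <;> fin_cases j <;>
    simp [Matrix.mul_apply, Fin.sum_univ_four, d₂, Matrix.mulVec, dotProduct, Fin.sum_univ_two]

lemma tauGL_w'' : tauGL (w'' k : GL (Fin 4) k) = w'' k := by
  rw [tauGL_eq_iff, w'', GSp4.coe_mk']
  ext i j
  fin_cases i <;> fin_cases j <;> simp [Matrix.mul_apply, Fin.sum_univ_four]

lemma tauGL_mem {g : GL (Fin 4) k} (hg : g ∈ GSp4 k) : tauGL g ∈ GSp4 k := by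
  obtain ⟨c, hc⟩ := hg
  let s : GL (Fin 4) k := Units.map (algebraMap k (Matrix (Fin 4) (Fin 4) k)).toMonoidHom c
  have hs : (s : Matrix (Fin 4) (Fin 4) k) = (c : k) • 1 := by
    simp [s, Algebra.algebraMap_eq_smul_one]
  have hsm : s ∈ GSp4 k := ⟨c * c, by simp [hs, smul_smul]⟩
  have hj : jMat k ∈ GSp4 k := ⟨1, by
    rw [← coe_tr, ← Units.val_mul, tr_jMat]; simp⟩
  have hd : dMat k ∈ GSp4 k := ⟨-1, by
    rw [← coe_tr, tr_dMat, Matrix.mul_assoc, ← Units.val_mul (jMat k), jMat_mul_dMat]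
    ext i j
    fin_cases i <;> fin_cases j <;>
      simp [jMat, dMat, Matrix.mul_apply, Fin.sum_univ_four]⟩
  have ht : tr g = s * jMat k * g⁻¹ * (jMat k)⁻¹ := by
    rw [eq_mul_inv_iff_mul_eq, eq_mul_inv_iff_mul_eq]
    exact Units.ext (by simp [hs, hc])
  have hg : g ∈ GSp4 k := ⟨c, hc⟩
  rw [tauGL, ht]
  exact mul_mem (mul_mem (mul_mem (mul_mem (inv_mem hd) (inv_mem hj))
    (mul_mem (mul_mem (mul_mem hsm hj) (inv_mem hg)) (inv_mem hj))) hj) hd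

/-- The anti-involution `τ(g) = d⁻¹ j⁻¹ ᵗg j d` of `GSp(4)`. -/
def tau (g : GSp4 k) : GSp4 k := ⟨tauGL g, tauGL_mem g.2⟩

lemma tau_mul (a b : GSp4 k) : tau (a * b) = tau b * tau a :=
  Subtype.ext (tauGL_mul _ _)

lemma tau_tau (a : GSp4 k) : tau (tau a) = a := Subtype.ext (tauGL_tauGL _)

lemma tau_w'' : tau (w'' k) = w'' k := Subtype.ext tauGL_w''

lemma tau_mem_P {p : GSp4 k} (hp : p ∈ P k) : tau p ∈ P k := by
  obtain ⟨l, A, v, z, rfl⟩ := hp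
  rw [tau_mul]
  refine mul_mem ⟨1, 1, d₂ k *ᵥ v, z, ?_⟩
    ⟨l⁻¹ * GeneralLinearGroup.det A, (d₁ k)⁻¹ * tr A * d₁ k, 0, 0, ?_⟩
  · rw [m_one, one_mul]; exact Subtype.ext (tauGL_h v z)
  · rw [h_zero, mul_one]; exact Subtype.ext (tauGL_m l A)

lemma tau_mem_openCell {g : GSp4 k} (hg : g ∈ openCell k) : tau g ∈ openCell k := by
  obtain ⟨p, hp, q, hq, rfl⟩ := hg
  exact ⟨tau q, tau_mem_P hq, tau p, tau_mem_P hp, by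
    rw [tau_mul, tau_mul, tau_w'', mul_assoc]⟩

lemma mul_mem_openCell {p g q : GSp4 k} (hp : p ∈ P k) (hg : g ∈ openCell k) (hq : q ∈ P k) :
    p * g * q ∈ openCell k := by
  obtain ⟨a, ha, b, hb, rfl⟩ := hg
  exact ⟨p * a, mul_mem hp ha, b * q, mul_mem hb hq, by simp only [mul_assoc]⟩

lemma P_mul_mem_openCell {p g : GSp4 k} (hp : p ∈ P k) (hg : g ∈ openCell k) :
    p * g ∈ openCell k := by
  simpa using mul_mem_openCell hp hg (one_mem _)

lemma h_mem_P (v : Fin 2 → k) (z : k) : h v z ∈ P k :=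
  ⟨1, 1, v, z, by rw [m_one, one_mul]⟩

variable [TopologicalSpace k] [IsTopologicalRing k]

lemma continuous_tau : Continuous (tau : GSp4 k → GSp4 k) := by
  refine Continuous.subtype_mk ?_ _
  unfold tauGL
  exact ((continuous_const.mul (continuous_tr.comp continuous_subtype_val)).mul
    continuous_const).mul continuous_const

/-- Conjugation `g ↦ t g t⁻¹` of the open cell by an element `t` of `J`. -/
def conjCell (t : J k) : openCell k ≃ₜ openCell k where
  toFun g := ⟨t * g * (t : GSp4 k)⁻¹, mul_mem_openCell (J_le_P t.2) g.2 (inv_mem (J_le_P t.2))⟩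
  invFun g := ⟨(t : GSp4 k)⁻¹ * g * t, mul_mem_openCell (inv_mem (J_le_P t.2)) g.2 (J_le_P t.2)⟩
  left_inv g := Subtype.ext (by simp [mul_assoc])
  right_inv g := Subtype.ext (by simp [mul_assoc])
  continuous_toFun := Continuous.subtype_mk
    ((continuous_const.mul continuous_subtype_val).mul continuous_const) _
  continuous_invFun := Continuous.subtype_mk
    ((continuous_const.mul continuous_subtype_val).mul continuous_const) _

/-- Left translation `g ↦ h(0, z) g` of the open cell by an element of the centre `Z` of `J`. -/
def leftZCell (z : k) : openCell k ≃ₜ openCell k where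
  toFun g := ⟨h 0 z * g, P_mul_mem_openCell (h_mem_P 0 z) g.2⟩
  invFun g := ⟨(h 0 z)⁻¹ * g, P_mul_mem_openCell (inv_mem (h_mem_P 0 z)) g.2⟩
  left_inv g := Subtype.ext (by simp)
  right_inv g := Subtype.ext (by simp)
  continuous_toFun := Continuous.subtype_mk (continuous_const.mul continuous_subtype_val) _
  continuous_invFun := Continuous.subtype_mk (continuous_const.mul continuous_subtype_val) _

/-- The restriction of `τ` to the open cell. -/
def tauCell (k : Type*) [Field k] [TopologicalSpace k] [IsTopologicalRing k] :
    openCell k ≃ₜ openCell k where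
  toFun g := ⟨tau g, tau_mem_openCell g.2⟩
  invFun g := ⟨tau g, tau_mem_openCell g.2⟩
  left_inv _ := Subtype.ext (tau_tau _)
  right_inv _ := Subtype.ext (tau_tau _)
  continuous_toFun := Continuous.subtype_mk (continuous_tau.comp continuous_subtype_val) _
  continuous_invFun := Continuous.subtype_mk (continuous_tau.comp continuous_subtype_val) _

end GSp4

end FourierJacobi

end

/-!
Let `G` act on `X` and let the involution `τ` of `X` normalize the action. If every test function on
`X` is a combination of functions `φ(g • x) - φ(x)` and `φ(τ x) + φ(x)`, that is, if the
anti-coinvariants `antiCoinv` exhaust the test functions, then every `G`-invariant distribution is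
`τ`-invariant (`isInvariant_of_testOn_le`). Both parts follow from one vanishing theorem of this
kind, `SLFibration.testOn_univ_le`, for spaces `X` over `GL(2) × k²` on which an extension `G` of
`SL(2)` acts, its kernel simply transitively on the fibres up to a parameter. For the first part `X`
is `GL(2) × k²` itself. For the second, an element of `P w'' P` is written uniquely as the conjugate
by `h(a, z)` of `w'' m(λ, A) h(v, y)`; conjugation by `J` acts on `(A, v)` as `SL(2)` does on
`GL(2) × k²`, its unipotent radical moves `(a, z)` simply transitively, and `(λ, y)` is an
invariant. The involution `τ` covers the involution of `GL(2) × k²` up to `-1 ∈ SL(2)`.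

The vanishing theorem is proved fibre by fibre. The parameter, the trace and determinant of `g` and
`det (v, g v)` are continuous invariants, so by Bernstein's localization principle
(`testOn_le_antiCoinv_of_fibers`) it suffices to treat a fibre of these, and such a fibre can be cut
into a closed invariant subset and its complement (`testOn_le_antiCoinv_of_closed`). On a set where
the orbit maps are open, indicators of compact open subsets of one orbit have positively
proportional classes in the coinvariants (`HasOpenOrbits.posEquiv_chi`); this replaces the
uniqueness and positivity of an invariant measure. If `τ` preserves each orbit, it therefore acts on
the class of an indicator by a positive factor, and on the anti-coinvariants it acts by `-1`, so the
class vanishes (`HasOpenOrbits.testOn_le_antiCoinv`). Two pairs `(g, v)` are conjugate under `SL(2)`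
when they have the same coordinates in frames of the same determinant (`IsFrame.exists_slAct`), and
frames that vary continuously show that orbit maps are open (`SLFibration.hasOpenOrbits_of_frames`).
This settles the following strata.

* `det (v, g v) ≠ 0`: the frame `(v, g v)`.
* `v = 0`: for nonscalar `g` a cyclic vector `u` gives the frame `(u, g u)`, rescaled by a local
  square root, which exists because `2 ≠ 0`.
* `v ≠ 0` an eigenvector for a double eigenvalue: after fixing one more invariant, `v` completed by
  any `w` with `det (v, w) = 1`.

There remain the nonzero eigenvectors `v` of a matrix `g` with two distinct eigenvalues. They form
two orbits, exchanged by `τ`, so that positivity on each orbit is not enough: a distribution could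
be positive on one and negative on the other. Such a distribution does not extend to the closure of
the two orbits, which meet along `v = 0`. Indeed, let `g` be diagonal and let `C` be the part of its
two eigenlines in the lattice `𝒪²`. For a compact open subgroup `K` and `T = diag(ϖ, ϖ⁻¹)` the sets
`K C` and `K T C` have the same class in the coinvariants (`SLFibration.chi_orb_sub_mem_coinv`).
Passing from `C` to `T C` removes a set from one eigenline and adds one to the other, and this links
the two orbits with a positive constant (`SLFibration.exists_linked`), which suffices
(`SLFibration.testOn_eigen_le`).
-/

noncomputable section

namespace InvariantDistribution

/-! ### Test functions on a subset -/

section TestFunctions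

open Set Function

variable {X : Type*}

/-- The indicator function of a set, with complex values. -/
def chi (V : Set X) : X → ℂ := V.indicator 1

lemma chi_of_mem {V : Set X} {x : X} (hx : x ∈ V) : chi V x = 1 := by simp [chi, hx]

lemma chi_of_notMem {V : Set X} {x : X} (hx : x ∉ V) : chi V x = 0 := by simp [chi, hx]

lemma chi_comp {Y : Type*} (e : Y → X) (V : Set X) : (fun y => chi V (e y)) = chi (e ⁻¹' V) := rfl

lemma support_chi (V : Set X) : support (chi V) = V := by simp [chi]

variable [TopologicalSpace X]

/-- The test functions on a subset `L` of `X`, extended by zero to `X`: the support is compact and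
contained in `L`, and the function is locally constant on `L`. -/
def testOn (L : Set X) : Submodule ℂ (X → ℂ) where
  carrier := {f | support f ⊆ L ∧ IsClosed (support f) ∧ (∃ C, IsCompact C ∧ support f ⊆ C) ∧
    ∀ x ∈ L, ∀ᶠ y in 𝓝[L] x, f y = f x}
  zero_mem' := by
    refine ⟨by simp, by simp, ⟨∅, isCompact_empty, by simp⟩, fun x _ => by simp⟩
  add_mem' := by
    rintro f g ⟨hf, hfc, ⟨C, hC, hfC⟩, hfl⟩ ⟨hg, hgc, ⟨D, hD, hgD⟩, hgl⟩
    have hs : support (f + g) ⊆ support f ∪ support g := support_add f g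
    have hl : ∀ x ∈ L, ∀ᶠ y in 𝓝[L] x, (f + g) y = (f + g) x := by
      intro x hx
      filter_upwards [hfl x hx, hgl x hx] with y h1 h2
      simp [h1, h2]
    refine ⟨hs.trans (union_subset hf hg), ?_, ⟨C ∪ D, hC.union hD,
      hs.trans (union_subset_union hfC hgD)⟩, hl⟩
    refine isClosed_of_closure_subset fun x hx => ?_
    have hxL : x ∈ support f ∪ support g :=
      (hfc.union hgc).closure_subset_iff.2 hs hx
    have hxL' : x ∈ L := (union_subset hf hg) hxL
    intro h0
    have h1 := hl x hxL'
    rw [eventually_nhdsWithin_iff] at h1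
    rw [mem_closure_iff_frequently] at hx
    obtain ⟨y, hy, hy'⟩ := (hx.and_eventually h1).exists
    exact hy ((hy' ((union_subset hf hg) (hs hy))).trans h0)
  smul_mem' := by
    rintro c f ⟨hf, hfc, ⟨C, hC, hfC⟩, hfl⟩
    rcases eq_or_ne c 0 with rfl | hc
    · simp only [zero_smul]
      exact ⟨by simp, by simp, ⟨∅, isCompact_empty, by simp⟩, fun x _ => by simp⟩
    have hs : support (c • f) = support f := support_const_smul_of_ne_zero c f hc
    refine ⟨hs ▸ hf, hs ▸ hfc, ⟨C, hC, hs ▸ hfC⟩, fun x hx => ?_⟩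
    filter_upwards [hfl x hx] with y h1
    simp [h1]

/-- `V` is a compact subset of `L`, open in the subspace topology of `L`. -/
structure IsCompactOpenIn (L V : Set X) : Prop where
  subset : V ⊆ L
  isCompact : IsCompact V
  mem_nhdsWithin : ∀ x ∈ V, V ∈ 𝓝[L] x

lemma isCompact_support [T2Space X] {L : Set X} {f : X → ℂ} (hf : f ∈ testOn L) :
    IsCompact (support f) := by
  obtain ⟨-, hc, ⟨C, hC, hfC⟩, -⟩ := hf
  exact hC.of_isClosed_subset hc hfC

lemma mem_testOn_iff [T2Space X] {L : Set X} {f : X → ℂ} : f ∈ testOn L ↔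
    support f ⊆ L ∧ IsCompact (support f) ∧ ∀ x ∈ L, ∀ᶠ y in 𝓝[L] x, f y = f x :=
  ⟨fun hf => ⟨hf.1, isCompact_support hf, hf.2.2.2⟩,
    fun hf => ⟨hf.1, hf.2.1.isClosed, ⟨_, hf.2.1, subset_rfl⟩, hf.2.2⟩⟩

lemma chi_mem_testOn [T2Space X] {L V : Set X} (hV : IsCompactOpenIn L V) : chi V ∈ testOn L := by
  rw [mem_testOn_iff, support_chi]
  refine ⟨hV.subset, hV.isCompact, fun x hx => ?_⟩
  by_cases hxV : x ∈ V
  · filter_upwards [hV.mem_nhdsWithin x hxV] with y hy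
    rw [chi_of_mem hy, chi_of_mem hxV]
  · filter_upwards [mem_nhdsWithin_of_mem_nhds (hV.isCompact.isClosed.isOpen_compl.mem_nhds hxV)]
      with y hy
    rw [chi_of_notMem hy, chi_of_notMem hxV]

lemma isCompactOpenIn_fiber [T2Space X] {L : Set X} {f : X → ℂ} (hf : f ∈ testOn L) {a : ℂ}
    (ha : a ≠ 0) : IsCompactOpenIn L (f ⁻¹' {a}) := by
  have hs : f ⁻¹' {a} ⊆ support f := fun x hx => by
    rw [mem_preimage, mem_singleton_iff] at hx
    rw [mem_support, hx]; exact ha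
  refine ⟨hs.trans hf.1, (isCompact_support hf).of_isClosed_subset ?_ hs, fun x hx => ?_⟩
  · refine isClosed_of_closure_subset fun x hx => ?_
    have hxL : x ∈ L := hf.1 (hf.2.1.closure_subset_iff.2 hs hx)
    have h1 := hf.2.2.2 x hxL
    rw [eventually_nhdsWithin_iff] at h1
    rw [mem_closure_iff_frequently] at hx
    obtain ⟨y, hy, hy'⟩ := (hx.and_eventually h1).exists
    rw [mem_preimage, mem_singleton_iff] at hy ⊢
    rw [← hy' (hf.1 (hs hy)), hy]
  · filter_upwards [hf.2.2.2 x (hf.1 (hs hx))] with y hy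
    rw [mem_preimage, mem_singleton_iff] at hx ⊢
    rw [hy, hx]

/-- Test functions are linear combinations of indicators of compact open sets. -/
lemma testOn_le [T2Space X] {L : Set X} {W : Submodule ℂ (X → ℂ)}
    (hW : ∀ V, IsCompactOpenIn L V → chi V ∈ W) : testOn L ≤ W := by
  intro f hf
  have hfin : (f '' support f).Finite := by
    obtain ⟨t, ht, hc⟩ := (isCompact_support hf).elim_nhdsWithin_subcover
      (fun x => f ⁻¹' {f x}) (fun x hx =>
        nhdsWithin_mono x hf.1 (hf.2.2.2 x (hf.1 hx)))
    refine (t.finite_toSet.image f).subset ?_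
    rintro _ ⟨x, hx, rfl⟩
    obtain ⟨y, hy, hxy⟩ := mem_iUnion₂.1 (hc hx)
    exact ⟨y, hy, (mem_singleton_iff.1 hxy).symm⟩
  have hsum : f = ∑ a ∈ hfin.toFinset, a • chi (f ⁻¹' {a}) := by
    funext x
    rw [Finset.sum_apply]
    by_cases hx : f x = 0
    · rw [hx, Finset.sum_eq_zero]
      intro a ha
      obtain ⟨y, hy, rfl⟩ := hfin.mem_toFinset.1 ha
      rw [Pi.smul_apply, chi_of_notMem, smul_zero]
      rw [mem_preimage, mem_singleton_iff, hx]
      exact fun h0 => hy h0.symm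
    · rw [Finset.sum_eq_single (f x)]
      · rw [Pi.smul_apply, chi_of_mem (show x ∈ f ⁻¹' {f x} from rfl)]; simp
      · intro a _ hne
        rw [Pi.smul_apply, chi_of_notMem, smul_zero]
        exact fun h0 => hne (mem_singleton_iff.1 h0).symm
      · intro h0
        exact absurd (hfin.mem_toFinset.2 ⟨x, hx, rfl⟩) h0
  rw [hsum]
  refine Submodule.sum_mem _ fun a ha => W.smul_mem _ (hW _ (isCompactOpenIn_fiber hf ?_))
  obtain ⟨y, hy, rfl⟩ := hfin.mem_toFinset.1 ha
  exact hy

/-- A test function that vanishes off a subset `U` is a test function on `U`. -/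
lemma mem_testOn_of_support_subset {L U : Set X} (hUL : U ⊆ L) {f : X → ℂ} (hf : f ∈ testOn L)
    (hfU : support f ⊆ U) : f ∈ testOn U :=
  ⟨hfU, hf.2.1, hf.2.2.1, fun x hx => nhdsWithin_mono x hUL (hf.2.2.2 x (hUL hx))⟩

lemma testOn_diff_le {L C : Set X} (hC : IsClosed C) : testOn (L \ C) ≤ testOn L := by
  rintro f ⟨h1, h2, h3, h4⟩
  refine ⟨h1.trans sdiff_subset, h2, h3, fun x hx => ?_⟩
  by_cases hxC : x ∈ C
  · have hx0 : f x = 0 := by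
      by_contra h0
      exact (h1 h0).2 hxC
    have : (support f)ᶜ ∈ 𝓝 x := h2.isOpen_compl.mem_nhds (fun h => h hx0)
    filter_upwards [mem_nhdsWithin_of_mem_nhds this] with y hy
    rw [hx0]
    exact notMem_support.1 hy
  · have hn : 𝓝[L \ C] x = 𝓝[L] x := by
      rw [sdiff_eq, nhdsWithin_inter_of_mem']
      exact mem_nhdsWithin_of_mem_nhds (hC.isOpen_compl.mem_nhds hxC)
    rw [← hn]
    exact h4 x ⟨hx, hxC⟩

lemma isCompactOpenIn_of_diff {L C V : Set X} (hC : IsClosed C)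
    (hV : IsCompactOpenIn (L \ C) V) : IsCompactOpenIn L V := by
  refine ⟨hV.subset.trans sdiff_subset, hV.isCompact, fun x hx => ?_⟩
  have hn : 𝓝[L \ C] x = 𝓝[L] x := by
    rw [sdiff_eq, nhdsWithin_inter_of_mem']
    exact mem_nhdsWithin_of_mem_nhds (hC.isOpen_compl.mem_nhds (hV.subset hx).2)
  rw [← hn]
  exact hV.mem_nhdsWithin x hx

lemma IsCompactOpenIn.union {L V W : Set X} (hV : IsCompactOpenIn L V)
    (hW : IsCompactOpenIn L W) : IsCompactOpenIn L (V ∪ W) :=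
  ⟨union_subset hV.subset hW.subset, hV.isCompact.union hW.isCompact, fun x hx => hx.elim
    (fun h => Filter.mem_of_superset (hV.mem_nhdsWithin x h) subset_union_left)
    (fun h => Filter.mem_of_superset (hW.mem_nhdsWithin x h) subset_union_right)⟩

lemma IsCompactOpenIn.inter [T2Space X] {L V W : Set X} (hV : IsCompactOpenIn L V)
    (hW : IsCompactOpenIn L W) : IsCompactOpenIn L (V ∩ W) :=
  ⟨inter_subset_left.trans hV.subset, hV.isCompact.inter hW.isCompact, fun x hx =>
    Filter.inter_mem (hV.mem_nhdsWithin x hx.1) (hW.mem_nhdsWithin x hx.2)⟩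

lemma IsCompactOpenIn.diff [T2Space X] {L V W : Set X} (hV : IsCompactOpenIn L V)
    (hW : IsCompactOpenIn L W) : IsCompactOpenIn L (V \ W) := by
  refine ⟨sdiff_subset.trans hV.subset, ?_, fun x hx => ?_⟩
  · refine hV.isCompact.of_isClosed_subset ?_ sdiff_subset
    refine isClosed_of_closure_subset fun x hx => ?_
    have hxV : x ∈ V := hV.isCompact.isClosed.closure_subset_iff.2 sdiff_subset hx
    refine ⟨hxV, fun hxW => ?_⟩
    rw [mem_closure_iff_frequently] at hx
    have := mem_nhdsWithin_iff_eventually.1 (hW.mem_nhdsWithin x hxW)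
    obtain ⟨y, hy, hy'⟩ := (hx.and_eventually this).exists
    exact hy.2 (hy' (hV.subset hy.1))
  · exact Filter.inter_mem (hV.mem_nhdsWithin x hx.1)
      (mem_nhdsWithin_of_mem_nhds (hW.isCompact.isClosed.isOpen_compl.mem_nhds hx.2))

lemma IsCompactOpenIn.preimage {L V : Set X} (hV : IsCompactOpenIn L V) (e : X ≃ₜ X)
    (he : ∀ x, e x ∈ L ↔ x ∈ L) : IsCompactOpenIn L (e ⁻¹' V) := by
  refine ⟨fun x hx => (he x).1 (hV.subset hx), e.isCompact_preimage.2 hV.isCompact, fun x hx => ?_⟩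
  have : Filter.Tendsto e (𝓝[L] x) (𝓝[L] (e x)) :=
    e.continuous.continuousWithinAt.tendsto_nhdsWithin (fun y hy => (he y).2 hy)
  exact this (hV.mem_nhdsWithin _ hx)

lemma comp_mem_testOn {L : Set X} {f : X → ℂ} (hf : f ∈ testOn L) (e : X ≃ₜ X)
    (he : ∀ x, e x ∈ L ↔ x ∈ L) : (fun x => f (e x)) ∈ testOn L := by
  obtain ⟨h1, h2, ⟨C, hC, h3⟩, h4⟩ := hf
  refine ⟨fun x hx => (he x).1 (h1 hx), h2.preimage e.continuous,
    ⟨e ⁻¹' C, e.isCompact_preimage.2 hC, fun x hx => h3 hx⟩, fun x hx => ?_⟩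
  have : Filter.Tendsto e (𝓝[L] x) (𝓝[L] (e x)) :=
    e.continuous.continuousWithinAt.tendsto_nhdsWithin (fun y hy => (he y).2 hy)
  exact this (h4 _ ((he x).2 hx))

variable [T2Space X] [LocallyCompactSpace X] [TotallyDisconnectedSpace X]

lemma exists_compact_clopen {x : X} {O : Set X} (hO : IsOpen O) (hx : x ∈ O) :
    ∃ W, IsClopen W ∧ IsCompact W ∧ x ∈ W ∧ W ⊆ O := by
  obtain ⟨K, hK, hxK, hKO⟩ := exists_compact_subset hO hx
  obtain ⟨W, hW, hxW, hWK⟩ := loc_compact_Haus_tot_disc_of_zero_dim.exists_subset_of_mem_open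
    hxK isOpen_interior
  exact ⟨W, hW, hK.of_isClosed_subset hW.1 (hWK.trans interior_subset), hxW,
    hWK.trans (interior_subset.trans hKO)⟩

lemma exists_compact_clopen_between {K O : Set X} (hK : IsCompact K) (hO : IsOpen O)
    (hKO : K ⊆ O) : ∃ W, IsClopen W ∧ IsCompact W ∧ K ⊆ W ∧ W ⊆ O := by
  refine hK.induction_on (p := fun K => ∃ W, IsClopen W ∧ IsCompact W ∧ K ⊆ W ∧ W ⊆ O)
    ⟨∅, isClopen_empty, isCompact_empty, subset_rfl, empty_subset _⟩
    (fun s t hst ⟨W, h1, h2, h3, h4⟩ => ⟨W, h1, h2, hst.trans h3, h4⟩)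
    (fun s t ⟨W, h1, h2, h3, h4⟩ ⟨W', h1', h2', h3', h4'⟩ =>
      ⟨W ∪ W', h1.union h1', h2.union h2', union_subset_union h3 h3', union_subset h4 h4'⟩)
    (fun x hx => ?_)
  obtain ⟨W, h1, h2, h3, h4⟩ := exists_compact_clopen hO (hKO hx)
  exact ⟨W, mem_nhdsWithin_of_mem_nhds (h1.2.mem_nhds h3), W, h1, h2, subset_rfl, h4⟩

/-- A compact open subset of a relatively closed subset `L ∩ C` of the locally closed set `L` is
the trace of a compact open subset of `L`. -/
lemma exists_isCompactOpenIn_extension {L C V : Set X} (hL : IsLocallyClosed L)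
    (hV : IsCompactOpenIn (L ∩ C) V) : ∃ W, IsCompactOpenIn L W ∧ ∀ x ∈ L ∩ C, x ∈ W ↔ x ∈ V := by
  obtain ⟨O₁, F, hO₁, hF, rfl⟩ := hL
  have hex : ∃ O, IsOpen O ∧ ∀ x ∈ O₁ ∩ F ∩ C, x ∈ O ↔ x ∈ V := by
    choose! O hO using fun x hx => mem_nhdsWithin.1 (hV.mem_nhdsWithin x hx)
    refine ⟨⋃ x ∈ V, O x, isOpen_biUnion fun x hx => (hO x hx).1, fun x hx => ?_⟩
    rw [mem_iUnion₂]
    exact ⟨fun ⟨y, hy, hxy⟩ => (hO y hy).2.2 ⟨hxy, hx⟩, fun hxV => ⟨x, hxV, (hO x hxV).2.1⟩⟩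
  obtain ⟨O, hO, hOV⟩ := hex
  obtain ⟨W, hW, hWc, hVW, hWO⟩ := exists_compact_clopen_between hV.isCompact (hO.inter hO₁)
    (fun x hx => ⟨(hOV x (hV.subset hx)).2 hx, (hV.subset hx).1.1⟩)
  refine ⟨W ∩ F, ⟨fun x hx => ⟨(hWO hx.1).2, hx.2⟩, hWc.inter_right hF, fun x hx => ?_⟩,
    fun x hx => ⟨fun h => (hOV x hx).1 (hWO h.1).1, fun h => ⟨hVW h, hx.1.2⟩⟩⟩
  exact Filter.inter_mem (mem_nhdsWithin_of_mem_nhds (hW.2.mem_nhds hx.1))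
    (Filter.mem_of_superset self_mem_nhdsWithin inter_subset_right)

/-- Test functions extend from a relatively closed subset of a locally closed set. -/
lemma exists_testOn_extension {L C : Set X} (hL : IsLocallyClosed L) {f : X → ℂ}
    (hf : f ∈ testOn (L ∩ C)) : ∃ F ∈ testOn L, ∀ x ∈ L ∩ C, F x = f x := by
  let W : Submodule ℂ (X → ℂ) :=
    { carrier := {f | ∃ F ∈ testOn L, ∀ x ∈ L ∩ C, F x = f x}
      zero_mem' := ⟨0, zero_mem _, fun _ _ => rfl⟩
      add_mem' := by
        rintro f g ⟨F, hF, hFf⟩ ⟨H, hH, hHg⟩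
        exact ⟨F + H, add_mem hF hH, fun x hx => by simp [hFf x hx, hHg x hx]⟩
      smul_mem' := by
        rintro c f ⟨F, hF, hFf⟩
        exact ⟨c • F, Submodule.smul_mem _ c hF, fun x hx => by simp [hFf x hx]⟩ }
  have : testOn (L ∩ C) ≤ W := testOn_le fun V hV => by
    obtain ⟨V', hV', h⟩ := exists_isCompactOpenIn_extension hL hV
    refine ⟨chi V', chi_mem_testOn hV', fun x hx => ?_⟩
    by_cases hx' : x ∈ V
    · rw [chi_of_mem hx', chi_of_mem ((h x hx).2 hx')]
    · rw [chi_of_notMem hx', chi_of_notMem (fun h' => hx' ((h x hx).1 h'))]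
  exact this hf

end TestFunctions

/-! ### Coinvariants and anti-coinvariants -/

section Coinvariants

open Set Function

variable {X : Type*} [TopologicalSpace X] (G : Type*) [Group G] [MulAction G X]

/-- The span of the functions `φ(g • x) - φ(x)`, for `φ` a test function on `L`. -/
def coinv (L : Set X) : Submodule ℂ (X → ℂ) :=
  Submodule.span ℂ {F | ∃ φ ∈ testOn L, ∃ g : G, F = fun x => φ (g • x) - φ x}

/-- The span of the functions `φ(g • x) - φ(x)` and `φ(τ x) + φ(x)`, for `φ` a test function on
`L`. The distributions on `L` that kill this space are those that are invariant under `G` and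
change sign under `τ`. -/
def antiCoinv (τ : X ≃ₜ X) (L : Set X) : Submodule ℂ (X → ℂ) :=
  Submodule.span ℂ {F | ∃ φ ∈ testOn L,
    (∃ g : G, F = fun x => φ (g • x) - φ x) ∨ F = fun x => φ (τ x) + φ x}

/-- `L` is stable under `G` and `τ`. -/
structure IsStable (τ : X ≃ₜ X) (L : Set X) : Prop where
  smul_mem : ∀ (g : G) x, g • x ∈ L ↔ x ∈ L
  map_mem : ∀ x, τ x ∈ L ↔ x ∈ L

variable {G} {τ : X ≃ₜ X} {L C : Set X}

lemma IsStable.inter {L' : Set X} (h : IsStable G τ L) (h' : IsStable G τ L') :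
    IsStable G τ (L ∩ L') :=
  ⟨fun g x => and_congr (h.smul_mem g x) (h'.smul_mem g x),
    fun x => and_congr (h.map_mem x) (h'.map_mem x)⟩

lemma IsStable.diff {L' : Set X} (h : IsStable G τ L) (h' : IsStable G τ L') :
    IsStable G τ (L \ L') :=
  ⟨fun g x => and_congr (h.smul_mem g x) (h'.smul_mem g x).not,
    fun x => and_congr (h.map_mem x) (h'.map_mem x).not⟩

lemma coinv_le_antiCoinv : coinv G L ≤ antiCoinv G τ L :=
  Submodule.span_mono fun _ ⟨φ, hφ, h⟩ => ⟨φ, hφ, Or.inl h⟩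

lemma coinv_mono {L' : Set X} (hL : testOn L ≤ testOn L') : coinv G L ≤ coinv G L' :=
  Submodule.span_mono fun _ ⟨φ, hφ, h⟩ => ⟨φ, hL hφ, h⟩

lemma antiCoinv_mono {L' : Set X} (hL : testOn L ≤ testOn L') :
    antiCoinv G τ L ≤ antiCoinv G τ L' :=
  Submodule.span_mono fun _ ⟨φ, hφ, h⟩ => ⟨φ, hL hφ, h⟩

lemma smul_sub_mem_coinv {φ : X → ℂ} (hφ : φ ∈ testOn L) (g : G) :
    (fun x => φ (g • x) - φ x) ∈ coinv G L := Submodule.subset_span ⟨φ, hφ, g, rfl⟩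

lemma map_add_mem_antiCoinv {φ : X → ℂ} (hφ : φ ∈ testOn L) :
    (fun x => φ (τ x) + φ x) ∈ antiCoinv G τ L := Submodule.subset_span ⟨φ, hφ, Or.inr rfl⟩

lemma indicator_mem_testOn {A : Set X} {f : X → ℂ} (hf : f ∈ testOn L)
    (hA : ∀ x ∈ L, ∀ᶠ y in 𝓝[L] x, y ∈ A ↔ x ∈ A) : A.indicator f ∈ testOn L := by
  obtain ⟨h1, h2, ⟨K, hK, h3⟩, h4⟩ := hf
  have hs : support (A.indicator f) ⊆ support f := by
    rw [support_indicator]; exact inter_subset_right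
  refine ⟨hs.trans h1, ?_, ⟨K, hK, hs.trans h3⟩, fun x hx => ?_⟩
  · refine isClosed_of_closure_subset fun x hx => ?_
    have hxf : x ∈ support f := h2.closure_subset_iff.2 hs hx
    have h5 := hA x (h1 hxf)
    rw [eventually_nhdsWithin_iff] at h5
    rw [mem_closure_iff_frequently] at hx
    obtain ⟨y, hy, hy'⟩ := (hx.and_eventually h5).exists
    rw [support_indicator] at hy ⊢
    exact ⟨(hy' (h1 hy.2)).1 hy.1, hxf⟩
  · filter_upwards [hA x hx, h4 x hx] with y h5 h6
    by_cases hxA : x ∈ A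
    · rw [indicator_of_mem hxA, indicator_of_mem (h5.2 hxA), h6]
    · rw [indicator_of_notMem hxA, indicator_of_notMem (fun h => hxA (h5.1 h))]

lemma indicator_mem_testOn_inter {f : X → ℂ} (hf : f ∈ testOn L) (hC : IsClosed C) :
    C.indicator f ∈ testOn (L ∩ C) := by
  obtain ⟨h1, h2, ⟨K, hK, h3⟩, h4⟩ := hf
  refine ⟨?_, ?_, ⟨K, hK, ?_⟩, fun x hx => ?_⟩
  · rw [support_indicator]; exact fun x hx => ⟨h1 hx.2, hx.1⟩
  · rw [support_indicator]; exact hC.inter h2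
  · rw [support_indicator]; exact inter_subset_right.trans h3
  · filter_upwards [nhdsWithin_mono x inter_subset_left (h4 x hx.1), self_mem_nhdsWithin]
      with y h5 h6
    rw [indicator_of_mem hx.2, indicator_of_mem h6.2, h5]

/-- The anti-coinvariants are stable under multiplication by invariant locally constant functions.
-/
lemma indicator_mem_antiCoinv {A : Set X} (hL : IsStable G τ L)
    (hA : ∀ x ∈ L, ∀ᶠ y in 𝓝[L] x, y ∈ A ↔ x ∈ A) (hG : ∀ (g : G), ∀ x ∈ L, g • x ∈ A ↔ x ∈ A)
    (hτ : ∀ x ∈ L, τ x ∈ A ↔ x ∈ A) {f : X → ℂ} (hf : f ∈ antiCoinv G τ L) :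
    A.indicator f ∈ antiCoinv G τ L := by
  have key : ∀ (φ : X → ℂ), φ ∈ testOn L → ∀ e : X → X, (∀ x, e x ∈ L ↔ x ∈ L) →
      (∀ x ∈ L, e x ∈ A ↔ x ∈ A) → ∀ x,
      A.indicator (fun y => φ (e y)) x = A.indicator φ (e x) := by
    intro φ hφ e he heA x
    have h0 : x ∉ L → φ (e x) = 0 := fun hx =>
      notMem_support.1 fun h => hx ((he x).1 (hφ.1 h))
    by_cases hx : x ∈ L
    · by_cases hxA : x ∈ A
      · rw [indicator_of_mem hxA, indicator_of_mem ((heA x hx).2 hxA)]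
      · rw [indicator_of_notMem hxA, indicator_of_notMem (fun h => hxA ((heA x hx).1 h))]
    · simp only [indicator, h0 hx, ite_self]
  induction hf using Submodule.span_induction with
  | mem F hF =>
    obtain ⟨φ, hφ, ⟨g, rfl⟩ | rfl⟩ := hF
    · refine Submodule.subset_span ⟨A.indicator φ, indicator_mem_testOn hφ hA, Or.inl ⟨g, ?_⟩⟩
      funext x
      rw [← key φ hφ (g • ·) (hL.smul_mem g) (hG g) x]
      exact congrFun (indicator_sub' A (fun x => φ (g • x)) φ) x
    · refine Submodule.subset_span ⟨A.indicator φ, indicator_mem_testOn hφ hA, Or.inr ?_⟩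
      funext x
      rw [← key φ hφ τ hL.map_mem hτ x]
      exact congrFun (indicator_add' A (fun x => φ (τ x)) φ) x
  | zero => rw [indicator_zero']; exact zero_mem _
  | add F H _ _ hF hH => rw [indicator_add']; exact add_mem hF hH
  | smul c F _ hF =>
    rw [show A.indicator (c • F) = c • A.indicator F from indicator_const_smul A c F]
    exact Submodule.smul_mem _ c hF

lemma smul_mem_testOn [ContinuousConstSMul G X] (hL : ∀ (g : G) x, g • x ∈ L ↔ x ∈ L)
    {φ : X → ℂ} (hφ : φ ∈ testOn L) (g : G) : (fun x => φ (g • x)) ∈ testOn L :=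
  comp_mem_testOn hφ (Homeomorph.smul g) (hL g)

lemma antiCoinv_le_testOn [ContinuousConstSMul G X] (hL : IsStable G τ L) :
    antiCoinv G τ L ≤ testOn L := by
  refine Submodule.span_le.2 ?_
  rintro _ ⟨φ, hφ, ⟨g, rfl⟩ | rfl⟩
  · exact sub_mem (smul_mem_testOn hL.smul_mem hφ g) hφ
  · exact add_mem (comp_mem_testOn hφ τ hL.map_mem) hφ

variable [T2Space X] [LocallyCompactSpace X] [TotallyDisconnectedSpace X]

lemma exists_antiCoinv_extension (hL : IsLocallyClosed L) (hLC : IsStable G τ (L ∩ C))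
    {e : X → ℂ} (he : e ∈ antiCoinv G τ (L ∩ C)) :
    ∃ e' ∈ antiCoinv G τ L, ∀ x ∈ L ∩ C, e' x = e x := by
  induction he using Submodule.span_induction with
  | mem F hF =>
    obtain ⟨φ, hφ, hF⟩ := hF
    obtain ⟨Φ, hΦ, hΦφ⟩ := exists_testOn_extension hL hφ
    obtain ⟨g, rfl⟩ | rfl := hF
    · exact ⟨_, Submodule.subset_span ⟨Φ, hΦ, Or.inl ⟨g, rfl⟩⟩, fun x hx => by
        simp only [hΦφ x hx, hΦφ _ ((hLC.smul_mem g x).2 hx)]⟩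
    · exact ⟨_, Submodule.subset_span ⟨Φ, hΦ, Or.inr rfl⟩, fun x hx => by
        simp only [hΦφ x hx, hΦφ _ ((hLC.map_mem x).2 hx)]⟩
  | zero => exact ⟨0, zero_mem _, fun _ _ => rfl⟩
  | add F H _ _ hF hH =>
    obtain ⟨F', hF', h1⟩ := hF
    obtain ⟨H', hH', h2⟩ := hH
    exact ⟨F' + H', add_mem hF' hH', fun x hx => by simp [h1 x hx, h2 x hx]⟩
  | smul c F _ hF =>
    obtain ⟨F', hF', h1⟩ := hF
    exact ⟨c • F', Submodule.smul_mem _ c hF', fun x hx => by simp [h1 x hx]⟩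

variable [ContinuousConstSMul G X]

/-- If the anti-coinvariants vanish on `L ∩ C`, every test function on `L` can be changed, within
its class, to one that vanishes on `C`. -/
lemma exists_antiCoinv_sub_mem (hC : IsClosed C) (hL : IsLocallyClosed L) (hst : IsStable G τ L)
    (hLC : IsStable G τ (L ∩ C)) (hZ : testOn (L ∩ C) ≤ antiCoinv G τ (L ∩ C))
    {f : X → ℂ} (hf : f ∈ testOn L) : ∃ e ∈ antiCoinv G τ L, f - e ∈ testOn (L \ C) := by
  obtain ⟨e, he, hef⟩ := exists_antiCoinv_extension hL hLC (hZ (indicator_mem_testOn_inter hf hC))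
  have hfe : f - e ∈ testOn L := sub_mem hf (antiCoinv_le_testOn hst he)
  refine ⟨e, he, mem_testOn_of_support_subset sdiff_subset hfe fun x hx =>
    ⟨hfe.1 hx, fun hxC => ?_⟩⟩
  have hxL := hfe.1 hx
  apply hx
  rw [Pi.sub_apply, hef x ⟨hxL, hxC⟩, indicator_of_mem hxC, sub_self]

/-- Passage from a relatively closed stable subset and its complement to the whole set. -/
theorem testOn_le_antiCoinv_of_closed (hC : IsClosed C) (hL : IsLocallyClosed L)
    (hst : IsStable G τ L) (hLC : IsStable G τ (L ∩ C))
    (hZ : testOn (L ∩ C) ≤ antiCoinv G τ (L ∩ C)) (hU : testOn (L \ C) ≤ antiCoinv G τ L) :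
    testOn L ≤ antiCoinv G τ L := by
  intro f hf
  obtain ⟨e, he, hfe⟩ := exists_antiCoinv_sub_mem hC hL hst hLC hZ hf
  have := add_mem he (hU hfe)
  rwa [add_sub_cancel] at this

/-- Bernstein's localization principle: if the anti-coinvariants vanish on each fibre of a
continuous invariant map `p`, they vanish on `L`. -/
theorem testOn_le_antiCoinv_of_fibers {Y : Type*} [TopologicalSpace Y] [TotallySeparatedSpace Y]
    (p : X → Y) (hp : ContinuousOn p L) (hpG : ∀ (g : G), ∀ x ∈ L, p (g • x) = p x)
    (hpτ : ∀ x ∈ L, p (τ x) = p x) (hL : IsLocallyClosed L) (hst : IsStable G τ L)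
    (hfib : ∀ y, testOn (L ∩ p ⁻¹' {y}) ≤ antiCoinv G τ (L ∩ p ⁻¹' {y})) :
    testOn L ≤ antiCoinv G τ L := by
  have hclopen : ∀ U : Set Y, IsClopen U → ∀ x ∈ L, ∀ᶠ y in 𝓝[L] x, y ∈ p ⁻¹' U ↔ x ∈ p ⁻¹' U := by
    intro U hU x hx
    by_cases hxU : p x ∈ U
    · filter_upwards [(hp x hx) (hU.2.mem_nhds hxU)] with y hy
      exact ⟨fun _ => hxU, fun _ => hy⟩
    · filter_upwards [(hp x hx) (hU.compl.2.mem_nhds hxU)] with y hy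
      exact ⟨fun h => absurd h hy, fun h => absurd h hxU⟩
  have hind : ∀ U : Set Y, IsClopen U → ∀ f ∈ antiCoinv G τ L,
      (p ⁻¹' U).indicator f ∈ antiCoinv G τ L := fun U hU f hf =>
    indicator_mem_antiCoinv hst (hclopen U hU) (fun g x hx => by
      rw [mem_preimage, hpG g x hx, mem_preimage]) (fun x hx => by
      rw [mem_preimage, hpτ x hx, mem_preimage]) hf
  intro f hf
  have hcpt : ∀ h ∈ testOn L, IsCompact (p '' support h) := fun h hh =>
    (isCompact_support hh).image_of_continuousOn (hp.mono hh.1)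
  -- Near a fibre, `f` agrees with an element of the anti-coinvariants: it does so on the fibre, and
  -- the image under `p` of the support of the difference is compact, hence misses a clopen
  -- neighbourhood of the point.
  have hloc : ∀ y, ∃ U : Set Y, IsClopen U ∧ y ∈ U ∧ (p ⁻¹' U).indicator f ∈ antiCoinv G τ L := by
    intro y
    obtain ⟨C, hC, hCL⟩ := continuousOn_iff_isClosed.1 hp {y} isClosed_singleton
    have hLC : L ∩ p ⁻¹' {y} = L ∩ C := by rw [inter_comm, hCL, inter_comm]
    have hst' : IsStable G τ (L ∩ p ⁻¹' {y}) := by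
      refine ⟨fun g x => ⟨fun h => ?_, fun h => ?_⟩, fun x => ⟨fun h => ?_, fun h => ?_⟩⟩
      · have hx := (hst.smul_mem g x).1 h.1
        exact ⟨hx, by rw [mem_preimage, ← hpG g x hx]; exact h.2⟩
      · exact ⟨(hst.smul_mem g x).2 h.1, by rw [mem_preimage, hpG g x h.1]; exact h.2⟩
      · have hx := (hst.map_mem x).1 h.1
        exact ⟨hx, by rw [mem_preimage, ← hpτ x hx]; exact h.2⟩
      · exact ⟨(hst.map_mem x).2 h.1, by rw [mem_preimage, hpτ x h.1]; exact h.2⟩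
    have hfy := hfib y
    rw [hLC] at hst' hfy
    obtain ⟨e, he, hfe⟩ := exists_antiCoinv_sub_mem hC hL hst hst' hfy hf
    have hfe' := testOn_diff_le hC hfe
    have hy : y ∉ p '' support (f - e) := by
      rintro ⟨x, hx, hxy⟩
      have : x ∈ L ∩ C := hLC ▸ ⟨(hfe.1 hx).1, hxy⟩
      exact (hfe.1 hx).2 this.2
    have hsep : ∃ U : Set Y, IsClopen U ∧ p '' support (f - e) ⊆ U ∧ y ∉ U := by
      refine (hcpt _ hfe').induction_on (p := fun s => ∃ U : Set Y, IsClopen U ∧ s ⊆ U ∧ y ∉ U)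
        ⟨∅, isClopen_empty, subset_rfl, notMem_empty _⟩
        (fun s t hs ⟨U, h1, h2, h3⟩ => ⟨U, h1, hs.trans h2, h3⟩)
        (fun s t ⟨U, h1, h2, h3⟩ ⟨U', h1', h2', h3'⟩ => ⟨U ∪ U', h1.union h1',
          union_subset_union h2 h2', fun h => h.elim h3 h3'⟩) (fun z hz => ?_)
      have hzy : z ≠ y := fun h => hy (h ▸ hz)
      obtain ⟨U, hU, hzU, hyU⟩ := exists_isClopen_of_totally_separated hzy
      exact ⟨U, mem_nhdsWithin_of_mem_nhds (hU.2.mem_nhds hzU), U, hU, subset_rfl, hyU⟩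
    obtain ⟨U, hU, hsU, hyU⟩ := hsep
    refine ⟨Uᶜ, hU.compl, hyU, ?_⟩
    have : (p ⁻¹' Uᶜ).indicator f = (p ⁻¹' Uᶜ).indicator e := by
      funext x
      by_cases hx : x ∈ p ⁻¹' Uᶜ
      · rw [indicator_of_mem hx, indicator_of_mem hx]
        by_contra hne
        exact hx (hsU ⟨x, sub_ne_zero.2 hne, rfl⟩)
      · rw [indicator_of_notMem hx, indicator_of_notMem hx]
    rw [this]
    exact hind _ hU.compl e he
  have hglob : ∃ U : Set Y, IsClopen U ∧ p '' support f ⊆ U ∧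
      (p ⁻¹' U).indicator f ∈ antiCoinv G τ L := by
    refine (hcpt f hf).induction_on (p := fun s => ∃ U : Set Y, IsClopen U ∧ s ⊆ U ∧
      (p ⁻¹' U).indicator f ∈ antiCoinv G τ L)
      ⟨∅, isClopen_empty, subset_rfl, by
        rw [preimage_empty, indicator_empty']; exact zero_mem _⟩
      (fun s t hs ⟨U, h1, h2, h3⟩ => ⟨U, h1, hs.trans h2, h3⟩)
      (fun s t ⟨U, h1, h2, h3⟩ ⟨U', h1', h2', h3'⟩ => ⟨U ∪ U', h1.union h1',
        union_subset_union h2 h2', ?_⟩) (fun z hz => ?_)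
    · have : (p ⁻¹' (U ∪ U')).indicator f = (p ⁻¹' U).indicator f + (p ⁻¹' U').indicator f -
          (p ⁻¹' U).indicator ((p ⁻¹' U').indicator f) := by
        funext x
        by_cases hx : x ∈ p ⁻¹' U <;> by_cases hx' : x ∈ p ⁻¹' U' <;>
          simp_all [indicator]
      rw [this]
      exact sub_mem (add_mem h3 h3') (hind U h1 _ h3')
    · obtain ⟨U, hU, hzU, h⟩ := hloc z
      exact ⟨U, mem_nhdsWithin_of_mem_nhds (hU.2.mem_nhds hzU), U, hU, subset_rfl, h⟩
  obtain ⟨U, -, hfU, h⟩ := hglob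
  rwa [indicator_eq_self.2 (show support f ⊆ p ⁻¹' U from fun x hx => hfU ⟨x, hx, rfl⟩)] at h

end Coinvariants

/-! ### Open orbits -/

section Orbits

open Set Function

variable {X : Type*} {G : Type*} [Group G]

section Algebra

variable [MulAction G X]

/-- The set `K V` of all `g • v` with `g ∈ K` and `v ∈ V`. -/
def orb (K : Subgroup G) (V : Set X) : Set X := {y | ∃ g ∈ K, ∃ v ∈ V, g • v = y}

lemma subset_orb (K : Subgroup G) (V : Set X) : V ⊆ orb K V :=
  fun v hv => ⟨1, K.one_mem, v, hv, one_smul _ _⟩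

lemma smul_mem_orb_iff {K : Subgroup G} {V : Set X} {g : G} (hg : g ∈ K) {x : X} :
    g • x ∈ orb K V ↔ x ∈ orb K V := by
  constructor
  · rintro ⟨k, hk, v, hv, h⟩
    exact ⟨g⁻¹ * k, K.mul_mem (K.inv_mem hg) hk, v, hv, by rw [mul_smul, h, inv_smul_smul]⟩
  · rintro ⟨k, hk, v, hv, rfl⟩
    exact ⟨g * k, K.mul_mem hg hk, v, hv, mul_smul _ _ _⟩

/-- `K (g V) = g (g⁻¹ K g) V`. -/
lemma orb_image_smul (K : Subgroup G) (g : G) (V : Set X) :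
    orb K ((g • ·) '' V) = (g⁻¹ • ·) ⁻¹' orb (K.comap (MulAut.conj g).toMonoidHom) V := by
  ext y
  constructor
  · rintro ⟨k, hk, _, ⟨v, hv, rfl⟩, rfl⟩
    refine ⟨g⁻¹ * k * g, ?_, v, hv, by simp only [mul_smul]⟩
    simpa [Subgroup.mem_comap, mul_assoc] using hk
  · rintro ⟨k, hk, v, hv, h⟩
    refine ⟨g * k * g⁻¹, by simpa [Subgroup.mem_comap] using hk, _, ⟨v, hv, rfl⟩, ?_⟩
    simp only [mul_smul, inv_smul_smul]
    rw [h, smul_inv_smul]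

end Algebra

section Conjugation

variable [TopologicalSpace G] [IsTopologicalGroup G]

lemma isOpen_comap_conj {K : Subgroup G} (hK : IsOpen (K : Set G)) (g : G) :
    IsOpen (K.comap (MulAut.conj g).toMonoidHom : Set G) :=
  hK.preimage ((continuous_const_mul g).mul_const _)

lemma isCompact_comap_conj {K : Subgroup G} (hK : IsCompact (K : Set G)) (g : G) :
    IsCompact (K.comap (MulAut.conj g).toMonoidHom : Set G) :=
  ((Homeomorph.mulLeft g).trans (Homeomorph.mulRight g⁻¹)).isCompact_preimage.2 hK

end Conjugation

variable [TopologicalSpace X] [MulAction G X] {L : Set X}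

variable (G) in
/-- Two functions on `L` are positively equivalent if their classes in the coinvariants differ by a
positive factor. -/
def PosEquiv (L : Set X) (f f' : X → ℂ) : Prop :=
  ∃ c : ℝ, 0 < c ∧ f - (c : ℂ) • f' ∈ coinv G L

lemma PosEquiv.symm {f f' : X → ℂ} : PosEquiv G L f f' → PosEquiv G L f' f := by
  rintro ⟨c, hc, h⟩
  refine ⟨c⁻¹, inv_pos.2 hc, ?_⟩
  have hc' : (c : ℂ) ≠ 0 := by exact_mod_cast hc.ne'
  have h2 := Submodule.smul_mem _ (-(c : ℂ)⁻¹) h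
  convert h2 using 1
  rw [smul_sub, smul_smul, neg_mul, inv_mul_cancel₀ hc', Complex.ofReal_inv]
  simp only [neg_smul, one_smul]
  abel

lemma PosEquiv.trans {f f' f'' : X → ℂ} :
    PosEquiv G L f f' → PosEquiv G L f' f'' → PosEquiv G L f f'' := by
  rintro ⟨c, hc, h⟩ ⟨d, hd, h'⟩
  refine ⟨c * d, mul_pos hc hd, ?_⟩
  have h2 := add_mem h (Submodule.smul_mem _ (c : ℂ) h')
  convert h2 using 1
  rw [smul_sub, smul_smul, Complex.ofReal_mul]
  abel

/-- A test function on which `τ` acts by a positive factor up to coinvariants has trivial class in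
the anti-coinvariants, since `τ` acts by `-1` there. -/
lemma mem_antiCoinv_of_posEquiv {τ : X ≃ₜ X} {f : X → ℂ} (hf : f ∈ testOn L)
    (h : PosEquiv G L (fun x => f (τ x)) f) : f ∈ antiCoinv G τ L := by
  obtain ⟨c, hc, h⟩ := h
  have h2 := sub_mem (map_add_mem_antiCoinv (G := G) (τ := τ) hf)
    (coinv_le_antiCoinv (τ := τ) h)
  have hc' : (1 + c : ℂ) ≠ 0 := by exact_mod_cast (by linarith : (1 + c : ℝ) ≠ 0)
  have h3 := Submodule.smul_mem _ (1 + c : ℂ)⁻¹ h2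
  convert h3 using 1
  rw [eq_inv_smul_iff₀ hc']
  funext x
  simp only [Pi.smul_apply, Pi.sub_apply, smul_eq_mul]
  ring

lemma chi_smul_sub_mem_coinv {V : Set X} (hV : chi V ∈ testOn L) (g : G) :
    chi ((g⁻¹ • ·) ⁻¹' V) - chi V ∈ coinv G L := smul_sub_mem_coinv hV g⁻¹

variable [TopologicalSpace G]

variable (G) in
/-- The orbit maps of `G` on the stable set `L` are open. -/
structure HasOpenOrbits (L : Set X) : Prop where
  smul_mem : ∀ (g : G) x, g • x ∈ L ↔ x ∈ L
  orbit_mem_nhdsWithin : ∀ x ∈ L, ∀ N ∈ 𝓝 (1 : G), {y | ∃ g ∈ N, g • x = y} ∈ 𝓝[L] x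

lemma HasOpenOrbits.isCompactOpenIn [ContinuousSMul G X] (hL : HasOpenOrbits G L) {K : Subgroup G}
    (hKo : IsOpen (K : Set G)) (hKc : IsCompact (K : Set G)) {x : X} (hx : x ∈ L) :
    IsCompactOpenIn L (orb K {x}) := by
  refine ⟨?_, ?_, ?_⟩
  · rintro _ ⟨g, -, v, rfl, rfl⟩
    exact (hL.smul_mem g v).2 hx
  · have : orb K {x} = (fun g : G => g • x) '' (K : Set G) := by
      ext y; simp [orb]
    rw [this]
    exact hKc.image (continuous_id.smul continuous_const)
  · rintro _ ⟨g, hg, v, rfl, rfl⟩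
    filter_upwards [hL.orbit_mem_nhdsWithin (g • v) ((hL.smul_mem g v).2 hx) K
      (hKo.mem_nhds K.one_mem)]
    rintro _ ⟨g', hg', rfl⟩
    exact ⟨g' * g, K.mul_mem hg' hg, v, rfl, mul_smul _ _ _⟩

/-- A compact open subset of a `G`-stable set is preserved by a neighbourhood of the identity. -/
lemma eventually_smul_mem [ContinuousSMul G X] (hL : ∀ (g : G) x, g • x ∈ L ↔ x ∈ L) {V : Set X}
    (hV : IsCompactOpenIn L V) : ∀ᶠ g in 𝓝 (1 : G), ∀ x ∈ V, g • x ∈ V := by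
  have key : ∀ᶠ g in 𝓝 (1 : G), ∀ x ∈ V, x ∈ L → g • x ∈ V := by
    refine hV.isCompact.eventually_forall_of_forall_eventually fun x hx => ?_
    have h1 : Filter.Tendsto (fun z : G × X => z.1 • z.2) (𝓝 (1, x)) (𝓝 x) := by
      have := (continuous_smul (M := G) (X := X)).tendsto (1, x)
      rwa [one_smul] at this
    filter_upwards [h1.eventually (mem_nhdsWithin_iff_eventually.1 (hV.mem_nhdsWithin x hx))]
      with z hz hzL
    exact hz ((hL _ _).2 hzL)
  filter_upwards [key] with g hg x hx
  exact hg x hx (hV.subset hx)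

/-- A compact open subset is a finite disjoint union of orbits of any small compact open
subgroup. -/
lemma HasOpenOrbits.chi_eq_sum [ContinuousSMul G X] (hL : HasOpenOrbits G L) {V : Set X}
    (hV : IsCompactOpenIn L V) :
    ∃ U ∈ 𝓝 (1 : G), ∀ K : Subgroup G, IsOpen (K : Set G) → IsCompact (K : Set G) →
      (K : Set G) ⊆ U → ∃ s : Finset X, (s : Set X) ⊆ V ∧ (V.Nonempty → s.Nonempty) ∧
        chi V = ∑ x ∈ s, chi (orb K {x}) := by
  classical
  refine ⟨_, eventually_smul_mem hL.smul_mem hV, fun K hKo hKc hKU => ?_⟩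
  obtain ⟨t, ht, hVt⟩ := hV.isCompact.elim_nhdsWithin_subcover (fun x => orb K {x}) (fun x hx =>
    nhdsWithin_mono x hV.subset ((hL.isCompactOpenIn hKo hKc (hV.subset hx)).mem_nhdsWithin x
      (subset_orb _ _ rfl)))
  have hVt' : V = ⋃ x ∈ t, orb K {x} := by
    refine hVt.antisymm (iUnion₂_subset fun x hx => ?_)
    rintro _ ⟨g, hg, v, rfl, rfl⟩
    exact hKU hg _ (ht _ hx)
  have key : ∀ t : Finset X, ∃ s ⊆ t, (t.Nonempty → s.Nonempty) ∧
      chi (⋃ x ∈ t, orb K {x}) = ∑ x ∈ s, chi (orb K {x}) := by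
    intro t
    induction t using Finset.induction_on with
    | empty =>
      refine ⟨∅, subset_rfl, id, ?_⟩
      funext x
      simp [chi]
    | insert a t ha ih =>
      obtain ⟨s, hst, hne, hs⟩ := ih
      by_cases hat : a ∈ ⋃ x ∈ t, orb K {x}
      · have htne : t.Nonempty := by
          obtain ⟨x, hx, -⟩ := mem_iUnion₂.1 hat
          exact ⟨x, hx⟩
        refine ⟨s, hst.trans (Finset.subset_insert _ _), fun _ => hne htne, ?_⟩
        rw [Finset.set_biUnion_insert, ← hs, union_eq_self_of_subset_left]
        rintro _ ⟨g, hg, v, rfl, rfl⟩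
        obtain ⟨x, hx, hvx⟩ := mem_iUnion₂.1 hat
        exact mem_iUnion₂.2 ⟨x, hx, (smul_mem_orb_iff hg).2 hvx⟩
      · refine ⟨insert a s, Finset.insert_subset_insert _ hst, fun _ => Finset.insert_nonempty _ _,
          ?_⟩
        rw [Finset.set_biUnion_insert, Finset.sum_insert (fun h => ha (hst h)), ← hs, chi,
          indicator_union_of_disjoint]
        · rfl
        · refine disjoint_left.2 ?_
          rintro _ ⟨g, hg, v, rfl, rfl⟩ hgv
          obtain ⟨x, hx, hvx⟩ := mem_iUnion₂.1 hgv
          exact hat (mem_iUnion₂.2 ⟨x, hx, (smul_mem_orb_iff hg).1 hvx⟩)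
  obtain ⟨s, hst, hne, hs⟩ := key t
  refine ⟨s, fun x hx => ht x (hst hx), fun hVne => hne ?_, by rw [← hs, ← hVt']⟩
  rw [hVt'] at hVne
  obtain ⟨y, hy⟩ := hVne
  obtain ⟨x, hx, -⟩ := mem_iUnion₂.1 hy
  exact ⟨x, hx⟩

variable [IsTopologicalGroup G]

/-- In a locally compact totally disconnected group, the compact open subgroups form a basis of
neighbourhoods of the identity. -/
theorem exists_compact_open_subgroup [T2Space G] [LocallyCompactSpace G]
    [TotallyDisconnectedSpace G] {U : Set G} (hU : U ∈ 𝓝 (1 : G)) :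
    ∃ K : Subgroup G, IsOpen (K : Set G) ∧ IsCompact (K : Set G) ∧ (K : Set G) ⊆ U := by
  obtain ⟨O, hOU, hO, h1O⟩ := mem_nhds_iff.1 hU
  obtain ⟨W, hW, hWc, h1W, hWO⟩ := exists_compact_clopen hO h1O
  -- The stabilizer of `W` under left translation.
  let K : Subgroup G :=
    { carrier := {g | ∀ x, g * x ∈ W ↔ x ∈ W}
      one_mem' := fun x => by rw [one_mul]
      mul_mem' := fun {a b} ha hb x => by rw [mul_assoc, ha, hb]
      inv_mem' := fun {a} ha x => by rw [← ha, mul_inv_cancel_left] }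
  have hKW : (K : Set G) ⊆ W := fun g hg => by
    have := (hg 1).2 h1W
    rwa [mul_one] at this
  have hWL : IsCompactOpenIn (univ : Set G) W :=
    ⟨subset_univ _, hWc, fun x hx => mem_nhdsWithin_of_mem_nhds (hW.2.mem_nhds hx)⟩
  have hev : ∀ᶠ g in 𝓝 (1 : G), ∀ x ∈ W, g • x ∈ W := eventually_smul_mem (by simp) hWL
  have hev' : ∀ᶠ g in 𝓝 (1 : G), ∀ x ∈ W, g⁻¹ • x ∈ W := by
    have : Filter.Tendsto (fun g : G => g⁻¹) (𝓝 1) (𝓝 1) := by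
      simpa using (continuous_inv (G := G)).tendsto 1
    exact this.eventually hev
  have hK : (K : Set G) ∈ 𝓝 (1 : G) := by
    filter_upwards [hev, hev'] with g h1 h2 x
    refine ⟨fun h => ?_, fun h => h1 x h⟩
    have := h2 _ h
    rwa [smul_eq_mul, inv_mul_cancel_left] at this
  have hKo := K.isOpen_of_mem_nhds hK
  exact ⟨K, hKo, hWc.of_isClosed_subset (K.isClosed_of_isOpen hKo) hKW, hKW.trans (hWO.trans hOU)⟩

/-- Counting the translates of `K' V` that cover the points of `K V`: if every point of `V` lies in
exactly `n` of the translates of `K' V` by `K ⧸ K'`, then the class of `K V` in the coinvariants is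
`[K : K'] / n` times that of `K' V`. -/
lemma relIndex_smul_chi_orb_sub {K K' : Subgroup G} (hK : IsCompact (K : Set G))
    (hK' : IsOpen (K' : Set G)) {V : Set X} (hle : K' ≤ K) (hV : chi (orb K' V) ∈ testOn L) (n : ℕ)
    (hn : ∀ v ∈ V, Nat.card {q : K ⧸ K'.subgroupOf K // (q.out : G)⁻¹ • v ∈ orb K' V} = n) :
    (K'.relIndex K : ℂ) • chi (orb K' V) - (n : ℂ) • chi (orb K V) ∈ coinv G L := by
  classical
  have : CompactSpace K := isCompact_iff_compactSpace.1 hK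
  have hfin : Finite (K ⧸ K'.subgroupOf K) :=
    Subgroup.quotient_finite_of_isOpen _ (hK'.preimage continuous_subtype_val)
  have := Fintype.ofFinite (K ⧸ K'.subgroupOf K)
  have hsum : ∑ q : K ⧸ K'.subgroupOf K, chi (((q.out : G)⁻¹ • ·) ⁻¹' orb K' V) =
      (n : ℂ) • chi (orb K V) := by
    funext y
    rw [Finset.sum_apply, Pi.smul_apply]
    by_cases hy : y ∈ orb K V
    · obtain ⟨k, hk, v, hv, rfl⟩ := id hy
      rw [chi_of_mem hy, ← hn v hv]
      -- The multiplicity at `k • v` is the one at `v`, because `k` permutes the cosets.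
      let r : X → K ⧸ K'.subgroupOf K → ℂ := fun x q => chi (orb K' V) ((q.out : G)⁻¹ • x)
      have hr : ∀ x (a : K), r x (a : K ⧸ K'.subgroupOf K) = chi (orb K' V) ((a : G)⁻¹ • x) := by
        intro x a
        obtain ⟨b, hb⟩ := QuotientGroup.mk_out_eq_mul (K'.subgroupOf K) a
        have hb' : ((b : K) : G)⁻¹ ∈ K' := K'.inv_mem (Subgroup.mem_subgroupOf.1 b.2)
        simp only [r, hb, Subgroup.coe_mul, _root_.mul_inv_rev, mul_smul, chi]
        by_cases h : (a : G)⁻¹ • x ∈ orb K' V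
        · rw [indicator_of_mem h, indicator_of_mem ((smul_mem_orb_iff hb').2 h)]; rfl
        · rw [indicator_of_notMem h,
            indicator_of_notMem (fun h' => h ((smul_mem_orb_iff hb').1 h'))]
      have h1 : ∀ q, chi (((q.out : G)⁻¹ • ·) ⁻¹' orb K' V) (k • v) =
          r v ((⟨k, hk⟩ : K)⁻¹ • q) := by
        intro q
        obtain ⟨a, rfl⟩ := QuotientGroup.mk_surjective q
        change r (k • v) _ = r v ((⟨k, hk⟩ : K)⁻¹ * a : K)
        rw [hr, hr, smul_smul]
        simp
      rw [Finset.sum_congr rfl fun q _ => h1 q,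
        (MulAction.bijective ((⟨k, hk⟩ : K)⁻¹)).sum_comp (r v)]
      have h2 : ∀ q, r v q = if (q.out : G)⁻¹ • v ∈ orb K' V then 1 else 0 := fun q => by
        simp only [r, chi, indicator, Pi.one_apply]
      rw [Finset.sum_congr rfl fun q _ => h2 q, Finset.sum_boole, Nat.card_eq_fintype_card,
        Fintype.card_subtype]
      simp
    · rw [chi_of_notMem hy, smul_zero]
      refine Finset.sum_eq_zero fun q _ => chi_of_notMem fun ⟨k, hk, v, hv, h⟩ => hy ?_
      refine ⟨q.out * k, K.mul_mem q.out.2 (hle hk), v, hv, ?_⟩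
      rw [mul_smul, h, smul_inv_smul]
  rw [← hsum, show (K'.relIndex K : ℂ) • chi (orb K' V) =
    ∑ q : K ⧸ K'.subgroupOf K, chi (orb K' V) by
      rw [Finset.sum_const, Finset.card_univ, Subgroup.relIndex, Subgroup.index,
        Nat.card_eq_fintype_card, Nat.cast_smul_eq_nsmul], ← Finset.sum_sub_distrib]
  refine Submodule.sum_mem _ fun q _ => ?_
  rw [← neg_sub]
  exact neg_mem (chi_smul_sub_mem_coinv hV _)

variable [T2Space X] [ContinuousSMul G X]

lemma HasOpenOrbits.posEquiv_of_le (hL : HasOpenOrbits G L) {K K' : Subgroup G}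
    (hKc : IsCompact (K : Set G)) (hK'o : IsOpen (K' : Set G)) (hle : K' ≤ K) {x : X}
    (hx : x ∈ L) : PosEquiv G L (chi (orb K {x})) (chi (orb K' {x})) := by
  have hK'c : IsCompact (K' : Set G) := hKc.of_isClosed_subset (K'.isClosed_of_isOpen hK'o) hle
  have : CompactSpace K := isCompact_iff_compactSpace.1 hKc
  have hfin : Finite (K ⧸ K'.subgroupOf K) :=
    Subgroup.quotient_finite_of_isOpen _ (hK'o.preimage continuous_subtype_val)
  have key := relIndex_smul_chi_orb_sub hKc hK'o hle
    (chi_mem_testOn (hL.isCompactOpenIn hK'o hK'c hx)) _ (fun v (hv : v ∈ ({x} : Set X)) => by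
      rw [mem_singleton_iff.1 hv])
  set n := Nat.card {q : K ⧸ K'.subgroupOf K // (q.out : G)⁻¹ • x ∈ orb K' {x}} with hn
  have hn0 : 0 < n := by
    have : Nonempty {q : K ⧸ K'.subgroupOf K // (q.out : G)⁻¹ • x ∈ orb K' {x}} := by
      refine ⟨((1 : K) : K ⧸ K'.subgroupOf K), ?_⟩
      obtain ⟨b, hb⟩ := QuotientGroup.mk_out_eq_mul (K'.subgroupOf K) 1
      rw [hb, one_mul]
      exact (smul_mem_orb_iff (K'.inv_mem (Subgroup.mem_subgroupOf.1 b.2))).2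
        (subset_orb _ _ rfl)
    exact Nat.card_pos
  have hi0 : 0 < K'.relIndex K := by
    rw [Subgroup.relIndex, Subgroup.index]; exact Nat.card_pos
  refine PosEquiv.symm ⟨n / K'.relIndex K, by positivity, ?_⟩
  have hi0' : (K'.relIndex K : ℂ) ≠ 0 := by exact_mod_cast hi0.ne'
  have := Submodule.smul_mem _ (K'.relIndex K : ℂ)⁻¹ key
  convert this using 1
  rw [smul_sub, smul_smul, smul_smul, inv_mul_cancel₀ hi0', one_smul]
  congr 2
  push_cast
  ring

lemma HasOpenOrbits.posEquiv_subgroups (hL : HasOpenOrbits G L) {K K' : Subgroup G}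
    (hKo : IsOpen (K : Set G)) (hKc : IsCompact (K : Set G)) (hK'o : IsOpen (K' : Set G))
    (hK'c : IsCompact (K' : Set G)) {x : X} (hx : x ∈ L) :
    PosEquiv G L (chi (orb K {x})) (chi (orb K' {x})) := by
  have ho : IsOpen ((K ⊓ K' : Subgroup G) : Set G) := hKo.inter hK'o
  exact (hL.posEquiv_of_le hKc ho inf_le_left hx).trans
    (hL.posEquiv_of_le hK'c ho inf_le_right hx).symm

lemma HasOpenOrbits.posEquiv_smul (hL : HasOpenOrbits G L) {K : Subgroup G}
    (hKo : IsOpen (K : Set G)) (hKc : IsCompact (K : Set G)) {x : X} (hx : x ∈ L) (g : G) :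
    PosEquiv G L (chi (orb K {g • x})) (chi (orb K {x})) := by
  have h1 := isOpen_comap_conj hKo g
  have h2 := isCompact_comap_conj hKc g
  refine PosEquiv.trans ⟨1, one_pos, ?_⟩ (hL.posEquiv_subgroups h1 h2 hKo hKc hx)
  rw [← image_singleton, orb_image_smul, Complex.ofReal_one, one_smul]
  exact chi_smul_sub_mem_coinv (chi_mem_testOn (hL.isCompactOpenIn h1 h2 hx)) g

variable [T2Space G] [LocallyCompactSpace G] [TotallyDisconnectedSpace G]

/-- Two nonempty compact open subsets of the same orbit have positively proportional classes in the
coinvariants: on an orbit, an invariant distribution is a multiple of a positive measure. -/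
theorem HasOpenOrbits.posEquiv_chi (hL : HasOpenOrbits G L) {V V' : Set X}
    (hV : IsCompactOpenIn L V) (hV' : IsCompactOpenIn L V') (hne : V.Nonempty) (hne' : V'.Nonempty)
    (x : X) (hx : x ∈ L) (hVx : ∀ y ∈ V, ∃ g : G, y = g • x) (hVx' : ∀ y ∈ V', ∃ g : G, y = g • x) :
    PosEquiv G L (chi V) (chi V') := by
  obtain ⟨U, hU, h⟩ := hL.chi_eq_sum hV
  obtain ⟨U', hU', h'⟩ := hL.chi_eq_sum hV'
  obtain ⟨K, hKo, hKc, hK⟩ := exists_compact_open_subgroup (Filter.inter_mem hU hU')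
  obtain ⟨s, hs, hsne, hVs⟩ := h K hKo hKc (hK.trans inter_subset_left)
  obtain ⟨s', hs', hsne', hVs'⟩ := h' K hKo hKc (hK.trans inter_subset_right)
  have key : ∀ s : Finset X, s.Nonempty → (∀ y ∈ s, ∃ g : G, y = g • x) →
      PosEquiv G L (∑ y ∈ s, chi (orb K {y})) (chi (orb K {x})) := by
    intro s hne hs
    refine Finset.sum_induction_nonempty (fun y => chi (orb K {y}))
      (fun f => PosEquiv G L f (chi (orb K {x}))) ?_ hne ?_
    · rintro f f' ⟨c, hc, h⟩ ⟨c', hc', h'⟩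
      refine ⟨c + c', add_pos hc hc', ?_⟩
      convert add_mem h h' using 1
      rw [Complex.ofReal_add, add_smul]
      abel
    · intro y hy
      obtain ⟨g, rfl⟩ := hs y hy
      exact hL.posEquiv_smul hKo hKc hx g
  rw [hVs, hVs']
  exact (key s (hsne hne) fun y hy => hVx y (hs hy)).trans
    (key s' (hsne' hne') fun y hy => hVx' y (hs' hy)).symm

/-- If the orbits of `G` on `L` are open and preserved by `τ`, then the anti-coinvariants of `L`
vanish. -/
theorem HasOpenOrbits.testOn_le_antiCoinv (hL : HasOpenOrbits G L) {τ : X ≃ₜ X}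
    (hτ : ∀ x, τ x ∈ L ↔ x ∈ L) (horb : ∀ x ∈ L, ∃ g : G, τ x = g • x) :
    testOn L ≤ antiCoinv G τ L := by
  refine testOn_le fun V hV => ?_
  obtain ⟨U, hU, h⟩ := hL.chi_eq_sum hV
  obtain ⟨K, hKo, hKc, hK⟩ := exists_compact_open_subgroup hU
  obtain ⟨s, hs, -, hVs⟩ := h K hKo hKc hK
  rw [hVs]
  refine Submodule.sum_mem _ fun x hx => ?_
  have hxL := hV.subset (hs hx)
  have hco := hL.isCompactOpenIn hKo hKc hxL
  refine mem_antiCoinv_of_posEquiv (chi_mem_testOn hco) ?_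
  rw [chi_comp]
  refine hL.posEquiv_chi (hco.preimage τ hτ) hco ?_ ⟨x, subset_orb _ _ rfl⟩ x hxL ?_ ?_
  · exact ⟨τ.symm x, by rw [mem_preimage, τ.apply_symm_apply]; exact subset_orb _ _ rfl⟩
  · rintro y ⟨g, hg, v, hv, hy⟩
    rw [mem_singleton_iff.1 hv] at hy
    have hyL : y ∈ L := by
      rw [← hτ, ← hy]
      exact (hL.smul_mem _ _).2 hxL
    obtain ⟨g', hg'⟩ := horb y hyL
    refine ⟨g'⁻¹ * g, ?_⟩
    rw [mul_smul, hy, hg', inv_smul_smul]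
  · rintro _ ⟨g, hg, v, hv, rfl⟩
    exact ⟨g, by rw [mem_singleton_iff.1 hv]⟩

end Orbits

end InvariantDistribution

namespace FourierJacobi

/-! ### Local fields -/

section LocalField

open ValuativeRel

variable (k : Type*) [Field k] [ValuativeRel k] [TopologicalSpace k] [IsNonarchimedeanLocalField k]

instance instT2SpaceLocalField : T2Space k := by
  let := IsTopologicalAddGroup.rightUniformSpace k
  have := isUniformAddGroup_of_addCommGroup (G := k)
  infer_instance

instance instTotallySeparatedSpaceLocalField : TotallySeparatedSpace k := by
  have : NonarchimedeanAddGroup k :=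
    { is_nonarchimedean := fun U hU => by
        obtain ⟨γ, hγ⟩ := (IsValuativeTopology.mem_nhds_zero_iff U).1 hU
        have hmem : ((valuation k).ltAddSubgroup γ : Set k) ∈ 𝓝 (0 : k) :=
          (IsValuativeTopology.mem_nhds_zero_iff _).2 ⟨γ, fun x hx => hx⟩
        exact ⟨⟨(valuation k).ltAddSubgroup γ, AddSubgroup.isOpen_of_mem_nhds _ hmem⟩, hγ⟩ }
  infer_instance

lemma isOpen_integers : IsOpen {x : k | valuation k x ≤ 1} := by
  rw [isOpen_iff_mem_nhds]
  intro x hx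
  rw [IsValuativeTopology.mem_nhds_iff']
  refine ⟨1, fun y hy => ?_⟩
  have := (valuation k).map_add (y - x) x
  rw [sub_add_cancel] at this
  exact this.trans (max_le (le_of_lt (by simpa using hy)) hx)

lemma exists_uniformizing : ∃ ϖ : k, ϖ ≠ 0 ∧ valuation k ϖ < 1 := by
  obtain ⟨x, hx, hx'⟩ := Valuation.IsNontrivial.exists_lt_one (v := valuation k)
  exact ⟨x, by simpa using hx, hx'⟩

/-- Hensel's lemma for the equation `y² + y = a`. -/
lemma exists_sq_add_self_eq (a : k) (ha : valuation k a < 1) :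
    ∃ y, y * y + y = a ∧ valuation k y = valuation k a := by
  let := IsTopologicalAddGroup.rightUniformSpace k
  have := isUniformAddGroup_of_addCommGroup (G := k)
  have hmem : ∀ x : 𝒪[k], x ∈ 𝓂[k] ↔ valuation k (x : k) < 1 := fun x =>
    (IsLocalRing.mem_maximalIdeal _).trans Valuation.Integer.not_isUnit_iff_valuation_lt_one
  let a' : 𝒪[k] := ⟨a, ha.le⟩
  have ha' : a' ∈ 𝓂[k] := (hmem a').2 ha
  obtain ⟨y, hy, hy'⟩ := HenselianRing.is_henselian (I := 𝓂[k])
    (Polynomial.X ^ 2 + Polynomial.X - Polynomial.C a' : Polynomial 𝒪[k])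
    (by monicity!) 0 (by simpa using ha') (by simp)
  have hy1 : valuation k (y : k) < 1 := (hmem y).1 (by simpa using hy')
  have h1 : (y : k) * y + y = a := by
    have := congrArg (Subtype.val) (show y ^ 2 + y = a' by
      simpa [Polynomial.IsRoot, sub_eq_zero] using hy)
    simpa [sq] using this
  refine ⟨y, h1, ?_⟩
  rw [← h1, ← add_one_mul, map_mul, add_comm, Valuation.map_one_add_of_lt _ hy1, one_mul]

/-- A local square root near `1`: if `z` is close to `1`, then `(z - 1) / 4 = y² + y` has a small
root `y` by Hensel's lemma, and `(1 + 2 y)² = z`. -/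
theorem exists_local_sqrt (two_ne : (2 : k) ≠ 0) :
    ∃ r : k → k, ContinuousAt r 1 ∧ r 1 = 1 ∧ ∀ᶠ z in 𝓝 1, r z * r z = z := by
  classical
  have four_ne : (4 : k) ≠ 0 := by
    have : (4 : k) = 2 * 2 := by norm_num
    rw [this]; exact mul_ne_zero two_ne two_ne
  choose! y hy hy' using exists_sq_add_self_eq k
  let r : k → k := fun z => 1 + 2 * y ((z - 1) / 4)
  have h0 : y 0 = 0 := by
    have := hy' 0 (by simp)
    simpa using this
  have hc : Filter.Tendsto (fun z : k => (z - 1) / 4) (𝓝 1) (𝓝 0) := by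
    have : Continuous (fun z : k => (z - 1) / 4) := by fun_prop
    simpa using this.tendsto 1
  have hlt : ∀ᶠ a in 𝓝 (0 : k), valuation k a < 1 := by
    filter_upwards [(IsValuativeTopology.hasBasis_nhds_zero k).mem_of_mem (i := 1) trivial]
      with a ha
    simpa using ha
  have hy0 : Filter.Tendsto y (𝓝 0) (𝓝 0) := by
    rw [(IsValuativeTopology.hasBasis_nhds_zero k).tendsto_right_iff]
    intro γ _
    filter_upwards [hlt, (IsValuativeTopology.hasBasis_nhds_zero k).mem_of_mem (i := γ) trivial]
      with a ha ha'
    rw [hy' a ha]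
    exact ha'
  refine ⟨r, ?_, by simp [r, h0], ?_⟩
  · have : Filter.Tendsto r (𝓝 1) (𝓝 (1 + 2 * 0)) :=
      ((hy0.comp hc).const_mul 2).const_add 1
    rw [ContinuousAt]
    convert this using 2
    simp [r, h0]
  · filter_upwards [hc.eventually hlt] with z hz
    have := hy _ hz
    simp only [r]
    linear_combination 4 * this + div_mul_cancel₀ (z - 1) four_ne

end LocalField

/-! ### Frames and invariants on `GL(2) × k²` -/

section Frames

variable {k : Type*} [Field k]

/-- The columns of `M` form a frame in which `g` has matrix `C` and `v` has coordinates `e`. -/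
structure IsFrame (C : Matrix (Fin 2) (Fin 2) k) (e : Fin 2 → k) (M : Matrix (Fin 2) (Fin 2) k)
    (b : GL (Fin 2) k × (Fin 2 → k)) : Prop where
  mul_eq : (b.1 : Matrix (Fin 2) (Fin 2) k) * M = M * C
  mulVec_eq : M *ᵥ e = b.2

/-- The `2 × 2` matrix with given columns. -/
def cols (u w : Fin 2 → k) : Matrix (Fin 2) (Fin 2) k := !![u 0, w 0; u 1, w 1]

lemma det_cols (u w : Fin 2 → k) : (cols u w).det = u 0 * w 1 - u 1 * w 0 := by
  rw [cols, det_fin_two_of]; ring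

lemma mul_cols (A : Matrix (Fin 2) (Fin 2) k) (u w : Fin 2 → k) :
    A * cols u w = cols (A *ᵥ u) (A *ᵥ w) := by
  ext i j
  fin_cases i <;> fin_cases j <;>
    simp [cols, Matrix.mul_apply, Matrix.mulVec, dotProduct, Fin.sum_univ_two]

lemma cols_mul (u w : Fin 2 → k) (a b c d : k) :
    cols u w * !![a, b; c, d] = cols (a • u + c • w) (b • u + d • w) := by
  ext i j
  fin_cases i <;> fin_cases j <;>
    simp [cols, Matrix.mul_apply, Fin.sum_univ_two, mul_comm]

lemma cols_mulVec (u w : Fin 2 → k) (a b : k) : cols u w *ᵥ ![a, b] = a • u + b • w := by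
  ext i
  fin_cases i <;> simp [cols, Matrix.mulVec, dotProduct, Fin.sum_univ_two, mul_comm]

lemma mulVec_fin_two (A : Matrix (Fin 2) (Fin 2) k) (u : Fin 2 → k) :
    A *ᵥ u = ![A 0 0 * u 0 + A 0 1 * u 1, A 1 0 * u 0 + A 1 1 * u 1] := by
  ext i
  fin_cases i <;> simp [Matrix.mulVec, dotProduct, Fin.sum_univ_two]

/-- The determinant of `(v, g v)`; it is an invariant of `SL(2)` on `GL(2) × k²`. -/
def qInv (b : GL (Fin 2) k × (Fin 2 → k)) : k :=
  (cols b.2 ((b.1 : Matrix (Fin 2) (Fin 2) k) *ᵥ b.2)).det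

/-- Cayley–Hamilton for a `2 × 2` matrix applied to a vector. -/
lemma mulVec_mulVec_eq (A : Matrix (Fin 2) (Fin 2) k) (u : Fin 2 → k) :
    A *ᵥ (A *ᵥ u) = A.trace • (A *ᵥ u) - A.det • u := by
  ext i
  fin_cases i <;> simp [trace_fin_two, det_fin_two] <;> ring

/-- In the frame `(u, g u)`, the matrix of `g` is the companion matrix. -/
lemma mul_cols_self (A : Matrix (Fin 2) (Fin 2) k) (u : Fin 2 → k) :
    A * cols u (A *ᵥ u) = cols u (A *ᵥ u) * !![0, -A.det; 1, A.trace] := by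
  rw [mul_cols, cols_mul, mulVec_mulVec_eq]
  congr 1
  · simp
  · rw [neg_smul]; abel

lemma sl_inv_mul (s : SL(2, k)) :
    ((s⁻¹ : SL(2, k)) : Matrix (Fin 2) (Fin 2) k) * (s : Matrix (Fin 2) (Fin 2) k) = 1 :=
  congrArg Subtype.val (inv_mul_cancel s)

lemma sl_mul_val (s s' : SL(2, k)) : ((s * s' : SL(2, k)) : Matrix (Fin 2) (Fin 2) k) =
    (s : Matrix (Fin 2) (Fin 2) k) * (s' : Matrix (Fin 2) (Fin 2) k) := rfl

lemma sl_mul_inv (s : SL(2, k)) :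
    (s : Matrix (Fin 2) (Fin 2) k) * ((s⁻¹ : SL(2, k)) : Matrix (Fin 2) (Fin 2) k) = 1 :=
  congrArg Subtype.val (mul_inv_cancel s)

variable [TopologicalSpace k] [IsTopologicalRing k]

lemma slAct_fst (s : SL(2, k)) (b : GL (Fin 2) k × (Fin 2 → k)) :
    ((slAct s b).1 : Matrix (Fin 2) (Fin 2) k) = (s : Matrix (Fin 2) (Fin 2) k) *
      (b.1 : Matrix (Fin 2) (Fin 2) k) * ((s⁻¹ : SL(2, k)) : Matrix (Fin 2) (Fin 2) k) := by
  change ((s : GL (Fin 2) k) * b.1 * (s : GL (Fin 2) k)⁻¹ : GL (Fin 2) k).val = _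
  rw [← map_inv]
  rfl

lemma slAct_snd (s : SL(2, k)) (b : GL (Fin 2) k × (Fin 2 → k)) :
    (slAct s b).2 = (s : Matrix (Fin 2) (Fin 2) k) *ᵥ b.2 := rfl

lemma slAct_fst_mul (s : SL(2, k)) (b : GL (Fin 2) k × (Fin 2 → k)) :
    ((slAct s b).1 : Matrix (Fin 2) (Fin 2) k) * (s : Matrix (Fin 2) (Fin 2) k) =
      (s : Matrix (Fin 2) (Fin 2) k) * (b.1 : Matrix (Fin 2) (Fin 2) k) := by
  rw [slAct_fst, Matrix.mul_assoc, sl_inv_mul, Matrix.mul_one]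

lemma slAct_one (b : GL (Fin 2) k × (Fin 2 → k)) : slAct 1 b = b :=
  Prod.ext (Units.ext (by rw [slAct_fst]; simp)) (by rw [slAct_snd]; simp)

lemma slAct_mul (s s' : SL(2, k)) (b : GL (Fin 2) k × (Fin 2 → k)) :
    slAct (s * s') b = slAct s (slAct s' b) :=
  Prod.ext (Units.ext (by
    rw [slAct_fst, slAct_fst, slAct_fst, _root_.mul_inv_rev, sl_mul_val,
      sl_mul_val]
    simp only [Matrix.mul_assoc])) (by
    rw [slAct_snd, slAct_snd, slAct_snd, sl_mul_val, mulVec_mulVec])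

lemma IsFrame.slAct {C M : Matrix (Fin 2) (Fin 2) k} {e : Fin 2 → k}
    {b : GL (Fin 2) k × (Fin 2 → k)} (h : IsFrame C e M b) (s : SL(2, k)) :
    IsFrame C e ((s : Matrix (Fin 2) (Fin 2) k) * M) (FourierJacobi.slAct s b) := by
  refine ⟨?_, ?_⟩
  · rw [← Matrix.mul_assoc, slAct_fst_mul, Matrix.mul_assoc, h.mul_eq, Matrix.mul_assoc]
  · rw [slAct_snd, ← mulVec_mulVec, h.mulVec_eq]

/-- Pairs `(g, v)` with the same coordinates in frames of the same determinant are conjugate under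
`SL(2)`. -/
lemma IsFrame.exists_slAct {C M M' : Matrix (Fin 2) (Fin 2) k} {e : Fin 2 → k}
    {b b' : GL (Fin 2) k × (Fin 2 → k)} (h : IsFrame C e M b) (h' : IsFrame C e M' b')
    (hdet : M'.det = M.det) (hne : M.det ≠ 0) :
    ∃ s : SL(2, k), (s : Matrix (Fin 2) (Fin 2) k) = M' * M⁻¹ ∧ FourierJacobi.slAct s b = b' := by
  have hu : IsUnit M.det := isUnit_iff_ne_zero.2 hne
  let s : SL(2, k) := ⟨M' * M⁻¹, by
    rw [det_mul, det_nonsing_inv, hdet, Ring.mul_inverse_cancel _ hu]⟩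
  have hs : (s : Matrix (Fin 2) (Fin 2) k) * M = M' := by
    change M' * M⁻¹ * M = M'
    rw [Matrix.mul_assoc, nonsing_inv_mul _ hu, Matrix.mul_one]
  refine ⟨s, rfl, ?_⟩
  have h2 := h.slAct s
  rw [hs] at h2
  have hu' : IsUnit M'.det := hdet ▸ hu
  refine Prod.ext (Units.ext ?_) (h2.mulVec_eq.symm.trans h'.mulVec_eq)
  have h3 := h2.mul_eq.trans h'.mul_eq.symm
  have h4 := congrArg (· * M'⁻¹) h3
  simpa [Matrix.mul_assoc, mul_nonsing_inv _ hu'] using h4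

lemma trace_slAct (s : SL(2, k)) (b : GL (Fin 2) k × (Fin 2 → k)) :
    ((slAct s b).1 : Matrix (Fin 2) (Fin 2) k).trace =
      (b.1 : Matrix (Fin 2) (Fin 2) k).trace := by
  rw [slAct_fst, Matrix.trace_mul_comm, ← Matrix.mul_assoc, sl_inv_mul, Matrix.one_mul]

lemma det_slAct (s : SL(2, k)) (b : GL (Fin 2) k × (Fin 2 → k)) :
    ((slAct s b).1 : Matrix (Fin 2) (Fin 2) k).det = (b.1 : Matrix (Fin 2) (Fin 2) k).det := by
  rw [slAct_fst, det_mul, det_mul, s.2, (s⁻¹).2, one_mul, mul_one]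

lemma qInv_slAct (s : SL(2, k)) (b : GL (Fin 2) k × (Fin 2 → k)) :
    qInv (slAct s b) = qInv b := by
  rw [qInv, qInv, slAct_snd, mulVec_mulVec, slAct_fst_mul, ← mulVec_mulVec, ← mul_cols, det_mul,
    s.2, one_mul]

lemma tauPrime_fst (b : GL (Fin 2) k × (Fin 2 → k)) :
    ((tauPrime k b).1 : Matrix (Fin 2) (Fin 2) k) =
      !![b.1 0 0, -b.1 1 0; -b.1 0 1, b.1 1 1] := by
  change !![1, 0; 0, -1] * (b.1 : Matrix (Fin 2) (Fin 2) k)ᵀ * !![1, 0; 0, -1] = _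
  ext i j
  fin_cases i <;> fin_cases j <;>
    simp [Matrix.mul_apply, Matrix.vecMul, dotProduct, Fin.sum_univ_two]

lemma tauPrime_snd (b : GL (Fin 2) k × (Fin 2 → k)) : (tauPrime k b).2 = ![b.2 1, b.2 0] := by
  change d₂ k *ᵥ b.2 = _
  ext i
  fin_cases i <;> simp [d₂, Matrix.mulVec, dotProduct, Fin.sum_univ_two]

lemma trace_tauPrime (b : GL (Fin 2) k × (Fin 2 → k)) :
    ((tauPrime k b).1 : Matrix (Fin 2) (Fin 2) k).trace =
      (b.1 : Matrix (Fin 2) (Fin 2) k).trace := by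
  rw [tauPrime_fst, trace_fin_two, trace_fin_two]; simp

lemma det_tauPrime (b : GL (Fin 2) k × (Fin 2 → k)) :
    ((tauPrime k b).1 : Matrix (Fin 2) (Fin 2) k).det =
      (b.1 : Matrix (Fin 2) (Fin 2) k).det := by
  rw [tauPrime_fst, det_fin_two_of, det_fin_two]; ring

lemma qInv_tauPrime (b : GL (Fin 2) k × (Fin 2 → k)) : qInv (tauPrime k b) = qInv b := by
  rw [qInv, qInv, tauPrime_fst, tauPrime_snd, det_cols, det_cols, mulVec_fin_two, mulVec_fin_two]
  simp
  ring

/-- The behaviour of frames under the involution, with `tr g` a scalar matrix: since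
`d₁⁻¹ ᵗg d₁ = d₂ (tr g - g) d₂`, a frame `(u, w)` of `(g, v)` gives the frame `(d₂ u, -d₂ w)` of its
image. -/
lemma IsFrame.tauPrime {M : Matrix (Fin 2) (Fin 2) k} {a b c d e : k}
    {x : GL (Fin 2) k × (Fin 2 → k)} (h : IsFrame !![a, b; c, d] ![e, 0] M x)
    (htr : (x.1 : Matrix (Fin 2) (Fin 2) k).trace = a + d) :
    IsFrame !![d, b; c, a] ![e, 0] !![M 1 0, -M 1 1; M 0 0, -M 0 1]
      (FourierJacobi.tauPrime k x) := by
  have h1 := h.mul_eq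
  have h2 := h.mulVec_eq
  rw [← Matrix.ext_iff] at h1
  simp only [Matrix.mul_apply, Fin.sum_univ_two, Fin.forall_fin_two] at h1
  rw [trace_fin_two] at htr
  refine ⟨?_, ?_⟩
  · rw [tauPrime_fst]
    simp at h1
    ext i j
    fin_cases i <;> fin_cases j <;> simp [Matrix.mul_apply, Fin.sum_univ_two]
    · linear_combination (M 1 0) * htr - h1.2.1
    · linear_combination -(M 1 1) * htr + h1.2.2
    · linear_combination (M 0 0) * htr - h1.1.1
    · linear_combination -(M 0 1) * htr + h1.1.2
  · rw [tauPrime_snd, ← h2]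
    ext i
    fin_cases i <;> simp [mul_comm]

end Frames

open InvariantDistribution Set

/-! ### Spaces fibred over `GL(2) × k²` -/

section Fibration

lemma continuous_cols {k Y : Type*} [TopologicalSpace k] [TopologicalSpace Y]
    {u w : Y → Fin 2 → k} (hu : Continuous u) (hw : Continuous w) :
    Continuous fun y => cols (u y) (w y) := by
  refine continuous_matrix fun i j => ?_
  have h : ∀ {f : Y → Fin 2 → k}, Continuous f → ∀ i, Continuous fun y => f y i :=
    fun hf i => (continuous_apply i).comp hf
  fin_cases i <;> fin_cases j
  · exact h hu 0
  · exact h hw 0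
  · exact h hu 1
  · exact h hw 1

/-- A `G`-space `X` over `GL(2) × k²`, where `G` is an extension of `SL(2)` split by `sec`.
The kernel of `proj : G → SL(2)` acts simply transitively on the fibres of
`(param, base) : X → Λ × (GL(2) × k²)`: each `x` is obtained by `shift x` from the point of the
`SL(2)`-equivariant section `point` over `(param x, base x)`. -/
structure SLFibration (k G X Λ : Type*) [Field k] [TopologicalSpace k] [IsTopologicalRing k]
    [Group G] [TopologicalSpace G] [TopologicalSpace X] [MulAction G X] [TopologicalSpace Λ] where
  /-- The projection of the group to `SL(2)`. -/
  proj : G →* SL(2, k)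
  /-- The splitting of `proj`. -/
  sec : SL(2, k) →* G
  /-- The parameter, on which `G` acts trivially. -/
  param : X → Λ
  /-- The equivariant map to `GL(2) × k²`. -/
  base : X → GL (Fin 2) k × (Fin 2 → k)
  /-- The element of the kernel of `proj` that carries a point of the section to `x`. -/
  shift : X → G
  /-- The section of `(param, base)`. -/
  point : Λ → GL (Fin 2) k × (Fin 2 → k) → X
  continuous_proj : Continuous proj
  continuous_sec : Continuous sec
  continuous_param : Continuous param
  continuous_base : Continuous base
  continuous_shift : Continuous shift
  continuous_point : ∀ l, Continuous (point l)
  proj_sec : ∀ s, proj (sec s) = s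
  proj_shift : ∀ x, proj (shift x) = 1
  shift_smul_point : ∀ x, shift x • point (param x) (base x) = x
  sec_smul_point : ∀ s l b, sec s • point l b = point l (slAct s b)
  param_smul : ∀ (g : G) x, param (g • x) = param x
  base_smul : ∀ (g : G) x, base (g • x) = slAct (proj g) (base x)
  param_point : ∀ l b, param (point l b) = l
  base_point : ∀ l b, base (point l b) = b
  shift_point : ∀ l b, shift (point l b) = 1
  shift_smul : ∀ (g : G) x, shift (g • x) * sec (proj g) = g * shift x

variable {k G X Λ : Type*} [Field k] [TopologicalSpace k] [IsTopologicalRing k]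
    [Group G] [TopologicalSpace G] [TopologicalSpace X] [MulAction G X] [TopologicalSpace Λ]

namespace SLFibration

/-- The map `τ` covers the involution of `GL(2) × k²`, up to the action of `SL(2)`. -/
structure IsCompatible (F : SLFibration k G X Λ) (τ : X ≃ₜ X) : Prop where
  param_map : ∀ x, F.param (τ x) = F.param x
  base_map : ∀ x, ∃ s : SL(2, k), F.base (τ x) = slAct s (tauPrime k (F.base x))

/-- The matrix component of the projection to `GL(2) × k²`. -/
def mat (F : SLFibration k G X Λ) (x : X) : Matrix (Fin 2) (Fin 2) k :=
  ((F.base x).1 : Matrix (Fin 2) (Fin 2) k)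

/-- The vector component of the projection to `GL(2) × k²`. -/
def vec (F : SLFibration k G X Λ) (x : X) : Fin 2 → k := (F.base x).2

/-- The parameter, the trace and determinant of `g`, and the determinant of `(v, g v)`. -/
def inv (F : SLFibration k G X Λ) (x : X) : Λ × k × k × k :=
  (F.param x, (F.mat x).trace, (F.mat x).det, qInv (F.base x))

variable (F : SLFibration k G X Λ)

lemma continuous_mat : Continuous F.mat :=
  Units.continuous_val.comp (continuous_fst.comp F.continuous_base)

lemma continuous_vec : Continuous F.vec := continuous_snd.comp F.continuous_base

lemma continuous_mat_apply (i j : Fin 2) : Continuous fun x => F.mat x i j :=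
  F.continuous_mat.matrix_elem i j

lemma continuous_vec_apply (i : Fin 2) : Continuous fun x => F.vec x i :=
  (continuous_apply i).comp F.continuous_vec

lemma continuous_inv : Continuous F.inv := by
  refine F.continuous_param.prodMk (F.continuous_mat.matrix_trace.prodMk
    (F.continuous_mat.matrix_det.prodMk ?_))
  exact (continuous_cols F.continuous_vec
    (F.continuous_mat.matrix_mulVec F.continuous_vec)).matrix_det

lemma inv_smul (g : G) (x : X) : F.inv (g • x) = F.inv x := by
  simp only [inv, mat, F.param_smul, F.base_smul, trace_slAct, det_slAct, qInv_slAct]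

lemma inv_map {τ : X ≃ₜ X} (hτ : F.IsCompatible τ) (x : X) : F.inv (τ x) = F.inv x := by
  obtain ⟨s, hs⟩ := hτ.base_map x
  simp only [inv, mat, hτ.param_map, hs, trace_slAct, det_slAct, qInv_slAct, trace_tauPrime,
    det_tauPrime, qInv_tauPrime]

variable {F}

lemma isStable_base {τ : X ≃ₜ X} (hτ : F.IsCompatible τ)
    {P : GL (Fin 2) k × (Fin 2 → k) → Prop} (hs : ∀ s b, P b → P (slAct s b))
    (hP : ∀ b, P b → P (tauPrime k b)) : IsStable G τ {x | P (F.base x)} := by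
  have hs' : ∀ s b, P (slAct s b) ↔ P b := fun s b => ⟨fun h => by
    have := hs s⁻¹ _ h
    rwa [← slAct_mul, inv_mul_cancel, slAct_one] at this, hs s b⟩
  have hP' : ∀ b, P (tauPrime k b) ↔ P b := fun b => ⟨fun h => by
    have := hP _ h
    rwa [show tauPrime k (tauPrime k b) = b from (tauPrime k).left_inv b] at this, hP b⟩
  refine ⟨fun g x => ?_, fun x => ?_⟩
  · change P _ ↔ P _
    rw [F.base_smul, hs']
  · change P _ ↔ P _
    obtain ⟨s, hs⟩ := hτ.base_map x
    rw [hs, hs', hP']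

lemma isStable_fiber {τ : X ≃ₜ X} (hτ : F.IsCompatible τ) (i : Λ × k × k × k) :
    IsStable G τ (F.inv ⁻¹' {i}) :=
  ⟨fun g x => by rw [mem_preimage, F.inv_smul, mem_preimage],
    fun x => by rw [mem_preimage, F.inv_map hτ, mem_preimage]⟩

lemma exists_smul_eq {x y : X} (hp : F.param x = F.param y) {s : SL(2, k)}
    (hs : slAct s (F.base x) = F.base y) : (F.shift y * F.sec s * (F.shift x)⁻¹) • x = y := by
  rw [mul_smul, mul_smul]
  conv_lhs => rw [← F.shift_smul_point x]
  have h1 : F.shift (F.shift x • F.point (F.param x) (F.base x)) = F.shift x := by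
    rw [F.shift_smul_point]
  rw [h1, inv_smul_smul, F.sec_smul_point, hs, hp, F.shift_smul_point]

/-- Orbit maps are open on a set covered by local frames with constant coordinates. -/
lemma hasOpenOrbits_of_frames [IsTopologicalGroup G] {L : Set X}
    (hL : ∀ (g : G) x, g • x ∈ L ↔ x ∈ L)
    (hpar : ∀ x ∈ L, ∀ y ∈ L, F.param x = F.param y)
    (hfr : ∀ x ∈ L, ∃ C e, ∃ M : X → Matrix (Fin 2) (Fin 2) k, ContinuousWithinAt M L x ∧
      (M x).det ≠ 0 ∧ ∀ᶠ y in 𝓝[L] x, (M y).det = (M x).det ∧ IsFrame C e (M y) (F.base y)) :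
    HasOpenOrbits G L := by
  classical
  -- The element of `G` that carries `x` to `y` is built from the frames at `x` and `y`, so it
  -- depends continuously on `y`.
  refine ⟨hL, fun x hx N hN => ?_⟩
  obtain ⟨C, e, M, hM, hdet, hfr⟩ := hfr x hx
  have hx' := (hfr.self_of_nhdsWithin hx).2
  have hex : ∀ y, ∃ s : SL(2, k), ((M y).det = (M x).det ∧ IsFrame C e (M y) (F.base y)) →
      (s : Matrix (Fin 2) (Fin 2) k) = M y * (M x)⁻¹ ∧ slAct s (F.base x) = F.base y := by
    intro y
    by_cases hy : (M y).det = (M x).det ∧ IsFrame C e (M y) (F.base y)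
    · obtain ⟨s, hs⟩ := hx'.exists_slAct hy.2 hy.1 hdet
      exact ⟨s, fun _ => hs⟩
    · exact ⟨1, fun h => absurd h hy⟩
  choose s hs using hex
  have hs1 : Filter.Tendsto s (𝓝[L] x) (𝓝 1) := by
    refine (IsInducing.tendsto_nhds_iff (Y := SL(2, k))
      IsInducing.subtypeVal).2 ?_
    have h1 : Filter.Tendsto (fun y => M y * (M x)⁻¹) (𝓝[L] x) (𝓝 (M x * (M x)⁻¹)) :=
      Filter.Tendsto.mul_const _ hM
    rw [mul_nonsing_inv _ (isUnit_iff_ne_zero.2 hdet)] at h1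
    exact h1.congr' (hfr.mono fun y hy => (hs y hy).1.symm)
  have hcont : Filter.Tendsto (fun y => F.shift y * F.sec (s y) * (F.shift x)⁻¹) (𝓝[L] x)
      (𝓝 1) := by
    have h1 : Filter.Tendsto F.shift (𝓝[L] x) (𝓝 (F.shift x)) :=
      F.continuous_shift.continuousWithinAt
    have h2 := (h1.mul ((F.continuous_sec.tendsto 1).comp hs1)).mul_const (F.shift x)⁻¹
    rwa [map_one, mul_one, mul_inv_cancel] at h2
  filter_upwards [hfr, hcont hN, self_mem_nhdsWithin] with y hy hyN hyL
  exact ⟨_, hyN, exists_smul_eq (hpar x hx y hyL) (hs y hy).2⟩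

end SLFibration

end Fibration

/-! ### The strata with `det (v, g v) ≠ 0` -/

section Strata

variable {k : Type*} [Field k] [ValuativeRel k] [TopologicalSpace k] [IsNonarchimedeanLocalField k]
  {G X Λ : Type*} [Group G] [TopologicalSpace G] [IsTopologicalGroup G] [T2Space G]
  [LocallyCompactSpace G] [TotallyDisconnectedSpace G] [TopologicalSpace X] [T2Space X]
  [MulAction G X] [ContinuousSMul G X] [TopologicalSpace Λ] {F : SLFibration k G X Λ} {τ : X ≃ₜ X}

namespace SLFibration

/-- On the fibres with `det (v, g v) ≠ 0`, the vectors `v, g v` form a frame. -/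
lemma testOn_le_of_qInv_ne_zero (hτ : F.IsCompatible τ) (l : Λ) (t δ : k) {q : k} (hq : q ≠ 0) :
    testOn (F.inv ⁻¹' {(l, t, δ, q)}) ≤ antiCoinv G τ (F.inv ⁻¹' {(l, t, δ, q)}) := by
  have hst := isStable_fiber hτ (l, t, δ, q)
  set L := F.inv ⁻¹' {(l, t, δ, q)} with hL
  have hmem : ∀ x ∈ L, F.param x = l ∧ (F.mat x).trace = t ∧ (F.mat x).det = δ ∧
      qInv (F.base x) = q := fun x hx => by
    simpa [hL, inv] using hx
  have hdet : ∀ x ∈ L, (cols (F.vec x) (F.mat x *ᵥ F.vec x)).det = q :=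
    fun x hx => (hmem x hx).2.2.2
  have hfr : ∀ x ∈ L, IsFrame !![0, -δ; 1, t] ![1, 0] (cols (F.vec x) (F.mat x *ᵥ F.vec x))
      (F.base x) := by
    intro x hx
    obtain ⟨-, h1, h2, -⟩ := hmem x hx
    refine ⟨?_, by rw [cols_mulVec]; simp [vec]⟩
    rw [← h1, ← h2]
    exact mul_cols_self _ _
  refine HasOpenOrbits.testOn_le_antiCoinv (hasOpenOrbits_of_frames hst.smul_mem
    (fun x hx y hy => (hmem x hx).1.trans (hmem y hy).1.symm) fun x hx => ?_) hst.map_mem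
    fun x hx => ?_
  · refine ⟨!![0, -δ; 1, t], ![1, 0], fun x => cols (F.vec x) (F.mat x *ᵥ F.vec x),
      (continuous_cols F.continuous_vec
        (F.continuous_mat.matrix_mulVec F.continuous_vec)).continuousWithinAt, ?_, ?_⟩
    · rw [hdet x hx]; exact hq
    · filter_upwards [self_mem_nhdsWithin] with y hy
      exact ⟨by rw [hdet y hy, hdet x hx], hfr y hy⟩
  · have hτx := (hst.map_mem x).2 hx
    obtain ⟨s, -, hs⟩ := (hfr x hx).exists_slAct (hfr _ hτx) (by rw [hdet _ hτx, hdet x hx])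
      (by rw [hdet x hx]; exact hq)
    exact ⟨_, (exists_smul_eq (hτ.param_map x).symm hs).symm⟩

end SLFibration

end Strata

/-! ### Eigenvectors of `2 × 2` matrices -/

section Eigenvectors

variable {k : Type*} [Field k] {b : GL (Fin 2) k × (Fin 2 → k)} {a c : k}

lemma exists_det_cols_ne_zero {v : Fin 2 → k} (hv : v ≠ 0) : ∃ u, (cols v u).det ≠ 0 := by
  by_cases h0 : v 0 = 0
  · refine ⟨![1, 0], fun h => hv ?_⟩
    rw [det_cols] at h
    ext i
    fin_cases i
    · exact h0
    · simpa using h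
  · exact ⟨![0, 1], by rw [det_cols]; simpa using h0⟩

lemma cols_smul (v u : Fin 2 → k) (r : k) : (cols v (r • u)).det = r * (cols v u).det := by
  simp only [det_cols, Pi.smul_apply, smul_eq_mul]; ring

/-- A vector `v ≠ 0` with `det (v, g v) = 0` is an eigenvector of `g`. -/
lemma exists_eigenvalue_of_qInv_eq_zero (hv : b.2 ≠ 0) (hq : qInv b = 0) :
    ∃ α : k, (b.1 : Matrix (Fin 2) (Fin 2) k) *ᵥ b.2 = α • b.2 ∧
      α * ((b.1 : Matrix (Fin 2) (Fin 2) k).trace - α) =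
        (b.1 : Matrix (Fin 2) (Fin 2) k).det := by
  obtain ⟨g, v⟩ := b
  have hα : ∃ α : k, (g : Matrix (Fin 2) (Fin 2) k) *ᵥ v = α • v := by
    rw [qInv, det_cols] at hq
    by_cases h0 : v 0 = 0
    · have h1 : v 1 ≠ 0 := fun h1 => hv (by ext i; fin_cases i <;> assumption)
      refine ⟨((g : Matrix (Fin 2) (Fin 2) k) *ᵥ v) 1 / v 1, ?_⟩
      ext i
      fin_cases i
      · simp only [h0] at hq
        simpa [h0, h1] using hq
      · simp [h1]
    · refine ⟨((g : Matrix (Fin 2) (Fin 2) k) *ᵥ v) 0 / v 0, ?_⟩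
      ext i
      fin_cases i
      · simp [h0]
      · simp only at hq
        simp only [Fin.mk_one, Pi.smul_apply, smul_eq_mul]
        field_simp
        linear_combination hq
  obtain ⟨α, hα⟩ := hα
  refine ⟨α, hα, ?_⟩
  have h2 := mulVec_mulVec_eq (g : Matrix (Fin 2) (Fin 2) k) v
  rw [hα, mulVec_smul, hα, smul_smul, smul_smul, ← sub_smul, ← sub_eq_zero, ← sub_smul] at h2
  linear_combination -(smul_eq_zero.1 h2).resolve_right hv

lemma mulVec_eq_or_of_qInv_eq_zero (hq : qInv b = 0)
    (htr : (b.1 : Matrix (Fin 2) (Fin 2) k).trace = a + c)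
    (hdet : (b.1 : Matrix (Fin 2) (Fin 2) k).det = a * c) :
    (b.1 : Matrix (Fin 2) (Fin 2) k) *ᵥ b.2 = a • b.2 ∨
      (b.1 : Matrix (Fin 2) (Fin 2) k) *ᵥ b.2 = c • b.2 := by
  by_cases hv : b.2 = 0
  · left; simp [hv]
  obtain ⟨α, hα, h⟩ := exists_eigenvalue_of_qInv_eq_zero hv hq
  have h3 : (α - a) * (α - c) = 0 := by
    rw [htr, hdet] at h
    linear_combination -h
  rcases mul_eq_zero.1 h3 with h | h
  · left; rw [hα, sub_eq_zero.1 h]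
  · right; rw [hα, sub_eq_zero.1 h]

/-- An eigenvector and any complementary vector form a frame with triangular coordinates. -/
lemma isFrame_cols (hv : (b.1 : Matrix (Fin 2) (Fin 2) k) *ᵥ b.2 = a • b.2)
    (htr : (b.1 : Matrix (Fin 2) (Fin 2) k).trace = a + c) {w : Fin 2 → k}
    (hw : (cols b.2 w).det = 1) :
    IsFrame !![a, (cols ((b.1 : Matrix (Fin 2) (Fin 2) k) *ᵥ w) w).det; 0, c] ![1, 0]
      (cols b.2 w) b := by
  refine ⟨?_, by rw [cols_mulVec]; simp⟩
  rw [mul_cols, cols_mul, hv]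
  congr 1
  · simp
  rw [mulVec_fin_two] at hv ⊢
  have h0 := congrFun hv 0
  have h1 := congrFun hv 1
  simp only [cons_val_zero, cons_val_one, Pi.smul_apply, smul_eq_mul] at h0 h1
  rw [trace_fin_two] at htr
  rw [det_cols] at hw
  ext i
  fin_cases i
  · simp only [det_cols, Fin.zero_eta, cons_val_zero, cons_val_one, Pi.add_apply, Pi.smul_apply,
      smul_eq_mul]
    linear_combination -(b.1 0 0 * w 0 + b.1 0 1 * w 1) * hw - w 0 * w 1 * h0 + w 0 * w 0 * h1 +
      w 0 * (b.1 0 0 + b.1 1 1 - a) * hw + w 0 * htr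
  · simp only [det_cols, Fin.mk_one, cons_val_zero, cons_val_one, Pi.add_apply, Pi.smul_apply,
      smul_eq_mul]
    linear_combination -(b.1 1 0 * w 0 + b.1 1 1 * w 1) * hw - w 1 * w 1 * h0 + w 1 * w 0 * h1 +
      w 1 * (b.1 0 0 + b.1 1 1 - a) * hw + w 1 * htr

open Classical in
/-- The coefficient `β` for which `(g - c) w = β det (v, w) v` for all `w`, where `v ≠ 0` is the
eigenvector of a matrix `g` with double eigenvalue `c`. -/
def nilCoef (b : GL (Fin 2) k × (Fin 2 → k)) : k :=
  if b.2 0 = 0 then -b.1 1 0 / b.2 1 ^ 2 else b.1 0 1 / b.2 0 ^ 2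

lemma IsFrame.nilpotent_entries {β : k} {M : Matrix (Fin 2) (Fin 2) k}
    (h : IsFrame !![c, β; 0, c] ![1, 0] M b) (hM : M.det = 1) :
    b.1 0 1 = β * b.2 0 ^ 2 ∧ b.1 1 0 = -(β * b.2 1 ^ 2) := by
  have h1 := h.mul_eq
  have h2 := h.mulVec_eq
  rw [← Matrix.ext_iff] at h1
  simp only [Matrix.mul_apply, Fin.sum_univ_two, Fin.forall_fin_two] at h1
  rw [← h2]
  rw [det_fin_two] at hM
  simp at h1 ⊢
  obtain ⟨⟨h00, h01⟩, h10, h11⟩ := h1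
  constructor
  · linear_combination -(b.1 0 1) * hM + M 0 0 * h01 - M 0 1 * h00
  · linear_combination -(b.1 1 0) * hM - M 1 0 * h11 + M 1 1 * h10

lemma IsFrame.nilCoef_eq {β : k} {M : Matrix (Fin 2) (Fin 2) k}
    (h : IsFrame !![c, β; 0, c] ![1, 0] M b) (hM : M.det = 1) (hb : b.2 ≠ 0) :
    nilCoef b = β := by
  obtain ⟨h1, h2⟩ := h.nilpotent_entries hM
  rw [nilCoef]
  split_ifs with h0
  · have h3 : b.2 1 ≠ 0 := fun h3 => hb (by ext i; fin_cases i <;> assumption)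
    rw [h2]; field_simp
  · rw [h1]; field_simp

end Eigenvectors

/-! ### The stratum `v = 0` -/

section StableSets

/-- A nonscalar `2 × 2` matrix has a cyclic vector. -/
lemma exists_cyclic {k : Type*} [Field k] {g : Matrix (Fin 2) (Fin 2) k}
    (h : ¬(g 0 1 = 0 ∧ g 1 0 = 0 ∧ g 0 0 = g 1 1)) : ∃ u, (cols u (g *ᵥ u)).det ≠ 0 := by
  by_contra! hu
  have h1 := hu ![1, 0]
  have h2 := hu ![0, 1]
  have h3 := hu ![1, 1]
  rw [det_cols, mulVec_fin_two] at h1 h2 h3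
  simp at h1 h2 h3
  refine h ⟨h2, h1, ?_⟩
  rw [h1, h2] at h3
  linear_combination -h3

variable {k : Type*} [Field k] [TopologicalSpace k] [IsTopologicalRing k]
  {G X Λ : Type*} [Group G] [TopologicalSpace G] [TopologicalSpace X]
  [MulAction G X] [TopologicalSpace Λ] {F : SLFibration k G X Λ} {τ : X ≃ₜ X} {L : Set X}

namespace SLFibration

lemma exists_smul_map (hτ : F.IsCompatible τ) {x : X}
    (h : ∃ s : SL(2, k), slAct s (F.base x) = tauPrime k (F.base x)) : ∃ g : G, τ x = g • x := by
  obtain ⟨s, hs⟩ := h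
  obtain ⟨s', hs'⟩ := hτ.base_map x
  exact ⟨_, (exists_smul_eq (hτ.param_map x).symm (s := s' * s)
    (by rw [slAct_mul, hs, hs'])).symm⟩

lemma mem_fiber {x : X} {l : Λ} {t δ q : k} : x ∈ F.inv ⁻¹' {(l, t, δ, q)} ↔
    F.param x = l ∧ (F.mat x).trace = t ∧ (F.mat x).det = δ ∧ qInv (F.base x) = q := by
  simp [inv]

/-- The set where `g` is a scalar matrix. -/
def scalarSet (F : SLFibration k G X Λ) : Set X :=
  {x | F.mat x 0 1 = 0 ∧ F.mat x 1 0 = 0 ∧ F.mat x 0 0 = F.mat x 1 1}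

/-- The set where `v = 0`. -/
def zeroSet (F : SLFibration k G X Λ) : Set X := {x | F.vec x = 0}

lemma isStable_zeroSet (hτ : F.IsCompatible τ) : IsStable G τ F.zeroSet :=
  isStable_base hτ (P := fun b => b.2 = 0) (fun s b hb => by rw [slAct_snd, hb, mulVec_zero])
    fun b hb => by rw [tauPrime_snd, hb]; ext i; fin_cases i <;> rfl

lemma isStable_scalarSet (hτ : F.IsCompatible τ) : IsStable G τ F.scalarSet := by
  refine isStable_base hτ (P := fun b => b.1 0 1 = 0 ∧ b.1 1 0 = 0 ∧ b.1 0 0 = b.1 1 1)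
    (fun s b hb => ?_) fun b hb => ?_
  · have h1 : (b.1 : Matrix (Fin 2) (Fin 2) k) = b.1 0 0 • (1 : Matrix (Fin 2) (Fin 2) k) := by
      ext i j
      fin_cases i <;> fin_cases j <;> simp [hb.1, hb.2.1, hb.2.2]
    have h2 : ((slAct s b).1 : Matrix (Fin 2) (Fin 2) k) =
        b.1 0 0 • (1 : Matrix (Fin 2) (Fin 2) k) := by
      rw [slAct_fst, h1, Matrix.mul_smul, Matrix.mul_one, Matrix.smul_mul, sl_mul_inv]
      simp
    simp [h2]
  · rw [tauPrime_fst]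
    simpa using ⟨hb.2.1, hb.1, hb.2.2⟩

lemma isClosed_zeroSet [T2Space k] : IsClosed F.zeroSet :=
  isClosed_eq F.continuous_vec continuous_const

lemma isClosed_scalarSet [T2Space k] : IsClosed F.scalarSet :=
  (isClosed_eq (F.continuous_mat_apply 0 1) continuous_const).inter
    ((isClosed_eq (F.continuous_mat_apply 1 0) continuous_const).inter
      (isClosed_eq (F.continuous_mat_apply 0 0) (F.continuous_mat_apply 1 1)))

lemma isClosed_fiber [T2Space k] [T1Space Λ] (i : Λ × k × k × k) : IsClosed (F.inv ⁻¹' {i}) :=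
  isClosed_singleton.preimage F.continuous_inv

/-- The frames `(u, g u)` of `g` and `(d₂ u, g' (d₂ u))` of its image `g'` have the same
determinant. -/
lemma exists_smul_map_nonscalar (hτ : F.IsCompatible τ) {x : X} (hx : F.vec x = 0)
    (hx' : x ∉ F.scalarSet) : ∃ g : G, τ x = g • x := by
  refine exists_smul_map hτ ?_
  obtain ⟨u, hu⟩ := exists_cyclic hx'
  have h1 : IsFrame !![0, -(F.mat x).det; 1, (F.mat x).trace] 0 (cols u (F.mat x *ᵥ u))
    (F.base x) := ⟨mul_cols_self _ _, by rw [mulVec_zero]; exact hx.symm⟩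
  have hx0 : (F.base x).2 = 0 := hx
  set b := tauPrime k (F.base x) with hb
  have hdb : (b.1 : Matrix (Fin 2) (Fin 2) k).det = (F.mat x).det := det_tauPrime _
  have htb : (b.1 : Matrix (Fin 2) (Fin 2) k).trace = (F.mat x).trace := trace_tauPrime _
  have h2 : IsFrame !![0, -(F.mat x).det; 1, (F.mat x).trace] 0
      (cols ![u 1, u 0] ((b.1 : Matrix (Fin 2) (Fin 2) k) *ᵥ ![u 1, u 0])) b := by
    refine ⟨?_, ?_⟩
    · rw [← hdb, ← htb]; exact mul_cols_self _ _
    · rw [mulVec_zero, hb, tauPrime_snd, hx0]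
      ext i; fin_cases i <;> rfl
  have h3 : (cols ![u 1, u 0] ((b.1 : Matrix (Fin 2) (Fin 2) k) *ᵥ ![u 1, u 0])).det =
      (cols u (F.mat x *ᵥ u)).det := by
    have := qInv_tauPrime ((F.base x).1, u)
    rw [qInv, tauPrime_snd] at this
    exact this
  obtain ⟨s, -, hs⟩ := h1.exists_slAct h2 h3 hu
  exact ⟨s, hs⟩

end SLFibration

end StableSets

section Strata

variable {k : Type*} [Field k] [ValuativeRel k] [TopologicalSpace k] [IsNonarchimedeanLocalField k]
  {G X Λ : Type*} [Group G] [TopologicalSpace G] [IsTopologicalGroup G] [TopologicalSpace X]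
  [MulAction G X] [TopologicalSpace Λ] {F : SLFibration k G X Λ} {τ : X ≃ₜ X}

namespace SLFibration

/-- The nonscalar pairs `(g, 0)` with given trace and determinant form a single open orbit under
`GL(2)`, and `SL(2)` has open orbits on it, because squares are open in `kˣ`. -/
lemma hasOpenOrbits_nonscalar (two_ne : (2 : k) ≠ 0) (hτ : F.IsCompatible τ) (i : Λ × k × k × k) :
    HasOpenOrbits G ((F.inv ⁻¹' {i} ∩ F.zeroSet) \ F.scalarSet) := by
  obtain ⟨l, t, δ, q⟩ := i
  have hst := ((isStable_fiber hτ (l, t, δ, q)).inter (isStable_zeroSet hτ)).diff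
    (isStable_scalarSet hτ)
  have hmem : ∀ x ∈ (F.inv ⁻¹' {(l, t, δ, q)} ∩ F.zeroSet) \ F.scalarSet, F.param x = l ∧
      (F.mat x).trace = t ∧ (F.mat x).det = δ ∧ F.vec x = 0 := fun x hx => by
    obtain ⟨h1, h2, h3, -⟩ := mem_fiber.1 hx.1.1
    exact ⟨h1, h2, h3, hx.1.2⟩
  refine hasOpenOrbits_of_frames hst.smul_mem
    (fun x hx y hy => (hmem x hx).1.trans (hmem y hy).1.symm) fun x hx => ?_
  obtain ⟨u, hu⟩ := exists_cyclic hx.2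
  obtain ⟨r, hr, hr1, hrr⟩ := exists_local_sqrt k two_ne
  set D : X → k := fun y => (cols u (F.mat y *ᵥ u)).det with hD
  have hDc : Continuous fun y => D y / D x := ((continuous_cols continuous_const
    (F.continuous_mat.matrix_mulVec continuous_const)).matrix_det).div_const _
  have hDx : D x / D x = 1 := div_self hu
  have hlim : Filter.Tendsto (fun y => D y / D x) (𝓝 x) (𝓝 1) := by
    have := hDc.tendsto x
    rwa [hDx] at this
  have hrc : ContinuousAt (fun y => r (D y / D x)) x :=
    ContinuousAt.comp (f := fun y => D y / D x) (by rw [hDx]; exact hr) hDc.continuousAt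
  have hrx : r (D x / D x) = 1 := by rw [hDx, hr1]
  refine ⟨!![0, -δ; 1, t], 0, fun y => (r (D y / D x))⁻¹ • cols u (F.mat y *ᵥ u), ?_, ?_, ?_⟩
  · refine ContinuousAt.continuousWithinAt (ContinuousAt.smul (hrc.inv₀ (by rw [hrx]; simp)) ?_)
    exact (continuous_cols continuous_const
      (F.continuous_mat.matrix_mulVec continuous_const)).continuousAt
  · simpa only [hrx, inv_one, one_smul] using hu
  · have hne : ∀ᶠ y in 𝓝 x, D y / D x ≠ 0 := hlim.eventually_ne one_ne_zero
    filter_upwards [self_mem_nhdsWithin, mem_nhdsWithin_of_mem_nhds (hlim.eventually hrr),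
      mem_nhdsWithin_of_mem_nhds hne] with y hy hry hney
    obtain ⟨-, h1, h2, h3⟩ := hmem y hy
    have hr0 : r (D y / D x) ≠ 0 := fun h => hney (by rw [← hry, h, zero_mul])
    refine ⟨?_, ?_, ?_⟩
    · simp only [hrx, det_smul]
      change _ * D y = _ * D x
      simp only [Fintype.card_fin, inv_one, one_pow, one_mul]
      have h4 : D y = r (D y / D x) * r (D y / D x) * D x := by
        rw [hry, div_mul_cancel₀ _ hu]
      rw [inv_pow, inv_mul_eq_iff_eq_mul₀ (pow_ne_zero _ hr0), sq]
      exact h4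
    · change F.mat y * _ = _
      rw [Matrix.mul_smul, mul_cols_self, h1, h2, Matrix.smul_mul]
    · rw [mulVec_zero]; exact h3.symm

variable [T2Space G]
  [LocallyCompactSpace G] [TotallyDisconnectedSpace G] [T2Space X] [ContinuousSMul G X]

/-- The stratum `v = 0`. -/
lemma testOn_le_of_zero [T1Space Λ] [LocallyCompactSpace X] [TotallyDisconnectedSpace X]
    (two_ne : (2 : k) ≠ 0) (hτ : F.IsCompatible τ) (i : Λ × k × k × k) :
    testOn (F.inv ⁻¹' {i} ∩ F.zeroSet) ≤ antiCoinv G τ (F.inv ⁻¹' {i} ∩ F.zeroSet) := by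
  have hst := (isStable_fiber hτ i).inter (isStable_zeroSet hτ)
  have hst' := hst.inter (isStable_scalarSet hτ)
  have hcl := (isClosed_fiber (F := F) i).inter (isClosed_zeroSet (F := F))
  refine testOn_le_antiCoinv_of_closed isClosed_scalarSet hcl.isLocallyClosed hst hst' ?_ ?_
  · obtain ⟨l, t, δ, q⟩ := i
    -- A scalar matrix of trace `t` is `t / 2`, so `(g, v)` is constant on this set.
    have hfr : ∀ x ∈ F.inv ⁻¹' {(l, t, δ, q)} ∩ F.zeroSet ∩ F.scalarSet,
        IsFrame !![t / 2, 0; 0, t / 2] 0 1 (F.base x) := by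
      intro x hx
      have h1 := (mem_fiber.1 hx.1.1).2.1
      have h2 : F.vec x = 0 := hx.1.2
      obtain ⟨h3, h4, h5⟩ := hx.2
      rw [trace_fin_two, h5, ← two_mul] at h1
      refine ⟨?_, by rw [mulVec_zero]; exact h2.symm⟩
      change F.mat x * 1 = _
      rw [Matrix.mul_one, Matrix.one_mul, ← h1, mul_div_cancel_left₀ _ two_ne]
      ext i j
      fin_cases i <;> fin_cases j <;> simp [h3, h4, h5]
    refine (hasOpenOrbits_of_frames hst'.smul_mem
      (fun x hx y hy => (mem_fiber.1 hx.1.1).1.trans (mem_fiber.1 hy.1.1).1.symm)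
      fun x hx => ?_).testOn_le_antiCoinv hst'.map_mem fun x hx => ?_
    · refine ⟨!![t / 2, 0; 0, t / 2], 0, fun _ => 1, continuousWithinAt_const, by simp, ?_⟩
      filter_upwards [self_mem_nhdsWithin] with y hy
      exact ⟨rfl, hfr y hy⟩
    · have hτx := (hst'.map_mem x).2 hx
      obtain ⟨s, -, hs⟩ := (hfr x hx).exists_slAct (hfr _ hτx) rfl (by simp)
      exact ⟨_, (exists_smul_eq (hτ.param_map x).symm hs).symm⟩
  · refine le_trans ?_ (antiCoinv_mono (testOn_diff_le (isClosed_scalarSet (F := F))))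
    exact (hasOpenOrbits_nonscalar two_ne hτ i).testOn_le_antiCoinv
      (hst.diff (isStable_scalarSet hτ)).map_mem
      fun x hx => exists_smul_map_nonscalar hτ hx.1.2 hx.2

end SLFibration

end Strata

/-! ### Eigenvectors for a double eigenvalue -/

section Strata

variable {k : Type*} [Field k] [ValuativeRel k] [TopologicalSpace k] [IsNonarchimedeanLocalField k]
  {G X Λ : Type*} [Group G] [TopologicalSpace G] [IsTopologicalGroup G] [TopologicalSpace X]
  [MulAction G X] [TopologicalSpace Λ] {F : SLFibration k G X Λ} {τ : X ≃ₜ X}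

namespace SLFibration

variable [T2Space G]
  [LocallyCompactSpace G] [TotallyDisconnectedSpace G] [T2Space X] [ContinuousSMul G X]
  [LocallyCompactSpace X] [TotallyDisconnectedSpace X] [T1Space Λ]

/-- The stratum where `v ≠ 0` is an eigenvector of a matrix `g` with double eigenvalue `c`: there
`g w = c w + β det (v, w) v` for all `w`, and on the subset with given `β` the group `SL(2)` has open
orbits. -/
lemma testOn_le_of_double (hτ : F.IsCompatible τ) (l : Λ) (c : k) :
    testOn (F.inv ⁻¹' {(l, c + c, c * c, 0)} \ F.zeroSet) ≤
      antiCoinv G τ (F.inv ⁻¹' {(l, c + c, c * c, 0)} \ F.zeroSet) := by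
  have hst := (isStable_fiber hτ (l, c + c, c * c, 0)).diff (isStable_zeroSet hτ)
  set L := F.inv ⁻¹' {(l, c + c, c * c, 0)} \ F.zeroSet with hL
  have hmem : ∀ x ∈ L, F.param x = l ∧ (F.mat x).trace = c + c ∧
      F.mat x *ᵥ F.vec x = c • F.vec x ∧ F.vec x ≠ 0 := fun x hx => by
    obtain ⟨h1, h2, h3, h4⟩ := mem_fiber.1 hx.1
    exact ⟨h1, h2, (mulVec_eq_or_of_qInv_eq_zero h4 h2 h3).elim id id, hx.2⟩
  -- A vector `w` with `det (v, w) = 1` completes `v` to a frame.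
  have hframe : ∀ x ∈ L, ∀ w, (cols (F.vec x) w).det = 1 →
      IsFrame !![c, nilCoef (F.base x); 0, c] ![1, 0] (cols (F.vec x) w) (F.base x) := by
    intro x hx w hw
    obtain ⟨-, h2, h3, h4⟩ := hmem x hx
    have h5 := isFrame_cols h3 h2 hw
    rwa [← h5.nilCoef_eq hw h4] at h5
  have hex : ∀ x ∈ L, ∃ w, (cols (F.vec x) w).det = 1 := by
    intro x hx
    obtain ⟨u, hu⟩ := exists_det_cols_ne_zero (hmem x hx).2.2.2
    exact ⟨(cols (F.vec x) u).det⁻¹ • u, by rw [cols_smul, inv_mul_cancel₀ hu]⟩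
  have hG : ∀ (g : G), ∀ x ∈ L, nilCoef (F.base (g • x)) = nilCoef (F.base x) := by
    intro g x hx
    obtain ⟨w, hw⟩ := hex x hx
    have h1 := (hframe x hx w hw).slAct (F.proj g)
    rw [← F.base_smul] at h1
    exact h1.nilCoef_eq (by rw [det_mul, hw, mul_one]; exact (F.proj g).2)
      (hmem _ ((hst.smul_mem g x).2 hx)).2.2.2
  have hτ' : ∀ x ∈ L, nilCoef (F.base (τ x)) = nilCoef (F.base x) := by
    intro x hx
    obtain ⟨w, hw⟩ := hex x hx
    obtain ⟨s, hs⟩ := hτ.base_map x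
    have h1 := ((hframe x hx w hw).tauPrime (hmem x hx).2.1).slAct s
    rw [← hs] at h1
    refine h1.nilCoef_eq ?_ (hmem _ ((hst.map_mem x).2 hx)).2.2.2
    rw [det_mul, s.2, one_mul, ← hw, det_fin_two_of, det_fin_two]
    ring
  have hcont : ContinuousOn (fun x => nilCoef (F.base x)) L := by
    intro x hx
    obtain ⟨-, -, -, hv⟩ := hmem x hx
    have key : ∀ y ∈ L, F.mat y 0 1 = nilCoef (F.base y) * F.vec y 0 ^ 2 ∧
        F.mat y 1 0 = -(nilCoef (F.base y) * F.vec y 1 ^ 2) := by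
      intro y hy
      obtain ⟨w, hw⟩ := hex y hy
      exact (hframe y hy w hw).nilpotent_entries hw
    by_cases h0 : F.vec x 0 = 0
    · have h1 : F.vec x 1 ≠ 0 := fun h1 => hv (by ext i; fin_cases i <;> assumption)
      have hc : ContinuousAt (fun y => -F.mat y 1 0 / F.vec y 1 ^ 2) x :=
        (F.continuous_mat_apply 1 0).neg.continuousAt.div
          ((F.continuous_vec_apply 1).pow 2).continuousAt (pow_ne_zero _ h1)
      refine hc.continuousWithinAt.congr_of_eventuallyEq ?_ ?_
      · filter_upwards [self_mem_nhdsWithin, mem_nhdsWithin_of_mem_nhds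
          ((F.continuous_vec_apply 1).continuousAt.eventually_ne h1)] with y hy hy1
        rw [(key y hy).2]; field_simp
      · rw [(key x hx).2]; field_simp
    · have hc : ContinuousAt (fun y => F.mat y 0 1 / F.vec y 0 ^ 2) x :=
        (F.continuous_mat_apply 0 1).continuousAt.div
          ((F.continuous_vec_apply 0).pow 2).continuousAt (pow_ne_zero _ h0)
      refine hc.continuousWithinAt.congr_of_eventuallyEq ?_ ?_
      · filter_upwards [self_mem_nhdsWithin, mem_nhdsWithin_of_mem_nhds
          ((F.continuous_vec_apply 0).continuousAt.eventually_ne h0)] with y hy hy0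
        rw [(key y hy).1]; field_simp
      · rw [(key x hx).1]; field_simp
  have hlc : IsLocallyClosed L :=
    (isClosed_fiber (F := F) _).isLocallyClosed.inter
      (isClosed_zeroSet (F := F)).isOpen_compl.isLocallyClosed
  refine testOn_le_antiCoinv_of_fibers _ hcont hG hτ' hlc hst fun β => ?_
  have hst' : IsStable G τ (L ∩ (fun x => nilCoef (F.base x)) ⁻¹' {β}) := by
    refine ⟨fun g x => ⟨fun h => ?_, fun h => ?_⟩, fun x => ⟨fun h => ?_, fun h => ?_⟩⟩
    · have := (hst.smul_mem g x).1 h.1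
      exact ⟨this, (hG g x this).symm.trans h.2⟩
    · exact ⟨(hst.smul_mem g x).2 h.1, (hG g x h.1).trans h.2⟩
    · have := (hst.map_mem x).1 h.1
      exact ⟨this, (hτ' x this).symm.trans h.2⟩
    · exact ⟨(hst.map_mem x).2 h.1, (hτ' x h.1).trans h.2⟩
  refine (hasOpenOrbits_of_frames hst'.smul_mem
      (fun x hx y hy => (hmem x hx.1).1.trans (hmem y hy.1).1.symm)
      fun x hx => ?_).testOn_le_antiCoinv hst'.map_mem fun x hx => ?_
  · obtain ⟨u, hu⟩ := exists_det_cols_ne_zero (hmem x hx.1).2.2.2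
    have hD : Continuous fun y => (cols (F.vec y) u).det :=
      (continuous_cols F.continuous_vec continuous_const).matrix_det
    have hdet : ∀ y, (cols (F.vec y) u).det ≠ 0 →
        (cols (F.vec y) ((cols (F.vec y) u).det⁻¹ • u)).det = 1 := fun y hy => by
      rw [cols_smul, inv_mul_cancel₀ hy]
    refine ⟨!![c, β; 0, c], ![1, 0], fun y => cols (F.vec y) ((cols (F.vec y) u).det⁻¹ • u),
      ?_, ?_, ?_⟩
    · have hw : ContinuousAt (fun y => (cols (F.vec y) u).det⁻¹ • u) x :=
        (hD.continuousAt.inv₀ hu).smul continuousAt_const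
      refine ContinuousAt.continuousWithinAt ?_
      have hcols : Continuous fun p : (Fin 2 → k) × (Fin 2 → k) => cols p.1 p.2 :=
        continuous_cols continuous_fst continuous_snd
      exact ContinuousAt.comp (f := fun y => (F.vec y, (cols (F.vec y) u).det⁻¹ • u))
        hcols.continuousAt (F.continuous_vec.continuousAt.prodMk hw)
    · simp only [hdet x hu]; exact one_ne_zero
    · filter_upwards [self_mem_nhdsWithin, mem_nhdsWithin_of_mem_nhds
        (hD.continuousAt.eventually_ne hu)] with y hy hyu
      refine ⟨by rw [hdet y hyu, hdet x hu], ?_⟩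
      have := hframe y hy.1 _ (hdet y hyu)
      rwa [show nilCoef (F.base y) = β from hy.2] at this
  · obtain ⟨w, hw⟩ := hex x hx.1
    have h1 := hframe x hx.1 w hw
    rw [show nilCoef (F.base x) = β from hx.2] at h1
    refine exists_smul_map hτ ?_
    obtain ⟨s, -, hs⟩ := h1.exists_slAct (h1.tauPrime (hmem x hx.1).2.1)
      (by rw [det_fin_two_of, det_fin_two]; ring) (by rw [hw]; exact one_ne_zero)
    exact ⟨s, hs⟩

end SLFibration

end Strata

/-! ### Eigenvectors for one of two distinct eigenvalues -/

section EigenSet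

variable {k : Type*} [Field k] [TopologicalSpace k] [IsTopologicalRing k]
  {G X Λ : Type*} [Group G] [TopologicalSpace G] [TopologicalSpace X]
  [MulAction G X] [TopologicalSpace Λ] {F : SLFibration k G X Λ} {τ : X ≃ₜ X} {l : Λ} {a c : k}

namespace SLFibration

/-- The set where `g v = a v`. -/
def eigenSet (F : SLFibration k G X Λ) (a : k) : Set X := {x | F.mat x *ᵥ F.vec x = a • F.vec x}

lemma isClosed_eigenSet [T2Space k] : IsClosed (F.eigenSet a) :=
  isClosed_eq (F.continuous_mat.matrix_mulVec F.continuous_vec) (F.continuous_vec.const_smul a)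

lemma smul_mem_eigenSet (g : G) {x : X} (hx : x ∈ F.eigenSet a) : g • x ∈ F.eigenSet a := by
  change ((F.base (g • x)).1 : Matrix (Fin 2) (Fin 2) k) *ᵥ (F.base (g • x)).2 =
    a • (F.base (g • x)).2
  rw [F.base_smul, slAct_snd, mulVec_mulVec, slAct_fst_mul, ← mulVec_mulVec]
  change _ *ᵥ (F.mat x *ᵥ F.vec x) = a • _ *ᵥ F.vec x
  rw [show F.mat x *ᵥ F.vec x = a • F.vec x from hx, mulVec_smul]

lemma smul_mem_eigenSet_iff (g : G) {x : X} : g • x ∈ F.eigenSet a ↔ x ∈ F.eigenSet a :=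
  ⟨fun h => by simpa using smul_mem_eigenSet g⁻¹ h, smul_mem_eigenSet g⟩

/-- On the fibre where `g` has the eigenvalues `a ≠ c` and `det (v, g v) = 0`, the complement of
`g v = c v` consists of the nonzero eigenvectors for `a`. -/
lemma mem_fiber_diff_eigenSet (hne : a ≠ c) {x : X} :
    x ∈ F.inv ⁻¹' {(l, a + c, a * c, 0)} \ F.eigenSet c ↔
      F.param x = l ∧ (F.mat x).trace = a + c ∧ (F.mat x).det = a * c ∧
        F.mat x *ᵥ F.vec x = a • F.vec x ∧ F.vec x ≠ 0 := by
  constructor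
  · rintro ⟨h, hc⟩
    obtain ⟨h1, h2, h3, h4⟩ := mem_fiber.1 h
    refine ⟨h1, h2, h3, (mulVec_eq_or_of_qInv_eq_zero h4 h2 h3).resolve_right hc, fun h0 => hc ?_⟩
    change _ = _
    rw [h0, mulVec_zero, smul_zero]
  · rintro ⟨h1, h2, h3, h4, h5⟩
    refine ⟨mem_fiber.2 ⟨h1, h2, h3, ?_⟩, fun hc => ?_⟩
    · rw [qInv]
      change (cols (F.vec x) (F.mat x *ᵥ F.vec x)).det = 0
      rw [h4, cols_smul, det_cols]
      ring
    · have h6 : F.mat x *ᵥ F.vec x = c • F.vec x := hc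
      rw [h4, ← sub_eq_zero, ← sub_smul, smul_eq_zero, sub_eq_zero] at h6
      exact h6.elim hne h5

/-- The vector `w = (g - a) u` is an eigenvector for the second eigenvalue, so `v` and a multiple of
`w` form a frame in which `g` is diagonal. -/
lemma isFrame_diag (hne : a ≠ c) {x : X}
    (hx : x ∈ F.inv ⁻¹' {(l, a + c, a * c, 0)} \ F.eigenSet c) {u : Fin 2 → k} {w : Fin 2 → k}
    (hw : w = F.mat x *ᵥ u - a • u) {r : k} (hr : (cols (F.vec x) (r • w)).det = 1) :
    IsFrame !![a, 0; 0, c] ![1, 0] (cols (F.vec x) (r • w)) (F.base x) := by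
  obtain ⟨-, h2, h3, h4, -⟩ := (mem_fiber_diff_eigenSet hne).1 hx
  have h5 : F.mat x *ᵥ w = c • w := by
    rw [hw, mulVec_sub, mulVec_mulVec_eq, mulVec_smul, h2, h3]
    module
  have h6 := isFrame_cols h4 h2 hr
  rwa [show ((F.base x).1 : Matrix (Fin 2) (Fin 2) k) *ᵥ (r • w) = c • (r • w) by
    rw [mulVec_smul, smul_comm c]; exact congrArg _ h5,
    show (cols (c • r • w) (r • w)).det = 0 by
      simp only [det_cols, Pi.smul_apply, smul_eq_mul]; ring] at h6

lemma det_cols_sub (hne : a ≠ c) {x : X}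
    (hx : x ∈ F.inv ⁻¹' {(l, a + c, a * c, 0)} \ F.eigenSet c) (u : Fin 2 → k) :
    (cols (F.vec x) (F.mat x *ᵥ u - a • u)).det = (c - a) * (cols (F.vec x) u).det := by
  obtain ⟨-, h2, h3, h4, -⟩ := (mem_fiber_diff_eigenSet hne).1 hx
  rw [mulVec_fin_two] at h4
  have h0 := congrFun h4 0
  have h1 := congrFun h4 1
  simp only [cons_val_zero, cons_val_one, Pi.smul_apply, smul_eq_mul] at h0 h1
  rw [trace_fin_two] at h2
  simp only [det_cols, mulVec_fin_two, Pi.sub_apply, Pi.smul_apply, smul_eq_mul, cons_val_zero,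
    cons_val_one]
  linear_combination (F.vec x 0 * u 1 - F.vec x 1 * u 0) * h2 - u 1 * h0 + u 0 * h1

lemma exists_isFrame_diag (hne : a ≠ c) {x : X}
    (hx : x ∈ F.inv ⁻¹' {(l, a + c, a * c, 0)} \ F.eigenSet c) :
    ∃ M, M.det = 1 ∧ IsFrame !![a, 0; 0, c] ![1, 0] M (F.base x) := by
  obtain ⟨-, -, -, -, h5⟩ := (mem_fiber_diff_eigenSet hne).1 hx
  obtain ⟨u, hu⟩ := exists_det_cols_ne_zero h5
  have hd : (cols (F.vec x) (F.mat x *ᵥ u - a • u)).det ≠ 0 := by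
    rw [det_cols_sub hne hx]
    exact mul_ne_zero (sub_ne_zero.2 hne.symm) hu
  have h1 : (cols (F.vec x) ((cols (F.vec x) (F.mat x *ᵥ u - a • u)).det⁻¹ •
    (F.mat x *ᵥ u - a • u))).det = 1 := by rw [cols_smul, inv_mul_cancel₀ hd]
  exact ⟨_, h1, isFrame_diag hne hx rfl h1⟩

lemma exists_smul_eq_of_eigen (hne : a ≠ c) {x y : X}
    (hx : x ∈ F.inv ⁻¹' {(l, a + c, a * c, 0)} \ F.eigenSet c)
    (hy : y ∈ F.inv ⁻¹' {(l, a + c, a * c, 0)} \ F.eigenSet c) : ∃ g : G, y = g • x := by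
  obtain ⟨M, hM, h1⟩ := exists_isFrame_diag hne hx
  obtain ⟨M', hM', h2⟩ := exists_isFrame_diag hne hy
  obtain ⟨s, -, hs⟩ := h1.exists_slAct h2 (hM'.trans hM.symm) (by rw [hM]; exact one_ne_zero)
  exact ⟨_, (exists_smul_eq ((mem_fiber.1 hx.1).1.trans (mem_fiber.1 hy.1).1.symm) hs).symm⟩

/-- The involution exchanges the two eigenvalues of an eigenvector. -/
lemma map_mem_eigen (hτ : F.IsCompatible τ) (hne : a ≠ c) {x : X}
    (hx : x ∈ F.inv ⁻¹' {(l, a + c, a * c, 0)} \ F.eigenSet c) :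
    τ x ∈ F.inv ⁻¹' {(l, c + a, c * a, 0)} \ F.eigenSet a := by
  obtain ⟨M, hM, h⟩ := exists_isFrame_diag hne hx
  obtain ⟨h1, h2, h3, -, -⟩ := (mem_fiber_diff_eigenSet hne).1 hx
  obtain ⟨s, hs⟩ := hτ.base_map x
  have h6 := (h.tauPrime h2).slAct s
  rw [← hs] at h6
  have hN : ((s : Matrix (Fin 2) (Fin 2) k) * !![M 1 0, -M 1 1; M 0 0, -M 0 1]).det = 1 := by
    rw [det_mul, s.2, one_mul, ← hM, det_fin_two_of, det_fin_two]; ring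
  generalize (s : Matrix (Fin 2) (Fin 2) k) * !![M 1 0, -M 1 1; M 0 0, -M 0 1] = N at h6 hN
  have h7 : τ x ∈ F.inv ⁻¹' {(l, a + c, a * c, 0)} := by
    rw [mem_preimage, F.inv_map hτ]; exact hx.1
  obtain ⟨e1, e2, e3, -⟩ := mem_fiber.1 h7
  rw [mem_fiber_diff_eigenSet hne.symm]
  refine ⟨e1, e2.trans (add_comm _ _), e3.trans (mul_comm _ _), ?_, fun h0 => ?_⟩
  · change ((F.base (τ x)).1 : Matrix (Fin 2) (Fin 2) k) *ᵥ (F.base (τ x)).2 =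
      c • (F.base (τ x)).2
    rw [← h6.mulVec_eq, mulVec_mulVec, h6.mul_eq, ← mulVec_mulVec, ← mulVec_smul]
    congr 1
    ext i; fin_cases i <;> simp
  · have h9 := h6.mulVec_eq
    rw [show (F.base (τ x)).2 = 0 from h0] at h9
    have h10 := eq_zero_of_mulVec_eq_zero (by rw [hN]; exact one_ne_zero) h9
    simpa using congrFun h10 0

end SLFibration

end EigenSet

section Strata

variable {k : Type*} [Field k] [ValuativeRel k] [TopologicalSpace k] [IsNonarchimedeanLocalField k]
  {G X Λ : Type*} [Group G] [TopologicalSpace G] [IsTopologicalGroup G] [TopologicalSpace X]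
  [MulAction G X] [TopologicalSpace Λ] {F : SLFibration k G X Λ} {τ : X ≃ₜ X} {l : Λ} {a c : k}

namespace SLFibration

lemma hasOpenOrbits_eigen (hne : a ≠ c) :
    HasOpenOrbits G (F.inv ⁻¹' {(l, a + c, a * c, 0)} \ F.eigenSet c) := by
  refine hasOpenOrbits_of_frames (fun g x => ?_)
    (fun x hx y hy => (mem_fiber.1 hx.1).1.trans (mem_fiber.1 hy.1).1.symm) fun x hx => ?_
  · rw [mem_sdiff, mem_preimage, F.inv_smul, smul_mem_eigenSet_iff]; rfl
  obtain ⟨-, -, -, -, h5⟩ := (mem_fiber_diff_eigenSet hne).1 hx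
  obtain ⟨u, hu⟩ := exists_det_cols_ne_zero h5
  have hd : (cols (F.vec x) (F.mat x *ᵥ u - a • u)).det ≠ 0 := by
    rw [det_cols_sub hne hx]
    exact mul_ne_zero (sub_ne_zero.2 hne.symm) hu
  have hw : Continuous fun y => F.mat y *ᵥ u - a • u :=
    (F.continuous_mat.matrix_mulVec continuous_const).sub continuous_const
  have hD : Continuous fun y => (cols (F.vec y) (F.mat y *ᵥ u - a • u)).det :=
    (continuous_cols F.continuous_vec hw).matrix_det
  have hdet : ∀ y, (cols (F.vec y) (F.mat y *ᵥ u - a • u)).det ≠ 0 →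
      (cols (F.vec y) ((cols (F.vec y) (F.mat y *ᵥ u - a • u)).det⁻¹ •
        (F.mat y *ᵥ u - a • u))).det = 1 := fun y hy => by
    rw [cols_smul, inv_mul_cancel₀ hy]
  refine ⟨!![a, 0; 0, c], ![1, 0], fun y => cols (F.vec y)
    ((cols (F.vec y) (F.mat y *ᵥ u - a • u)).det⁻¹ • (F.mat y *ᵥ u - a • u)), ?_, ?_, ?_⟩
  · have hw' : ContinuousAt (fun y => (cols (F.vec y) (F.mat y *ᵥ u - a • u)).det⁻¹ •
        (F.mat y *ᵥ u - a • u)) x := (hD.continuousAt.inv₀ hd).smul hw.continuousAt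
    have hcols : Continuous fun p : (Fin 2 → k) × (Fin 2 → k) => cols p.1 p.2 :=
      continuous_cols continuous_fst continuous_snd
    exact (ContinuousAt.comp (f := fun y => (F.vec y,
      (cols (F.vec y) (F.mat y *ᵥ u - a • u)).det⁻¹ • (F.mat y *ᵥ u - a • u)))
      hcols.continuousAt (F.continuous_vec.continuousAt.prodMk hw')).continuousWithinAt
  · simp only [hdet x hd]; exact one_ne_zero
  · filter_upwards [self_mem_nhdsWithin, mem_nhdsWithin_of_mem_nhds
      (hD.continuousAt.eventually_ne hd)] with y hy hyd
    exact ⟨by rw [hdet y hyd, hdet x hd], isFrame_diag hne hy rfl (hdet y hyd)⟩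

variable [T2Space G]
  [LocallyCompactSpace G] [TotallyDisconnectedSpace G] [T2Space X] [ContinuousSMul G X]

/-- If the measures on the two orbits of eigenvectors agree, up to coinvariants of the whole fibre,
on some pair of compact open subsets, then the involution, which exchanges the orbits, acts by a
positive factor. -/
lemma testOn_eigen_le (hτ : F.IsCompatible τ) (hne : a ≠ c) {W W' : Set X}
    (hW : IsCompactOpenIn (F.inv ⁻¹' {(l, a + c, a * c, 0)}) W) (hWne : W.Nonempty)
    (hWe : W ⊆ F.inv ⁻¹' {(l, a + c, a * c, 0)} \ F.eigenSet c)
    (hW' : IsCompactOpenIn (F.inv ⁻¹' {(l, a + c, a * c, 0)}) W') (hW'ne : W'.Nonempty)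
    (hW'e : W' ⊆ F.inv ⁻¹' {(l, a + c, a * c, 0)} \ F.eigenSet a)
    (h : PosEquiv G (F.inv ⁻¹' {(l, a + c, a * c, 0)}) (chi W) (chi W')) :
    testOn (F.inv ⁻¹' {(l, a + c, a * c, 0)} \ F.eigenSet c) ≤
      antiCoinv G τ (F.inv ⁻¹' {(l, a + c, a * c, 0)}) := by
  refine testOn_le fun V hV => ?_
  set L := F.inv ⁻¹' {(l, a + c, a * c, 0)} with hL
  have hL' : F.inv ⁻¹' {(l, c + a, c * a, 0)} = L := by rw [add_comm c, mul_comm c]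
  have hVL : IsCompactOpenIn L V := isCompactOpenIn_of_diff isClosed_eigenSet hV
  have hst : IsStable G τ L := isStable_fiber hτ _
  rcases V.eq_empty_or_nonempty with rfl | hVne
  · rw [show chi (∅ : Set X) = 0 by funext x; simp [chi]]
    exact zero_mem _
  have restrict : ∀ {e : k} {V : Set X}, IsCompactOpenIn L V → V ⊆ L \ F.eigenSet e →
      IsCompactOpenIn (L \ F.eigenSet e) V := fun h1 h2 =>
    ⟨h2, h1.isCompact, fun x hx => nhdsWithin_mono x sdiff_subset (h1.mem_nhdsWithin x hx)⟩
  have mono : ∀ {e : k} {f f' : X → ℂ}, PosEquiv G (L \ F.eigenSet e) f f' → PosEquiv G L f f' :=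
    fun ⟨r, hr, h⟩ => ⟨r, hr, coinv_mono (testOn_diff_le isClosed_eigenSet) h⟩
  refine mem_antiCoinv_of_posEquiv (chi_mem_testOn hVL) ?_
  rw [chi_comp]
  have hVτ : τ ⁻¹' V ⊆ L \ F.eigenSet a := by
    intro x hx
    have hxL : x ∈ L := (hst.map_mem x).1 (hVL.subset hx)
    refine ⟨hxL, fun hxa => ?_⟩
    by_cases hxc : x ∈ F.eigenSet c
    · have h1 : F.mat x *ᵥ F.vec x = a • F.vec x := hxa
      have h2 : F.mat x *ᵥ F.vec x = c • F.vec x := hxc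
      rw [h1, ← sub_eq_zero, ← sub_smul, smul_eq_zero, sub_eq_zero] at h2
      have h3 : x ∈ F.zeroSet := h2.resolve_left hne
      have h4 : F.vec (τ x) = 0 := ((isStable_zeroSet hτ).map_mem x).2 h3
      refine (hV.subset hx).2 ?_
      change _ = _
      rw [h4, mulVec_zero, smul_zero]
    · have h1 := map_mem_eigen hτ hne ⟨hxL, hxc⟩
      have h2 := (mem_fiber_diff_eigenSet hne.symm).1 h1
      exact (hV.subset hx).2 h2.2.2.2.1
  obtain ⟨x, hx⟩ := hVne
  obtain ⟨y, hy⟩ := hW'ne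
  have h1 : PosEquiv G L (chi (τ ⁻¹' V)) (chi W') := by
    have hoo := hasOpenOrbits_eigen (F := F) (l := l) hne.symm
    rw [hL'] at hoo
    refine mono (hoo.posEquiv_chi (restrict (hVL.preimage τ hst.map_mem) hVτ) (restrict hW' hW'e)
      ⟨τ.symm x, by simpa using hx⟩ ⟨y, hy⟩ y (hW'e hy) (fun z hz => ?_) fun z hz => ?_)
    · exact exists_smul_eq_of_eigen hne.symm (hL' ▸ hW'e hy) (hL' ▸ hVτ hz)
    · exact exists_smul_eq_of_eigen hne.symm (hL' ▸ hW'e hy) (hL' ▸ hW'e hz)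
  refine (h1.trans h.symm).trans (mono ((hasOpenOrbits_eigen hne).posEquiv_chi (restrict hW hWe) hV
    hWne ⟨x, hx⟩ x (hV.subset hx) (fun z hz => ?_) fun z hz => ?_))
  · exact exists_smul_eq_of_eigen hne (hV.subset hx) (hWe hz)
  · exact exists_smul_eq_of_eigen hne (hV.subset hx) (hV.subset hz)

end SLFibration

end Strata

/-! ### The torus and the Weyl element of `SL(2)` -/

section Torus

variable {k : Type*} [Field k]

/-- The diagonal matrix `diag(r, r⁻¹)`. -/
def diagSL (r : k) (hr : r ≠ 0) : SL(2, k) :=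
  ⟨!![r, 0; 0, r⁻¹], by rw [det_fin_two_of, mul_inv_cancel₀ hr]; ring⟩

/-- The Weyl element of `SL(2)`. -/
def weylSL (k : Type*) [Field k] : SL(2, k) := ⟨!![0, 1; -1, 0], by rw [det_fin_two_of]; ring⟩

lemma weylSL_pow_four : weylSL k ^ 4 = 1 := by
  have h : weylSL k * weylSL k = -1 := by
    refine Subtype.ext ?_
    change !![0, 1; -1, 0] * !![0, 1; -1, 0] = -(1 : Matrix (Fin 2) (Fin 2) k)
    ext i j
    fin_cases i <;> fin_cases j <;> simp
  rw [show 4 = 2 * 2 from rfl, pow_mul, sq, sq, h]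
  simp

lemma diagSL_mul_weylSL_mul_diagSL (r : k) (hr : r ≠ 0) :
    diagSL r hr * weylSL k * diagSL r hr = weylSL k := by
  refine Subtype.ext ?_
  change !![r, 0; 0, r⁻¹] * !![0, 1; -1, 0] * !![r, 0; 0, r⁻¹] =
    (!![0, 1; -1, 0] : Matrix (Fin 2) (Fin 2) k)
  ext i j
  fin_cases i <;> fin_cases j <;> simp [hr]

lemma commute_diagSL {s : SL(2, k)} (h01 : s 0 1 = 0) (h10 : s 1 0 = 0) (r : k) (hr : r ≠ 0) :
    Commute s (diagSL r hr) := by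
  refine Subtype.ext ?_
  change (s : Matrix (Fin 2) (Fin 2) k) * !![r, 0; 0, r⁻¹] =
    !![r, 0; 0, r⁻¹] * (s : Matrix (Fin 2) (Fin 2) k)
  have h01' : (s : Matrix (Fin 2) (Fin 2) k) 0 1 = 0 := h01
  have h10' : (s : Matrix (Fin 2) (Fin 2) k) 1 0 = 0 := h10
  ext i j
  fin_cases i <;> fin_cases j <;> simp [Matrix.mul_apply, Fin.sum_univ_two, h01', h10', mul_comm]

end Torus

section Conjugates

variable {G : Type*} [Group G]

lemma comap_conj_comap_conj (K : Subgroup G) (g h : G) :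
    (K.comap (MulAut.conj g).toMonoidHom).comap (MulAut.conj h).toMonoidHom =
      K.comap (MulAut.conj (g * h)).toMonoidHom := by
  ext x; simp [Subgroup.mem_comap, mul_assoc]

/-- If conjugation by `R` exchanges `K` and `K₁`, then `K ∩ K₁` has the same index in both. -/
lemma relIndex_inf_eq {K K₁ : Subgroup G} {R : G}
    (h : K.comap (MulAut.conj R).toMonoidHom = K₁) (h₁ : K₁.comap (MulAut.conj R).toMonoidHom = K) :
    (K ⊓ K₁).relIndex K₁ = (K ⊓ K₁).relIndex K := by
  have h2 : (K ⊓ K₁).comap (MulAut.conj R).toMonoidHom = K ⊓ K₁ := by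
    rw [Subgroup.comap_inf, h, h₁, inf_comm]
  have h3 := Subgroup.relIndex_comap (K ⊓ K₁) (MulAut.conj R).toMonoidHom K₁
  rw [h2] at h3
  rw [h3, ← h, Subgroup.map_comap_eq_self_of_surjective]
  exact (MulAut.conj R).surjective

variable [TopologicalSpace G] [IsTopologicalGroup G]

/-- A compact open subgroup can be shrunk to one that is stable under conjugation by an element `w`
with `w⁴ = 1`, by intersecting its conjugates under the powers of `w`. -/
lemma exists_subgroup_comap_eq [T2Space G] {K₀ : Subgroup G} (ho : IsOpen (K₀ : Set G))
    (hc : IsCompact (K₀ : Set G)) {w : G} (hw : w ^ 4 = 1) : ∃ K ≤ K₀, IsOpen (K : Set G) ∧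
      IsCompact (K : Set G) ∧ K.comap (MulAut.conj w).toMonoidHom = K := by
  let c : ℕ → Subgroup G := fun n => K₀.comap (MulAut.conj (w ^ n)).toMonoidHom
  have hc0 : c 0 = K₀ := by ext x; simp [c, Subgroup.mem_comap]
  have hc4 : c 4 = K₀ := by
    ext x
    change w ^ 4 * x * (w ^ 4)⁻¹ ∈ K₀ ↔ x ∈ K₀
    rw [hw]
    simp
  have hcs : ∀ n, (c n).comap (MulAut.conj w).toMonoidHom = c (n + 1) := fun n => by
    rw [comap_conj_comap_conj, ← pow_succ]
  have hco : ∀ n, IsOpen (c n : Set G) := fun n => isOpen_comap_conj ho _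
  have hle : c 0 ⊓ c 1 ⊓ c 2 ⊓ c 3 ≤ K₀ := by
    rw [hc0]; exact inf_le_left.trans (inf_le_left.trans inf_le_left)
  have hop : IsOpen ((c 0 ⊓ c 1 ⊓ c 2 ⊓ c 3 : Subgroup G) : Set G) :=
    (((hco 0).inter (hco 1)).inter (hco 2)).inter (hco 3)
  refine ⟨_, hle, hop, hc.of_isClosed_subset (Subgroup.isClosed_of_isOpen _ hop) hle, ?_⟩
  simp only [Subgroup.comap_inf, hcs]
  rw [show (3 + 1 : ℕ) = 4 from rfl, hc4, ← hc0]
  simp only [zero_add, Nat.reduceAdd]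
  ext x
  simp only [Subgroup.mem_inf]
  tauto

end Conjugates

/-! ### Points over a diagonal matrix -/

section PointSection

variable {k : Type*} [Field k] [TopologicalSpace k] [IsTopologicalRing k]
  {G X Λ : Type*} [Group G] [TopologicalSpace G] [TopologicalSpace X]
  [MulAction G X] [TopologicalSpace Λ] {F : SLFibration k G X Λ} {τ : X ≃ₜ X} {l : Λ} {a c : k}
  {g₀ : GL (Fin 2) k}

namespace SLFibration

/-- An element of `G` that carries a point of the section to a point of the section comes from
`SL(2)`. -/
lemma eq_sec_of_smul_point {g : G} {b b' : GL (Fin 2) k × (Fin 2 → k)}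
    (h : g • F.point l b = F.point l b') : g = F.sec (F.proj g) ∧ slAct (F.proj g) b = b' := by
  have h1 := F.shift_smul g (F.point l b)
  have h2 := F.base_smul g (F.point l b)
  rw [h, F.shift_point, F.shift_point, one_mul, mul_one] at h1
  rw [h, F.base_point, F.base_point] at h2
  exact ⟨h1.symm, h2.symm⟩

/-- The centralizer of `diag(a, c)` in `SL(2)` consists of diagonal matrices. -/
lemma diagonal_of_slAct (hne : a ≠ c) (hg₀ : (g₀ : Matrix (Fin 2) (Fin 2) k) = !![a, 0; 0, c])
    {s : SL(2, k)} {v v' : Fin 2 → k} (h : slAct s (g₀, v) = (g₀, v')) :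
    s 0 1 = 0 ∧ s 1 0 = 0 := by
  have h1 := slAct_fst_mul s (g₀, v)
  rw [h] at h1
  simp only [hg₀] at h1
  rw [← Matrix.ext_iff] at h1
  simp [Matrix.mul_apply, Fin.sum_univ_two, Fin.forall_fin_two] at h1
  obtain ⟨⟨-, h2⟩, h3, -⟩ := h1
  constructor
  · have : (a - c) * s 0 1 = 0 := by linear_combination h2
    exact (mul_eq_zero.1 this).resolve_left (sub_ne_zero.2 hne)
  · have : (a - c) * s 1 0 = 0 := by linear_combination -h3
    exact (mul_eq_zero.1 this).resolve_left (sub_ne_zero.2 hne)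

lemma sec_diagSL_smul_point (hg₀ : (g₀ : Matrix (Fin 2) (Fin 2) k) = !![a, 0; 0, c]) (r : k)
    (hr : r ≠ 0) (v : Fin 2 → k) :
    F.sec (diagSL r hr) • F.point l (g₀, v) = F.point l (g₀, ![r * v 0, r⁻¹ * v 1]) := by
  rw [F.sec_smul_point]
  congr 1
  refine Prod.ext (Units.ext ?_) ?_
  · rw [slAct_fst]
    change !![r, 0; 0, r⁻¹] * (g₀ : Matrix (Fin 2) (Fin 2) k) *
      (adjugate !![r, 0; 0, r⁻¹]) = (g₀ : Matrix (Fin 2) (Fin 2) k)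
    rw [hg₀, adjugate_fin_two_of]
    ext i j
    fin_cases i <;> fin_cases j <;> simp [Matrix.mul_apply, Fin.sum_univ_two]
    · field_simp
    · field_simp
  · rw [slAct_snd]
    change !![r, 0; 0, r⁻¹] *ᵥ v = _
    ext i
    fin_cases i <;> simp [Matrix.mulVec, dotProduct, Fin.sum_univ_two]

lemma point_mem_fiber (hg₀ : (g₀ : Matrix (Fin 2) (Fin 2) k) = !![a, 0; 0, c]) {v : Fin 2 → k}
    (hv : v 0 * v 1 = 0) : F.point l (g₀, v) ∈ F.inv ⁻¹' {(l, a + c, a * c, 0)} := by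
  rw [mem_fiber, mat, F.base_point, F.param_point, qInv, det_cols, mulVec_fin_two]
  simp only [hg₀]
  refine ⟨trivial, by simp [trace_fin_two], by simp [det_fin_two], ?_⟩
  simp
  linear_combination (c - a) * hv

lemma point_mem_eigenSet_iff (hne : a ≠ c)
    (hg₀ : (g₀ : Matrix (Fin 2) (Fin 2) k) = !![a, 0; 0, c]) {v : Fin 2 → k} :
    (F.point l (g₀, v) ∈ F.eigenSet a ↔ v 1 = 0) ∧
      (F.point l (g₀, v) ∈ F.eigenSet c ↔ v 0 = 0) := by
  have h : ∀ e, F.point l (g₀, v) ∈ F.eigenSet e ↔ a * v 0 = e * v 0 ∧ c * v 1 = e * v 1 := by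
    intro e
    change F.mat _ *ᵥ F.vec _ = e • F.vec _ ↔ _
    rw [mat, vec, F.base_point]
    simp only [hg₀]
    rw [mulVec_fin_two, funext_iff, Fin.forall_fin_two]
    simp
  rw [h, h]
  constructor
  · constructor
    · rintro ⟨-, h2⟩
      have : (a - c) * v 1 = 0 := by linear_combination -h2
      exact (mul_eq_zero.1 this).resolve_left (sub_ne_zero.2 hne)
    · intro h; simp [h]
  · constructor
    · rintro ⟨h2, -⟩
      have : (a - c) * v 0 = 0 := by linear_combination h2
      exact (mul_eq_zero.1 this).resolve_left (sub_ne_zero.2 hne)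
    · intro h; simp [h]

end SLFibration

end PointSection

section Strata

variable {k : Type*} [Field k] [ValuativeRel k] [TopologicalSpace k] [IsNonarchimedeanLocalField k]
  {G X Λ : Type*} [Group G] [TopologicalSpace G] [IsTopologicalGroup G] [TopologicalSpace X]
  [MulAction G X] [TopologicalSpace Λ] {F : SLFibration k G X Λ} {τ : X ≃ₜ X}
  {l : Λ} {a c : k} {g₀ : GL (Fin 2) k}

namespace SLFibration

/-- The points `(g₀, v)` of the section, with `v` in the union of the two eigenlines of the diagonal
matrix `g₀`. -/
def crossPoints (F : SLFibration k G X Λ) (l : Λ) (g₀ : GL (Fin 2) k) (B : Set (Fin 2 → k)) :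
    Set X := (fun v => F.point l (g₀, v)) '' (B ∩ {v | v 0 * v 1 = 0})

/-- The orbit maps of `G` on the pairs `(g, 0)` with `g` conjugate to `g₀` are open, so every point
of the fibre near the section can be moved to a pair `(g₀, v)` by a small element of `G`. -/
lemma isCompactOpenIn_orb_crossPoints [ContinuousSMul G X] (two_ne : (2 : k) ≠ 0)
    (hτ : F.IsCompatible τ) (hne : a ≠ c)
    (hg₀ : (g₀ : Matrix (Fin 2) (Fin 2) k) = !![a, 0; 0, c]) {K : Subgroup G}
    (hKo : IsOpen (K : Set G)) (hKc : IsCompact (K : Set G)) {B : Set (Fin 2 → k)}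
    (hBo : IsOpen B) (hBc : IsCompact B) :
    IsCompactOpenIn (F.inv ⁻¹' {(l, a + c, a * c, 0)}) (orb K (F.crossPoints l g₀ B)) := by
  have hst := isStable_fiber hτ (l, a + c, a * c, 0)
  set L := F.inv ⁻¹' {(l, a + c, a * c, 0)} with hL
  have hpt : Continuous fun v => F.point l (g₀, v) :=
    (F.continuous_point l).comp (continuous_const.prodMk continuous_id)
  have hloc : ∀ v ∈ B, v 0 * v 1 = 0 → ∀ᶠ y in 𝓝[L] F.point l (g₀, v),
      y ∈ orb K (F.crossPoints l g₀ B) := by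
    intro v hv hv0
    set z := F.point l (g₀, v) with hz
    have hzL : z ∈ L := point_mem_fiber hg₀ hv0
    have hzv : F.vec z = v := by rw [vec, hz, F.base_point]
    set p := F.point l (g₀, 0) with hp
    -- The map `r` replaces the vector `v` by zero.
    set r : X → X := fun y => F.shift y • F.point l ((F.base y).1, 0) with hr
    have hrc : Continuous r := F.continuous_shift.smul ((F.continuous_point l).comp
      ((continuous_fst.comp F.continuous_base).prodMk continuous_const))
    have hrz : r z = p := by
      change F.shift z • F.point l ((F.base z).1, 0) = p
      rw [hz, F.shift_point, F.base_point, one_smul]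
    have hrb : ∀ y, F.base (r y) = ((F.base y).1, 0) := by
      intro y
      rw [F.base_smul, F.proj_shift, slAct_one, F.base_point]
    have hrs : ∀ y, F.shift (r y) = F.shift y := by
      intro y
      have := F.shift_smul (F.shift y) (F.point l ((F.base y).1, 0))
      rwa [F.proj_shift, map_one, mul_one, F.shift_point, mul_one] at this
    set Z := (F.inv ⁻¹' {(l, a + c, a * c, 0)} ∩ F.zeroSet) \ F.scalarSet with hZ
    have hrZ : ∀ y ∈ L, r y ∈ Z := by
      intro y hy
      obtain ⟨-, h2, h3, -⟩ := mem_fiber.1 hy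
      have hm : F.mat (r y) = F.mat y := by rw [mat, hrb]; rfl
      have hv : F.vec (r y) = 0 := by rw [vec, hrb]
      refine ⟨⟨mem_fiber.2 ⟨?_, by rw [hm, h2], by rw [hm, h3], ?_⟩, hv⟩, fun h => hne ?_⟩
      · rw [F.param_smul, F.param_point]
      · rw [qInv, show (F.base (r y)).2 = 0 from hv, det_cols]; simp
      · obtain ⟨e1, e2, e3⟩ := h
        rw [hm] at e1 e2 e3
        rw [trace_fin_two] at h2
        rw [det_fin_two, e1] at h3
        have : (a - c) * (a - c) = 0 := by
          linear_combination -(F.mat y 0 0 + F.mat y 1 1 + a + c) * h2 + 4 * h3 +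
            (F.mat y 0 0 - F.mat y 1 1) * e3
        exact sub_eq_zero.1 (mul_self_eq_zero.1 this)
    have hB : ∀ᶠ q in 𝓝 ((1 : G), z), F.vec (q.1⁻¹ • q.2) ∈ B := by
      have hcont : Continuous fun q : G × X => F.vec (q.1⁻¹ • q.2) :=
        F.continuous_vec.comp (continuous_fst.inv.smul continuous_snd)
      refine hcont.continuousAt.eventually_mem (hBo.mem_nhds ?_)
      simpa [hzv] using hv
    obtain ⟨N, hN, M, hM, hNM⟩ := mem_nhds_prod_iff.1 hB
    have horb := (hasOpenOrbits_nonscalar two_ne hτ (l, a + c, a * c, 0)).orbit_mem_nhdsWithin p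
      (hrz ▸ hrZ z hzL) (N ∩ K) (Filter.inter_mem hN (hKo.mem_nhds K.one_mem))
    have hlim : Filter.Tendsto r (𝓝[L] z) (𝓝[Z] p) := by
      have := hrc.continuousWithinAt.tendsto_nhdsWithin (t := Z) (x := z) (s := L) hrZ
      rwa [hrz] at this
    filter_upwards [hlim horb, self_mem_nhdsWithin, mem_nhdsWithin_of_mem_nhds hM] with y hy hyL hyM
    obtain ⟨g, ⟨hgN, hgK⟩, hgy⟩ := hy
    refine ⟨g, hgK, g⁻¹ • y, ⟨F.vec (g⁻¹ • y), ⟨hNM (mk_mem_prod hgN hyM), ?_⟩, ?_⟩,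
      smul_inv_smul _ _⟩
    all_goals
      have hyL' : g⁻¹ • y ∈ L := (hst.smul_mem _ _).2 hyL
      have h1 : (F.base (g⁻¹ • y)).1 = g₀ := by
        have h2 := F.base_smul g p
        rw [hgy, hrb, hp, F.base_point] at h2
        have h3 := F.base_smul g (g⁻¹ • y)
        rw [smul_inv_smul] at h3
        have h4 : (slAct (F.proj g) (F.base (g⁻¹ • y))).1 = (slAct (F.proj g) (g₀, 0)).1 := by
          rw [← h3, ← h2]
        have h5 := congrArg Units.val h4
        rw [slAct_fst, slAct_fst] at h5
        have h6 := congrArg (fun A => ((F.proj g)⁻¹ : SL(2, k)).val * A * (F.proj g).val) h5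
        have h7 : ((F.proj g)⁻¹ : SL(2, k)).val * (F.proj g).val = 1 := sl_inv_mul _
        simp only [Matrix.mul_assoc, h7, Matrix.mul_one] at h6
        simp only [← Matrix.mul_assoc, h7, Matrix.one_mul] at h6
        exact Units.ext h6
    · obtain ⟨-, -, -, h2⟩ := mem_fiber.1 hyL'
      rw [qInv, h1, det_cols, hg₀, mulVec_fin_two] at h2
      simp at h2
      have : (a - c) * (F.vec (g⁻¹ • y) 0 * F.vec (g⁻¹ • y) 1) = 0 := by
        rw [vec]; linear_combination -h2
      exact (mul_eq_zero.1 this).resolve_left (sub_ne_zero.2 hne)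
    · have h2 := F.shift_smul g p
      rw [hgy, hrs, hp, F.shift_point, mul_one] at h2
      have h3 := F.shift_smul g (g⁻¹ • y)
      rw [smul_inv_smul, h2] at h3
      have h4 : F.shift (g⁻¹ • y) = 1 := (mul_eq_left.1 h3.symm)
      have h5 := F.shift_smul_point (g⁻¹ • y)
      rw [h4, one_smul, (mem_fiber.1 hyL').1] at h5
      refine Eq.trans ?_ h5
      change F.point l (g₀, (F.base (g⁻¹ • y)).2) = _
      congr 1
      exact Prod.ext h1.symm rfl
  refine ⟨?_, ?_, ?_⟩
  · rintro _ ⟨g, -, _, ⟨v, ⟨-, hv⟩, rfl⟩, rfl⟩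
    exact (hst.smul_mem _ _).2 (point_mem_fiber hg₀ hv)
  · have h1 : orb K (F.crossPoints l g₀ B) =
        (fun q : G × X => q.1 • q.2) '' ((K : Set G) ×ˢ F.crossPoints l g₀ B) := by
      ext y
      constructor
      · rintro ⟨g, hg, v, hv, rfl⟩; exact ⟨(g, v), ⟨hg, hv⟩, rfl⟩
      · rintro ⟨⟨g, v⟩, ⟨hg, hv⟩, rfl⟩; exact ⟨g, hg, v, hv, rfl⟩
    rw [h1]
    refine (hKc.prod ((hBc.inter_right ?_).image hpt)).image continuous_smul
    exact isClosed_eq ((continuous_apply 0).mul (continuous_apply 1)) continuous_const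
  · rintro _ ⟨g, hg, _, ⟨v, ⟨hv, hv0⟩, rfl⟩, rfl⟩
    have h1 := hloc v hv hv0
    have h2 : Filter.Tendsto (fun y => g⁻¹ • y) (𝓝[L] (g • F.point l (g₀, v)))
        (𝓝[L] F.point l (g₀, v)) := by
      have := (continuous_const_smul g⁻¹).continuousWithinAt.tendsto_nhdsWithin (t := L) (s := L)
        (x := g • F.point l (g₀, v)) (fun y hy => (hst.smul_mem _ _).2 hy)
      rwa [inv_smul_smul] at this
    filter_upwards [h2.eventually h1] with y hy
    exact (smul_mem_orb_iff (K.inv_mem hg)).1 hy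

/-- For a compact open subgroup `K`, a diagonal element `T = diag(r, r⁻¹)` of `SL(2)` and
`K₁ = T K T⁻¹`, the sets `K V` and `K₁ V` have the same class in the coinvariants when `V` consists of points
over `g₀`. Indeed `K V` is the union of the translates of `(K ∩ K₁) V` by `K / (K ∩ K₁)`, and every
point of `V` lies in only one of them, because the elements of `K` that carry a point over `g₀` to
another one are diagonal, commute with `T` and hence lie in `K ∩ K₁`; the same holds for `K₁`. The
indices of `K ∩ K₁` in `K` and `K₁` agree because conjugation by `w T⁻¹` exchanges the two groups,
where `w` is the Weyl element, which normalizes `K`. -/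
lemma chi_orb_sub_mem_coinv [T2Space G] (hne : a ≠ c)
    (hg₀ : (g₀ : Matrix (Fin 2) (Fin 2) k) = !![a, 0; 0, c]) {K : Subgroup G}
    (hKo : IsOpen (K : Set G)) (hKc : IsCompact (K : Set G))
    (hKw : K.comap (MulAut.conj (F.sec (weylSL k))).toMonoidHom = K) {r : k} (hr : r ≠ 0)
    {L : Set X} {B : Set (Fin 2 → k)}
    (hL : ∀ K : Subgroup G, IsOpen (K : Set G) → IsCompact (K : Set G) →
      chi (orb K (F.crossPoints l g₀ B)) ∈ testOn L) :
    chi (orb K (F.crossPoints l g₀ B)) -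
      chi (orb (K.comap (MulAut.conj (F.sec (diagSL r hr))⁻¹).toMonoidHom)
        (F.crossPoints l g₀ B)) ∈ coinv G L := by
  set T := F.sec (diagSL r hr) with hT
  set w := F.sec (weylSL k) with hw
  set K₁ := K.comap (MulAut.conj T⁻¹).toMonoidHom with hK₁
  set V := F.crossPoints l g₀ B with hV
  have hK₁o : IsOpen (K₁ : Set G) := isOpen_comap_conj hKo _
  have hK₁c : IsCompact (K₁ : Set G) := isCompact_comap_conj hKc _
  have hTwT : T * w * T = w := by
    rw [hT, hw, ← map_mul, ← map_mul, diagSL_mul_weylSL_mul_diagSL]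
  have hidx : (K ⊓ K₁).relIndex K₁ = (K ⊓ K₁).relIndex K := by
    refine relIndex_inf_eq (R := w * T⁻¹) ?_ ?_
    · rw [← comap_conj_comap_conj, hKw]
    · have h1 : T⁻¹ * (w * T⁻¹) = w := by
        conv_lhs => rw [← hTwT]
        simp [mul_assoc]
      rw [hK₁, comap_conj_comap_conj, h1, hKw]
  have hio : IsOpen ((K ⊓ K₁ : Subgroup G) : Set G) := hKo.inter hK₁o
  have hic : IsCompact ((K ⊓ K₁ : Subgroup G) : Set G) :=
    hKc.of_isClosed_subset (Subgroup.isClosed_of_isOpen _ hio) inter_subset_left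
  have hstab : ∀ g : G, ∀ v ∈ V, ∀ v' ∈ V, g • v' = v → (g ∈ K ↔ g ∈ K₁) := by
    rintro g _ ⟨x, -, rfl⟩ _ ⟨x', -, rfl⟩ h
    obtain ⟨h1, h2⟩ := eq_sec_of_smul_point h
    obtain ⟨h3, h4⟩ := diagonal_of_slAct hne hg₀ h2
    have h5 : T⁻¹ * g * T = g := by
      rw [h1, hT, ← map_inv, ← map_mul, ← map_mul, mul_assoc, (commute_diagSL h3 h4 r hr).eq,
        inv_mul_cancel_left]
    rw [hK₁, Subgroup.mem_comap]
    change _ ↔ T⁻¹ * g * T⁻¹⁻¹ ∈ K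
    rw [inv_inv, h5]
  have hcard : ∀ H : Subgroup G, (∀ g : G, ∀ v ∈ V, ∀ v' ∈ V, g • v' = v → g ∈ H → g ∈ K ⊓ K₁) →
      K ⊓ K₁ ≤ H → ∀ v ∈ V,
        Nat.card {q : H ⧸ (K ⊓ K₁).subgroupOf H // (q.out : G)⁻¹ • v ∈ orb (K ⊓ K₁) V} = 1 := by
    intro H hH hle v hv
    rw [Nat.card_eq_one_iff_exists]
    have hone : ((((1 : H) : H ⧸ (K ⊓ K₁).subgroupOf H).out : H) : G)⁻¹ • v ∈ orb (K ⊓ K₁) V := by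
      obtain ⟨b, hb⟩ := QuotientGroup.mk_out_eq_mul ((K ⊓ K₁).subgroupOf H) 1
      rw [hb, one_mul]
      exact (smul_mem_orb_iff (Subgroup.inv_mem _ (Subgroup.mem_subgroupOf.1 b.2))).2
        (subset_orb _ _ hv)
    refine ⟨⟨_, hone⟩, ?_⟩
    rintro ⟨q, i, hi, v', hv', h⟩
    refine Subtype.ext ?_
    have h1 : ((q.out : G) * i) • v' = v := by rw [mul_smul, h, smul_inv_smul]
    have h2 := hH _ v hv v' hv' h1 (H.mul_mem q.out.2 (hle hi))
    have h3 : (q.out : G) ∈ K ⊓ K₁ := by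
      have := (K ⊓ K₁).mul_mem h2 ((K ⊓ K₁).inv_mem hi)
      rwa [mul_inv_cancel_right] at this
    change q = _
    rw [← QuotientGroup.out_eq' q, QuotientGroup.eq]
    simpa [Subgroup.mem_subgroupOf] using h3
  have e1 := relIndex_smul_chi_orb_sub hKc hio inf_le_left (hL _ hio hic) 1
    (hcard K (fun g v hv v' hv' h hg => ⟨hg, (hstab g v hv v' hv' h).1 hg⟩) inf_le_left)
  have e2 := relIndex_smul_chi_orb_sub hK₁c hio inf_le_right (hL _ hio hic) 1
    (hcard K₁ (fun g v hv v' hv' h hg => ⟨(hstab g v hv v' hv' h).2 hg, hg⟩) inf_le_right)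
  rw [hidx] at e2
  have e3 := sub_mem e2 e1
  convert e3 using 1
  simp

end SLFibration

end Strata

/-! ### The two orbits of eigenvectors -/

section Boxes

open ValuativeRel

variable (k : Type*) [Field k] [ValuativeRel k] [TopologicalSpace k] [IsNonarchimedeanLocalField k]

/-- The lattice `𝒪² ⊆ k²`. -/
def integralBox : Set (Fin 2 → k) := {v | ∀ i, valuation k (v i) ≤ 1}

lemma isOpen_integralBox : IsOpen (integralBox k) := by
  have : integralBox k = ⋂ i, (fun v => v i) ⁻¹' {x : k | valuation k x ≤ 1} := by
    ext v; simp [integralBox]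
  rw [this]
  exact isOpen_iInter_of_finite fun i => (isOpen_integers k).preimage (continuous_apply i)

lemma isCompact_integralBox : IsCompact (integralBox k) := by
  have : integralBox k = univ.pi fun _ => {x : k | valuation k x ≤ 1} := by
    ext v; simp [integralBox]
  rw [this]
  exact isCompact_univ_pi fun _ => IsNonarchimedeanLocalField.isCompact_closedBall k 1

end Boxes

section Strata

open ValuativeRel

variable {k : Type*} [Field k] [ValuativeRel k] [TopologicalSpace k] [IsNonarchimedeanLocalField k]
  {G X Λ : Type*} [Group G] [TopologicalSpace G] [IsTopologicalGroup G] [T2Space G]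
  [LocallyCompactSpace G] [TotallyDisconnectedSpace G] [TopologicalSpace X] [T2Space X]
  [MulAction G X] [ContinuousSMul G X] [TopologicalSpace Λ] {F : SLFibration k G X Λ} {τ : X ≃ₜ X}
  {a c : k}

namespace SLFibration

/-- The measures on the two orbits of eigenvectors are linked by a relation in the coinvariants of
the fibre. With `C` and `C' = diag(ϖ, ϖ⁻¹) C` the parts in `𝒪 × 𝒪` and in `ϖ 𝒪 × ϖ⁻¹ 𝒪` of the union
of the two eigenlines, the sets `K C` and `K C'` have the same class; the first is larger along one
eigenline, the second along the other. -/
lemma exists_linked (two_ne : (2 : k) ≠ 0) (hτ : F.IsCompatible τ) (l : Λ) (hne : a ≠ c)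
    (h0 : a * c ≠ 0) : ∃ W W' : Set X,
      IsCompactOpenIn (F.inv ⁻¹' {(l, a + c, a * c, 0)}) W ∧ W.Nonempty ∧
      W ⊆ F.inv ⁻¹' {(l, a + c, a * c, 0)} \ F.eigenSet c ∧
      IsCompactOpenIn (F.inv ⁻¹' {(l, a + c, a * c, 0)}) W' ∧ W'.Nonempty ∧
      W' ⊆ F.inv ⁻¹' {(l, a + c, a * c, 0)} \ F.eigenSet a ∧
      PosEquiv G (F.inv ⁻¹' {(l, a + c, a * c, 0)}) (chi W) (chi W') := by
  obtain ⟨ϖ, hϖ, hϖ1⟩ := exists_uniformizing (k := k)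
  obtain ⟨g₀, hg₀⟩ : ∃ g₀ : GL (Fin 2) k, (g₀ : Matrix (Fin 2) (Fin 2) k) = !![a, 0; 0, c] :=
    ⟨GeneralLinearGroup.mkOfDetNeZero !![a, 0; 0, c] (by rw [det_fin_two_of]; simpa using h0), rfl⟩
  -- Elements of the compact open subgroup `K` have integral matrix entries, so their diagonal part
  -- cannot enlarge a vector of the lattice.
  have hU : {g : G | ∀ i j, valuation k (F.proj g i j) ≤ 1} ∈ 𝓝 (1 : G) := by
    have hc : ∀ i j, Continuous fun g : G => F.proj g i j := fun i j =>
      (continuous_subtype_val.comp F.continuous_proj).matrix_elem i j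
    have h : ∀ i j, ∀ᶠ g in 𝓝 (1 : G), valuation k (F.proj g i j) ≤ 1 := fun i j => by
      refine (hc i j).continuousAt.eventually_mem ((isOpen_integers k).mem_nhds ?_)
      rw [map_one]
      change valuation k ((1 : Matrix (Fin 2) (Fin 2) k) i j) ≤ 1
      fin_cases i <;> fin_cases j <;> simp
    exact Filter.eventually_all.2 fun i => Filter.eventually_all.2 fun j => h i j
  obtain ⟨K₀, hK₀o, hK₀c, hK₀⟩ := exists_compact_open_subgroup hU
  obtain ⟨K, hKK₀, hKo, hKc, hKw⟩ := exists_subgroup_comap_eq hK₀o hK₀c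
    (w := F.sec (weylSL k)) (by rw [← map_pow, weylSL_pow_four, map_one])
  have hint : ∀ g ∈ K, ∀ i j, valuation k (F.proj g i j) ≤ 1 := fun g hg => hK₀ (hKK₀ hg)
  set L := F.inv ⁻¹' {(l, a + c, a * c, 0)} with hL
  set B' : Set (Fin 2 → k) := (fun v => ![ϖ⁻¹ * v 0, ϖ * v 1]) ⁻¹' integralBox k with hB'
  have hBo' : IsOpen B' := (isOpen_integralBox k).preimage (by
    refine continuous_pi fun i => ?_
    fin_cases i
    · exact continuous_const.mul (continuous_apply 0)
    · exact continuous_const.mul (continuous_apply 1))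
  have himage : B' = (fun v : Fin 2 → k => ![ϖ * v 0, ϖ⁻¹ * v 1]) '' integralBox k := by
    ext v
    constructor
    · intro hv
      refine ⟨_, hv, ?_⟩
      ext i
      fin_cases i <;> simp [hϖ]
    · rintro ⟨v, hv, rfl⟩
      change _ ∈ integralBox k
      convert hv using 1
      ext i
      fin_cases i <;> simp [hϖ]
  have hBc' : IsCompact B' := by
    rw [himage]
    refine (isCompact_integralBox k).image (continuous_pi fun i => ?_)
    fin_cases i
    · exact continuous_const.mul (continuous_apply 0)
    · exact continuous_const.mul (continuous_apply 1)
  have hcross : F.crossPoints l g₀ B' =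
      (F.sec (diagSL ϖ hϖ) • ·) '' F.crossPoints l g₀ (integralBox k) := by
    rw [himage]
    ext x
    constructor
    · rintro ⟨_, ⟨⟨v, hv, rfl⟩, hv0⟩, rfl⟩
      refine ⟨_, ⟨v, ⟨hv, ?_⟩, rfl⟩, sec_diagSL_smul_point hg₀ ϖ hϖ v⟩
      have h1 : ϖ * v 0 * (ϖ⁻¹ * v 1) = 0 := hv0
      change v 0 * v 1 = 0
      field_simp at h1
      exact h1
    · rintro ⟨_, ⟨v, ⟨hv, hv0⟩, rfl⟩, rfl⟩
      refine ⟨_, ⟨⟨v, hv, rfl⟩, ?_⟩, (sec_diagSL_smul_point hg₀ ϖ hϖ v).symm⟩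
      have h1 : v 0 * v 1 = 0 := hv0
      change ϖ * v 0 * (ϖ⁻¹ * v 1) = 0
      field_simp
      exact h1
  have hco : ∀ K : Subgroup G, IsOpen (K : Set G) → IsCompact (K : Set G) →
      IsCompactOpenIn L (orb K (F.crossPoints l g₀ B')) := fun K h1 h2 =>
    isCompactOpenIn_orb_crossPoints two_ne hτ hne hg₀ h1 h2 hBo' hBc'
  have hA : IsCompactOpenIn L (orb K (F.crossPoints l g₀ (integralBox k))) :=
    isCompactOpenIn_orb_crossPoints two_ne hτ hne hg₀ hKo hKc (isOpen_integralBox k)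
      (isCompact_integralBox k)
  have hA' := hco K hKo hKc
  have hdiff : chi (orb K (F.crossPoints l g₀ (integralBox k))) -
      chi (orb K (F.crossPoints l g₀ B')) ∈ coinv G L := by
    have h1 := chi_orb_sub_mem_coinv hne hg₀ hKo hKc hKw hϖ
      fun K h1 h2 => chi_mem_testOn (hco K h1 h2)
    have h2 := chi_smul_sub_mem_coinv (chi_mem_testOn hA) (F.sec (diagSL ϖ hϖ))
    have h3 : orb (K.comap (MulAut.conj (F.sec (diagSL ϖ hϖ))⁻¹).toMonoidHom)
        (F.crossPoints l g₀ B') = ((F.sec (diagSL ϖ hϖ))⁻¹ • ·) ⁻¹'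
          orb K (F.crossPoints l g₀ (integralBox k)) := by
      rw [hcross, orb_image_smul, comap_conj_comap_conj, inv_mul_cancel]
      congr 2
      ext x
      simp
    rw [h3] at h1
    have h4 := neg_mem (add_mem h1 h2)
    convert h4 using 1
    abel
  refine ⟨orb K (F.crossPoints l g₀ (integralBox k)) \ orb K (F.crossPoints l g₀ B'),
    orb K (F.crossPoints l g₀ B') \ orb K (F.crossPoints l g₀ (integralBox k)),
    hA.diff hA', ?_, ?_, hA'.diff hA, ?_, ?_, 1, one_pos, ?_⟩
  · refine ⟨F.point l (g₀, ![1, 0]), subset_orb _ _ ⟨_, ⟨?_, by simp⟩, rfl⟩, ?_⟩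
    · intro i; fin_cases i <;> simp
    · rintro ⟨g, hg, _, ⟨v, ⟨hv, -⟩, rfl⟩, h⟩
      obtain ⟨-, h1⟩ := eq_sec_of_smul_point h
      obtain ⟨h2, -⟩ := diagonal_of_slAct hne hg₀ h1
      have h3 : F.proj g 0 0 * v 0 + F.proj g 0 1 * v 1 = 1 := by
        have := congrFun (congrArg Prod.snd h1) 0
        rwa [slAct_snd, mulVec_fin_two] at this
      rw [h2, zero_mul, add_zero] at h3
      have h4 : valuation k (ϖ⁻¹ * v 0) ≤ 1 := hv 0
      have h5 : ϖ⁻¹ = F.proj g 0 0 * (ϖ⁻¹ * v 0) := by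
        rw [mul_left_comm, h3, mul_one]
      have h6 : valuation k ϖ⁻¹ ≤ 1 := by
        rw [h5, map_mul]; exact mul_le_one' (hint g hg 0 0) h4
      rw [map_inv₀] at h6
      exact absurd h6 (not_le.2 ((one_lt_inv₀ (by simpa [zero_lt_iff] using hϖ)).2 hϖ1))
  · intro x hx
    refine ⟨hA.subset hx.1, fun hxc => hx.2 ?_⟩
    obtain ⟨g, hg, _, ⟨v, ⟨hv, hv0⟩, rfl⟩, rfl⟩ := hx.1
    have h1 := (point_mem_eigenSet_iff hne hg₀).2.1 ((smul_mem_eigenSet_iff g).1 hxc)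
    refine ⟨g, hg, _, ⟨v, ⟨fun i => ?_, hv0⟩, rfl⟩, rfl⟩
    fin_cases i
    · simp [h1]
    · change valuation k (ϖ * v 1) ≤ 1
      rw [map_mul]
      exact mul_le_one' hϖ1.le (hv 1)
  · refine ⟨F.point l (g₀, ![0, ϖ⁻¹]), subset_orb _ _ ⟨_, ⟨?_, by simp⟩, rfl⟩, ?_⟩
    · intro i; fin_cases i <;> simp [hϖ]
    · rintro ⟨g, hg, _, ⟨v, ⟨hv, -⟩, rfl⟩, h⟩
      obtain ⟨-, h1⟩ := eq_sec_of_smul_point h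
      obtain ⟨-, h2⟩ := diagonal_of_slAct hne hg₀ h1
      have h3 : F.proj g 1 0 * v 0 + F.proj g 1 1 * v 1 = ϖ⁻¹ := by
        have := congrFun (congrArg Prod.snd h1) 1
        rwa [slAct_snd, mulVec_fin_two] at this
      rw [h2, zero_mul, zero_add] at h3
      have h6 : valuation k ϖ⁻¹ ≤ 1 := by
        rw [← h3, map_mul]; exact mul_le_one' (hint g hg 1 1) (hv 1)
      rw [map_inv₀] at h6
      exact absurd h6 (not_le.2 ((one_lt_inv₀ (by simpa [zero_lt_iff] using hϖ)).2 hϖ1))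
  · intro x hx
    refine ⟨hA'.subset hx.1, fun hxa => hx.2 ?_⟩
    obtain ⟨g, hg, _, ⟨v, ⟨hv, hv0⟩, rfl⟩, rfl⟩ := hx.1
    have h1 := (point_mem_eigenSet_iff hne hg₀).1.1 ((smul_mem_eigenSet_iff g).1 hxa)
    refine ⟨g, hg, _, ⟨v, ⟨fun i => ?_, hv0⟩, rfl⟩, rfl⟩
    fin_cases i
    · have h2 : valuation k (ϖ⁻¹ * v 0) ≤ 1 := hv 0
      change valuation k (v 0) ≤ 1
      rw [← mul_inv_cancel_left₀ hϖ (v 0), map_mul]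
      exact mul_le_one' hϖ1.le h2
    · simp [h1]
  · rw [Complex.ofReal_one, one_smul]
    convert hdiff using 1
    funext x
    simp only [Pi.sub_apply, chi, indicator, mem_sdiff]
    split_ifs <;> simp_all

/-- The stratum where `v ≠ 0` is an eigenvector of a matrix `g` with distinct eigenvalues. -/
lemma testOn_le_of_split (two_ne : (2 : k) ≠ 0) (hτ : F.IsCompatible τ) (l : Λ) (hne : a ≠ c)
    (h0 : a * c ≠ 0) :
    testOn (F.inv ⁻¹' {(l, a + c, a * c, 0)} \ F.zeroSet) ≤
      antiCoinv G τ (F.inv ⁻¹' {(l, a + c, a * c, 0)}) := by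
  obtain ⟨W, W', hW, hWne, hWe, hW', hW'ne, hW'e, h⟩ := exists_linked two_ne hτ l hne h0
  set L := F.inv ⁻¹' {(l, a + c, a * c, 0)} with hL
  have hL' : F.inv ⁻¹' {(l, c + a, c * a, 0)} = L := by rw [add_comm c, mul_comm c]
  have h1 : testOn (L \ F.eigenSet c) ≤ antiCoinv G τ L :=
    testOn_eigen_le hτ hne hW hWne hWe hW' hW'ne hW'e h
  have h2 : testOn (L \ F.eigenSet a) ≤ antiCoinv G τ L := by
    have := testOn_eigen_le (l := l) hτ hne.symm (W := W') (W' := W)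
    rw [hL'] at this
    exact this hW' hW'ne hW'e hW hWne hWe h.symm
  have hex : ∀ x ∈ L \ F.zeroSet, x ∈ F.eigenSet a ↔ x ∉ F.eigenSet c := by
    intro x hx
    obtain ⟨-, e2, e3, e4⟩ := mem_fiber.1 hx.1
    refine ⟨fun hxa hxc => hx.2 ?_, (mulVec_eq_or_of_qInv_eq_zero e4 e2 e3).resolve_right⟩
    have h3 : F.mat x *ᵥ F.vec x = a • F.vec x := hxa
    rw [show F.mat x *ᵥ F.vec x = c • F.vec x from hxc, ← sub_eq_zero, ← sub_smul, smul_eq_zero,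
      sub_eq_zero] at h3
    exact h3.resolve_left hne.symm
  intro f hf
  have hopen : ∀ e : k, ∀ x ∉ F.eigenSet e, ∀ᶠ y in 𝓝[L \ F.zeroSet] x, y ∉ F.eigenSet e :=
    fun e x hx => mem_nhdsWithin_of_mem_nhds (isClosed_eigenSet.isOpen_compl.mem_nhds hx)
  have hA : ∀ x ∈ L \ F.zeroSet, ∀ᶠ y in 𝓝[L \ F.zeroSet] x,
      y ∈ F.eigenSet a ↔ x ∈ F.eigenSet a := by
    intro x hx
    by_cases hxa : x ∈ F.eigenSet a
    · filter_upwards [hopen c x ((hex x hx).1 hxa), self_mem_nhdsWithin] with y hy hyL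
      exact iff_of_true ((hex y hyL).2 hy) hxa
    · filter_upwards [hopen a x hxa] with y hy
      exact iff_of_false hy hxa
  have hf1 := indicator_mem_testOn hf hA
  have hf2 := sub_mem hf hf1
  have hsub : ∀ e : k, L \ F.eigenSet e ⊆ L \ F.zeroSet := fun e x hx => ⟨hx.1, fun h => hx.2 (by
    change _ = _
    rw [show F.vec x = 0 from h, mulVec_zero, smul_zero])⟩
  have h3 : (F.eigenSet a).indicator f ∈ antiCoinv G τ L := by
    refine h1 (mem_testOn_of_support_subset (hsub c) hf1 fun x hx => ?_)
    have hxL := hf1.1 hx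
    rw [support_indicator] at hx
    exact ⟨hxL.1, (hex x hxL).1 hx.1⟩
  have h4 : f - (F.eigenSet a).indicator f ∈ antiCoinv G τ L := by
    refine h2 (mem_testOn_of_support_subset (hsub a) hf2 fun x hx => ?_)
    refine ⟨(hf2.1 hx).1, fun hxa => hx ?_⟩
    simp [indicator_of_mem hxa]
  have h5 := add_mem h3 h4
  rwa [add_sub_cancel] at h5

end SLFibration

end Strata

/-! ### From test functions to distributions -/

section Duality

variable {X G : Type*} [TopologicalSpace X] [T2Space X] [Group G] [MulAction G X]
  [ContinuousConstSMul G X] {τ : X ≃ₜ X}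

lemma mem_testOn_univ {f : X → ℂ} : f ∈ testOn (univ : Set X) ↔ f ∈ TestFunction X := by
  rw [mem_testOn_iff]
  simp only [subset_univ, true_and, nhdsWithin_univ, mem_univ, forall_true_left]
  change _ ↔ IsLocallyConstant f ∧ HasCompactSupport f
  rw [IsLocallyConstant.iff_eventually_eq, and_comm]
  refine and_congr_right fun h => ?_
  have hcl : IsClosed (Function.support f) :=
    (((IsLocallyConstant.iff_eventually_eq f).2 h).isOpen_fiber 0).isClosed_compl
  rw [HasCompactSupport, tsupport, hcl.closure_eq]

/-- If the anti-coinvariants of `X` vanish, then invariant distributions are `τ`-invariant: the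
difference of `T` and its image under `τ` factors through the anti-coinvariants. -/
theorem isInvariant_of_testOn_le (h : testOn (univ : Set X) ≤ antiCoinv G τ univ)
    (hτ : ∀ x, τ (τ x) = x) (hτG : ∀ g : G, ∃ g' : G, ∀ x, g • τ x = τ (g' • x))
    {T : Distribution X} (hT : ∀ g : G, T.IsInvariant (Homeomorph.smul g)) : T.IsInvariant τ := by
  set D : Distribution X := T.map τ - T with hD
  have hTg : ∀ (g : G) (f : TestFunction X),
      T (TestFunction.pullback (Homeomorph.smul g) f) = T f :=
    fun g f => LinearMap.congr_fun (hT g) f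
  have hDf : ∀ f, D f = T (TestFunction.pullback τ f) - T f := fun _ => rfl
  have hDG : ∀ (g : G) f, D (TestFunction.pullback (Homeomorph.smul g) f) = D f := by
    intro g f
    obtain ⟨g', hg'⟩ := hτG g
    have hcomm : TestFunction.pullback τ (TestFunction.pullback (Homeomorph.smul g) f) =
        TestFunction.pullback (Homeomorph.smul g') (TestFunction.pullback τ f) :=
      Subtype.ext (funext fun x => congrArg f.1 (hg' x))
    rw [hDf, hDf, hcomm, hTg, hTg]
  have hDτ : ∀ f, D (TestFunction.pullback τ f) = -D f := by
    intro f
    have h1 : TestFunction.pullback τ (TestFunction.pullback τ f) = f :=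
      Subtype.ext (funext fun x => congrArg f.1 (hτ x))
    rw [hDf, hDf, h1, neg_sub]
  have key : antiCoinv G τ univ ≤ (LinearMap.ker D).map (TestFunction X).subtype := by
    refine Submodule.span_le.2 ?_
    rintro _ ⟨φ, hφ, ⟨g, rfl⟩ | rfl⟩
    · refine ⟨TestFunction.pullback (Homeomorph.smul g) ⟨φ, mem_testOn_univ.1 hφ⟩ -
        ⟨φ, mem_testOn_univ.1 hφ⟩, ?_, rfl⟩
      rw [SetLike.mem_coe, LinearMap.mem_ker, map_sub, hDG, sub_self]
    · refine ⟨TestFunction.pullback τ ⟨φ, mem_testOn_univ.1 hφ⟩ + ⟨φ, mem_testOn_univ.1 hφ⟩, ?_,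
        rfl⟩
      rw [SetLike.mem_coe, LinearMap.mem_ker, map_add, hDτ, neg_add_cancel]
  refine LinearMap.ext fun f => ?_
  obtain ⟨f', hf', hff'⟩ := key (h (mem_testOn_univ.2 f.2))
  have h1 : D f = 0 := by rwa [show f = f' from (Subtype.ext hff').symm]
  exact sub_eq_zero.1 h1

end Duality

/-! ### Vanishing of the anti-coinvariants -/

instance instTotallySeparatedSpaceProd {Y Z : Type*} [TopologicalSpace Y]
    [TopologicalSpace Z] [TotallySeparatedSpace Y] [TotallySeparatedSpace Z] :
    TotallySeparatedSpace (Y × Z) := by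
  refine totallySeparatedSpace_iff_exists_isClopen.2 fun p q hpq => ?_
  by_cases h : p.1 = q.1
  · obtain ⟨U, hU, h1, h2⟩ := exists_isClopen_of_totally_separated (α := Z)
      (fun h' => hpq (Prod.ext h h'))
    exact ⟨Prod.snd ⁻¹' U, hU.preimage continuous_snd, h1, h2⟩
  · obtain ⟨U, hU, h1, h2⟩ := exists_isClopen_of_totally_separated h
    exact ⟨Prod.fst ⁻¹' U, hU.preimage continuous_fst, h1, h2⟩

section Strata

variable {k : Type*} [Field k] [ValuativeRel k] [TopologicalSpace k] [IsNonarchimedeanLocalField k]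
  {G X Λ : Type*} [Group G] [TopologicalSpace G] [IsTopologicalGroup G] [T2Space G]
  [LocallyCompactSpace G] [TotallyDisconnectedSpace G] [TopologicalSpace X] [T2Space X]
  [LocallyCompactSpace X] [TotallyDisconnectedSpace X] [MulAction G X] [ContinuousSMul G X]
  [TopologicalSpace Λ] {F : SLFibration k G X Λ} {τ : X ≃ₜ X}

namespace SLFibration

/-- The stratum `det (v, g v) = 0`. -/
lemma testOn_le_of_qInv_eq_zero [T1Space Λ] (two_ne : (2 : k) ≠ 0) (hτ : F.IsCompatible τ) (l : Λ)
    (t δ : k) : testOn (F.inv ⁻¹' {(l, t, δ, 0)}) ≤ antiCoinv G τ (F.inv ⁻¹' {(l, t, δ, 0)}) := by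
  have hst := isStable_fiber hτ (l, t, δ, 0)
  refine testOn_le_antiCoinv_of_closed (isClosed_zeroSet (F := F))
    (isClosed_fiber (F := F) _).isLocallyClosed hst (hst.inter (isStable_zeroSet hτ))
    (testOn_le_of_zero two_ne hτ _) ?_
  have hempty : F.inv ⁻¹' {(l, t, δ, 0)} \ F.zeroSet = ∅ →
      testOn (F.inv ⁻¹' {(l, t, δ, 0)} \ F.zeroSet) ≤
        antiCoinv G τ (F.inv ⁻¹' {(l, t, δ, 0)}) := by
    intro h f hf
    have h1 := hf.1
    rw [h, subset_empty_iff, Function.support_eq_empty_iff] at h1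
    rw [h1]
    exact zero_mem _
  by_cases hex : ∃ a c, t = a + c ∧ δ = a * c
  · obtain ⟨a, c, rfl, rfl⟩ := hex
    rcases eq_or_ne a c with rfl | hne
    · exact (testOn_le_of_double hτ l a).trans (antiCoinv_mono (testOn_diff_le isClosed_zeroSet))
    · by_cases h0 : a * c = 0
      · refine hempty (eq_empty_of_forall_notMem fun x hx => ?_)
        have h1 := (mem_fiber.1 hx.1).2.2.1
        rw [h0] at h1
        exact (isUnit_iff_ne_zero.1 ((isUnit_iff_isUnit_det _).1 (F.base x).1.isUnit)) h1
      · exact testOn_le_of_split two_ne hτ l hne h0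
  · refine hempty (eq_empty_of_forall_notMem fun x hx => hex ?_)
    obtain ⟨-, h2, h3, h4⟩ := mem_fiber.1 hx.1
    obtain ⟨α, -, h⟩ := exists_eigenvalue_of_qInv_eq_zero hx.2 h4
    refine ⟨α, t - α, by ring, ?_⟩
    rw [← h2, ← h3]
    exact h.symm

/-- The invariants `(param, trace, det, qInv)` reduce the vanishing of the anti-coinvariants to the
strata. -/
theorem testOn_univ_le [TotallySeparatedSpace Λ] (two_ne : (2 : k) ≠ 0) (hτ : F.IsCompatible τ) :
    testOn (univ : Set X) ≤ antiCoinv G τ univ := by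
  refine testOn_le_antiCoinv_of_fibers F.inv F.continuous_inv.continuousOn
    (fun g x _ => F.inv_smul g x) (fun x _ => F.inv_map hτ x) isClosed_univ.isLocallyClosed
    ⟨fun _ _ => iff_of_true trivial trivial, fun _ => iff_of_true trivial trivial⟩ ?_
  rintro ⟨l, t, δ, q⟩
  rw [univ_inter]
  by_cases hq : q = 0
  · rw [hq]; exact testOn_le_of_qInv_eq_zero two_ne hτ l t δ
  · exact testOn_le_of_qInv_ne_zero hτ l t δ hq

end SLFibration

end Strata

/-! ### Topology of matrix groups over a local field -/

section Topology

lemma totallyDisconnectedSpace_of_injective {Y Z : Type*} [TopologicalSpace Y] [TopologicalSpace Z]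
    [TotallyDisconnectedSpace Z] {f : Y → Z} (hf : Continuous f) (hi : Function.Injective f) :
    TotallyDisconnectedSpace Y :=
  ⟨isTotallyDisconnected_of_image hf.continuousOn hi
    (isTotallyDisconnected_of_totallyDisconnectedSpace _)⟩

instance instTotallySeparatedSpaceUnits {M : Type*} [Monoid M] [TopologicalSpace M]
    [TotallySeparatedSpace M] : TotallySeparatedSpace Mˣ := by
  refine totallySeparatedSpace_iff_exists_isClopen.2 fun p q hpq => ?_
  obtain ⟨U, hU, h1, h2⟩ := exists_isClopen_of_totally_separated (α := M)
    (fun h => hpq (Units.ext h))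
  exact ⟨Units.val ⁻¹' U, hU.preimage Units.continuous_val, h1, h2⟩

variable {k : Type*} [Field k] [TopologicalSpace k] [IsTopologicalRing k] [T2Space k]

instance instLocallyCompactSpaceMatrix [LocallyCompactSpace k] :
    LocallyCompactSpace (Matrix (Fin 2) (Fin 2) k) :=
  inferInstanceAs (LocallyCompactSpace (Fin 2 → Fin 2 → k))

instance instTotallyDisconnectedSpaceMatrix [TotallyDisconnectedSpace k] :
    TotallyDisconnectedSpace (Matrix (Fin 2) (Fin 2) k) :=
  inferInstanceAs (TotallyDisconnectedSpace (Fin 2 → Fin 2 → k))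

instance instLocallyCompactSpaceGL [LocallyCompactSpace k] :
    LocallyCompactSpace (GL (Fin 2) k) :=
  Units.isClosedEmbedding_embedProduct.locallyCompactSpace

instance instTotallyDisconnectedSpaceGL [TotallyDisconnectedSpace k] :
    TotallyDisconnectedSpace (GL (Fin 2) k) :=
  totallyDisconnectedSpace_of_injective Units.continuous_val Units.val_injective

instance instLocallyCompactSpaceSL [LocallyCompactSpace k] : LocallyCompactSpace SL(2, k) :=
  SpecialLinearGroup.isClosedEmbedding_val.locallyCompactSpace

instance instTotallyDisconnectedSpaceSL [TotallyDisconnectedSpace k] :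
    TotallyDisconnectedSpace SL(2, k) :=
  totallyDisconnectedSpace_of_injective continuous_subtype_val Subtype.val_injective

end Topology

/-! ### The action of `SL(2)` on `GL(2) × k²` -/

section Pairs

variable {k : Type*} [Field k] [TopologicalSpace k] [IsTopologicalRing k]

/-- The action `(g, v) ↦ (s g s⁻¹, s v)` of `SL(2)` on `GL(2) × k²`. -/
instance slMulAction : MulAction SL(2, k) (GL (Fin 2) k × (Fin 2 → k)) where
  smul s b := slAct s b
  one_smul := slAct_one
  mul_smul := slAct_mul

lemma continuous_toGL : Continuous fun s : SL(2, k) => (s : GL (Fin 2) k) := by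
  refine Units.continuous_iff.2 ⟨continuous_subtype_val, ?_⟩
  have h : Continuous fun s : SL(2, k) => (s⁻¹).val := continuous_subtype_val.comp continuous_inv
  refine h.congr fun s => ?_
  rw [← map_inv]
  rfl

instance slContinuousSMul : ContinuousSMul SL(2, k) (GL (Fin 2) k × (Fin 2 → k)) := by
  refine ⟨Continuous.prodMk ?_ ?_⟩
  · have h := continuous_toGL.comp
      (continuous_fst (X := SL(2, k)) (Y := GL (Fin 2) k × (Fin 2 → k)))
    exact (h.mul (continuous_fst.comp continuous_snd)).mul h.inv
  · exact (continuous_subtype_val.comp continuous_fst).matrix_mulVec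
      (continuous_snd.comp continuous_snd)

/-- The involution normalizes the action of `SL(2)`: it intertwines `s` with `d₂ s d₂`. -/
lemma exists_slAct_tauPrime (s : SL(2, k)) : ∃ s' : SL(2, k), ∀ b,
    slAct s (tauPrime k b) = tauPrime k (slAct s' b) := by
  have hdet : (s : Matrix (Fin 2) (Fin 2) k).det = 1 := s.2
  obtain ⟨s', hs'⟩ : ∃ s' : SL(2, k), (s' : Matrix (Fin 2) (Fin 2) k) =
      !![s.1 1 1, s.1 1 0; s.1 0 1, s.1 0 0] := ⟨⟨!![s.1 1 1, s.1 1 0; s.1 0 1, s.1 0 0], by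
    rw [det_fin_two] at hdet
    rw [det_fin_two_of]; linear_combination hdet⟩, rfl⟩
  have hs : ((s⁻¹ : SL(2, k)) : Matrix (Fin 2) (Fin 2) k) =
      !![s.1 1 1, -s.1 0 1; -s.1 1 0, s.1 0 0] := adjugate_fin_two _
  have hs'' : ((s'⁻¹ : SL(2, k)) : Matrix (Fin 2) (Fin 2) k) =
      !![s.1 0 0, -s.1 1 0; -s.1 0 1, s.1 1 1] := by
    refine (adjugate_fin_two (s' : Matrix (Fin 2) (Fin 2) k)).trans ?_
    rw [hs']
    simp
  refine ⟨s', fun b => Prod.ext (Units.ext ?_) ?_⟩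
  · rw [tauPrime_fst, slAct_fst, slAct_fst, tauPrime_fst, hs, hs', hs'']
    ext i j
    fin_cases i <;> fin_cases j <;>
      simp [Matrix.mul_apply, Matrix.vecMul, dotProduct, Fin.sum_univ_two] <;> ring
  · rw [tauPrime_snd, slAct_snd, slAct_snd, tauPrime_snd, hs', mulVec_fin_two, mulVec_fin_two]
    ext i
    fin_cases i <;> simp <;> ring

/-- `GL(2) × k²` as a space over itself. -/
def pairFibration (k : Type*) [Field k] [TopologicalSpace k] [IsTopologicalRing k] :
    SLFibration k SL(2, k) (GL (Fin 2) k × (Fin 2 → k)) Unit where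
  proj := MonoidHom.id _
  sec := MonoidHom.id _
  param _ := ()
  base := id
  shift _ := 1
  point _ := id
  continuous_proj := continuous_id
  continuous_sec := continuous_id
  continuous_param := continuous_const
  continuous_base := continuous_id
  continuous_shift := continuous_const
  continuous_point _ := continuous_id
  proj_sec _ := rfl
  proj_shift _ := rfl
  shift_smul_point _ := one_smul _ _
  sec_smul_point _ _ _ := rfl
  param_smul _ _ := rfl
  base_smul _ _ := rfl
  param_point _ _ := rfl
  base_point _ _ := rfl
  shift_point _ _ := rfl
  shift_smul g _ := by rw [MonoidHom.id_apply, one_mul, mul_one]; rfl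

lemma isCompatible_pairFibration : (pairFibration k).IsCompatible (tauPrime k) :=
  ⟨fun _ => rfl, fun _ => ⟨1, (slAct_one _).symm⟩⟩

end Pairs

theorem isInvariant_tauPrime {k : Type*} [Field k] [ValuativeRel k] [TopologicalSpace k]
    [IsNonarchimedeanLocalField k] (two_ne : (2 : k) ≠ 0)
    {T : Distribution (GL (Fin 2) k × (Fin 2 → k))}
    (hT : ∀ s : SL(2, k), T.IsInvariant (slAct s)) : T.IsInvariant (tauPrime k) := by
  refine isInvariant_of_testOn_le (G := SL(2, k))
    (SLFibration.testOn_univ_le two_ne isCompatible_pairFibration)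
    (fun b => (tauPrime k).left_inv b) exists_slAct_tauPrime fun s => ?_
  have h : Homeomorph.smul s = slAct s := Homeomorph.ext fun _ => rfl
  rw [h]
  exact hT s

/-! ### Coordinates on the open cell -/

section Coordinates

variable {k : Type*} [Field k]

lemma w''_mul_m (l : kˣ) (A : GL (Fin 2) k) :
    w'' k * m l A = m (l⁻¹ * GeneralLinearGroup.det A) A * w'' k := by
  have hl : (l : k) ≠ 0 := l.ne_zero
  have hd : (A : Matrix (Fin 2) (Fin 2) k).det ≠ 0 := (GeneralLinearGroup.det A).ne_zero
  apply GSp4.ext'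
  rw [w'', m, m, GSp4.mk'_mul_mk', GSp4.mk'_mul_mk']
  ext i j
  fin_cases i <;> fin_cases j <;> simp [Matrix.mul_apply, Fin.sum_univ_four]
  field_simp

lemma m_mul_h (l : kˣ) (A : GL (Fin 2) k) (v : Fin 2 → k) (z : k) :
    ∃ v' z', m l A * h v z = h v' z' * m l A := by
  have h1 := h_mul_m v z l⁻¹ A⁻¹
  rw [← m_inv] at h1
  have h2 := congrArg (fun x => m l A * x * m l A) h1
  simp only [mul_assoc, inv_mul_cancel, mul_one, mul_inv_cancel_left] at h2
  exact ⟨_, _, h2⟩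

/-- The conjugate by `h(a, z)` of the element `w'' m(l, A) h(v, y)` of the open cell. -/
def cell (a : Fin 2 → k) (z : k) (l : kˣ) (A : GL (Fin 2) k) (v : Fin 2 → k) (y : k) :
    openCell k :=
  ⟨h a z * (w'' k * m l A * h v y) * (h a z)⁻¹, h a z, h_mem_P a z, m l A * h v y * (h a z)⁻¹,
    (P k).mul_mem ⟨l, A, v, y, rfl⟩ ((P k).inv_mem (h_mem_P a z)), by simp only [mul_assoc]⟩

lemma exists_eq_cell (g : openCell k) : ∃ a z l A v y, g = cell a z l A v y := by
  obtain ⟨_, _, ⟨l, A, v, z, rfl⟩, _, ⟨l', A', v', z', rfl⟩, rfl⟩ := g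
  obtain ⟨v₁, z₁, h1⟩ := m_mul_h l A v z
  have h2 : m l A * w'' k = w'' k * m (l⁻¹ * GeneralLinearGroup.det A) A := by
    rw [w''_mul_m]; simp
  refine ⟨v₁, z₁, (l⁻¹ * GeneralLinearGroup.det A) * l', A * A', v' + v₁,
    z' + z₁ + v' 0 * v₁ 1 - v' 1 * v₁ 0, Subtype.ext ?_⟩
  change m l A * h v z * w'' k * (m l' A' * h v' z') =
    h v₁ z₁ * (w'' k * m _ _ * h _ _) * (h v₁ z₁)⁻¹
  rw [eq_mul_inv_iff_mul_eq, h1, ← m_mul, ← h_mul]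
  simp only [← mul_assoc]
  rw [mul_assoc (h v₁ z₁), h2]
  simp only [← mul_assoc]

/-- The matrix of an element of the open cell. -/
def cellMatrix (g : openCell k) : Matrix (Fin 4) (Fin 4) k := ((g : GSp4 k) : GL (Fin 4) k)

lemma cellMatrix_cell (a : Fin 2 → k) (z : k) (l : kˣ) (A : GL (Fin 2) k) (v : Fin 2 → k) (y : k) :
    cellMatrix (cell a z l A v y) =
      !![1, a 0, a 1, z; 0, 1, 0, a 1; 0, 0, 1, -a 0; 0, 0, 0, 1] *
      !![0, 0, 0, (l : k)⁻¹ * (A : Matrix (Fin 2) (Fin 2) k).det;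
        0, A 0 0, A 0 1, A 0 0 * (v 1 - a 1) - A 0 1 * (v 0 - a 0);
        0, A 1 0, A 1 1, A 1 0 * (v 1 - a 1) - A 1 1 * (v 0 - a 0);
        -l, -l * (v 0 - a 0), -l * (v 1 - a 1), -l * (y - z - v 0 * a 1 + v 1 * a 0)] := by
  have h1 : ((cell a z l A v y : openCell k) : GSp4 k) =
      h a z * (w'' k * m l A * h (v - a) (y - z - v 0 * a 1 + v 1 * a 0)) := by
    change h a z * (w'' k * m l A * h v y) * (h a z)⁻¹ = _
    rw [h_inv, mul_assoc, mul_assoc (w'' k * m l A), h_mul]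
    congr 3
    · abel
    · simp; ring
  rw [cellMatrix, h1]
  have h2 : ((w'' k * m l A * h (v - a) (y - z - v 0 * a 1 + v 1 * a 0) : GSp4 k) :
      GL (Fin 4) k).val = !![0, 0, 0, (l : k)⁻¹ * (A : Matrix (Fin 2) (Fin 2) k).det;
        0, A 0 0, A 0 1, A 0 0 * (v 1 - a 1) - A 0 1 * (v 0 - a 0);
        0, A 1 0, A 1 1, A 1 0 * (v 1 - a 1) - A 1 1 * (v 0 - a 0);
        -l, -l * (v 0 - a 0), -l * (v 1 - a 1), -l * (y - z - v 0 * a 1 + v 1 * a 0)] := by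
    have h3 : ((w'' k * m l A : GSp4 k) : GL (Fin 4) k).val =
        !![0, 0, 0, (l : k)⁻¹ * (A : Matrix (Fin 2) (Fin 2) k).det;
          0, A 0 0, A 0 1, 0; 0, A 1 0, A 1 1, 0; -l, 0, 0, 0] := by
      rw [w'', m, GSp4.mk'_mul_mk']
      ext i j
      fin_cases i <;> fin_cases j <;> simp [Matrix.mul_apply, Fin.sum_univ_four]
    change ((w'' k * m l A : GSp4 k) : GL (Fin 4) k).val *
      ((h (v - a) (y - z - v 0 * a 1 + v 1 * a 0) : GSp4 k) : GL (Fin 4) k).val = _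
    rw [h3, h, GSp4.coe_mk']
    ext i j
    fin_cases i <;> fin_cases j <;> simp [Matrix.mul_apply, Fin.sum_univ_four] <;> ring
  change ((h a z : GSp4 k) : GL (Fin 4) k).val * ((w'' k * m l A *
    h (v - a) (y - z - v 0 * a 1 + v 1 * a 0) : GSp4 k) : GL (Fin 4) k).val = _
  rw [h2]
  rfl

end Coordinates

/-! ### Coordinates on `J` -/

section Jacobi

variable {k : Type*} [Field k]

/-- The element `m(1, s) h(v, z)` of `J`. -/
def jElt (s : SL(2, k)) (v : Fin 2 → k) (z : k) : J k :=
  ⟨m 1 (s : GL (Fin 2) k) * h v z, s, v, z, rfl⟩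

lemma exists_eq_jElt (t : J k) : ∃ s v z, t = jElt s v z := by
  obtain ⟨_, s, v, z, rfl⟩ := t
  exact ⟨s, v, z, rfl⟩

lemma jElt_mul_jElt (s s' : SL(2, k)) (v v' : Fin 2 → k) (z z' : k) :
    jElt s v z * jElt s' v' z' = jElt (s * s') (v ᵥ* (s' : Matrix (Fin 2) (Fin 2) k) + v')
      (z + z' + (v ᵥ* (s' : Matrix (Fin 2) (Fin 2) k)) 0 * v' 1 -
        (v ᵥ* (s' : Matrix (Fin 2) (Fin 2) k)) 1 * v' 0) := by
  refine Subtype.ext ?_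
  change m 1 (s : GL (Fin 2) k) * h v z * (m 1 (s' : GL (Fin 2) k) * h v' z') =
    m 1 ((s * s' : SL(2, k)) : GL (Fin 2) k) * h _ _
  have hs' : ((s' : GL (Fin 2) k) : Matrix (Fin 2) (Fin 2) k).det = 1 := s'.2
  rw [mul_assoc, ← mul_assoc (h v z), h_mul_m, hs', map_mul, ← mul_one (1 : kˣ), ← m_mul, mul_one,
    mul_assoc, mul_assoc, h_mul]
  simp [mul_assoc]

lemma jElt_one : jElt (1 : SL(2, k)) 0 0 = 1 :=
  Subtype.ext (by
    change m 1 ((1 : SL(2, k)) : GL (Fin 2) k) * h 0 0 = 1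
    rw [map_one, m_one, h_zero, mul_one])

/-- The matrix of an element of `J`. -/
def jMatrix (t : J k) : Matrix (Fin 4) (Fin 4) k := ((t : GSp4 k) : GL (Fin 4) k)

lemma jMatrix_jElt (s : SL(2, k)) (v : Fin 2 → k) (z : k) : jMatrix (jElt s v z) =
    !![1, v 0, v 1, z;
      0, s.1 0 0, s.1 0 1, s.1 0 0 * v 1 - s.1 0 1 * v 0;
      0, s.1 1 0, s.1 1 1, s.1 1 0 * v 1 - s.1 1 1 * v 0;
      0, 0, 0, 1] := by
  have hs : (s : Matrix (Fin 2) (Fin 2) k).det = 1 := s.2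
  change ((m 1 (s : GL (Fin 2) k) : GSp4 k) : GL (Fin 4) k).val *
    ((h v z : GSp4 k) : GL (Fin 4) k).val = _
  rw [m, h, GSp4.coe_mk', GSp4.coe_mk']
  ext i j
  fin_cases i <;> fin_cases j <;> simp [Matrix.mul_apply, Fin.sum_univ_four] <;> ring

/-- The projection of `J` to `SL(2)`. -/
def jProj (k : Type*) [Field k] : J k →* SL(2, k) where
  toFun t := ⟨!![jMatrix t 1 1, jMatrix t 1 2; jMatrix t 2 1, jMatrix t 2 2], by
    obtain ⟨s, v, z, rfl⟩ := exists_eq_jElt t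
    rw [jMatrix_jElt, det_fin_two_of]
    have := s.2
    rw [det_fin_two] at this
    simpa using this⟩
  map_one' := by
    refine Subtype.ext ?_
    change !![jMatrix _ 1 1, jMatrix _ 1 2; jMatrix _ 2 1, jMatrix _ 2 2] =
      (1 : Matrix (Fin 2) (Fin 2) k)
    rw [← jElt_one, jMatrix_jElt]
    ext i j
    fin_cases i <;> fin_cases j <;> simp
  map_mul' t t' := by
    obtain ⟨s, v, z, rfl⟩ := exists_eq_jElt t
    obtain ⟨s', v', z', rfl⟩ := exists_eq_jElt t'
    refine Subtype.ext ?_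
    change !![jMatrix _ 1 1, jMatrix _ 1 2; jMatrix _ 2 1, jMatrix _ 2 2] =
      !![jMatrix _ 1 1, jMatrix _ 1 2; jMatrix _ 2 1, jMatrix _ 2 2] *
      (!![jMatrix _ 1 1, jMatrix _ 1 2; jMatrix _ 2 1, jMatrix _ 2 2] : Matrix (Fin 2) (Fin 2) k)
    rw [jElt_mul_jElt, jMatrix_jElt, jMatrix_jElt, jMatrix_jElt]
    ext i j
    fin_cases i <;> fin_cases j <;>
      simp [Matrix.mul_apply, Fin.sum_univ_two]

lemma jProj_jElt (s : SL(2, k)) (v : Fin 2 → k) (z : k) : jProj k (jElt s v z) = s := by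
  refine Subtype.ext ?_
  change !![jMatrix _ 1 1, jMatrix _ 1 2; jMatrix _ 2 1, jMatrix _ 2 2] = s.1
  rw [jMatrix_jElt]
  ext i j
  fin_cases i <;> fin_cases j <;> simp

/-- The splitting of the projection of `J` to `SL(2)`. -/
def jSec (k : Type*) [Field k] : SL(2, k) →* J k where
  toFun s := jElt s 0 0
  map_one' := jElt_one
  map_mul' s s' := by rw [jElt_mul_jElt]; simp

/-- The coordinates of a product, with the unipotent factor on the left. -/
lemma jElt_mul_shift (s : SL(2, k)) (v a : Fin 2 → k) (z y : k) : ∃ a' z',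
    jElt s v z * jElt 1 a y = jElt 1 a' z' * jSec k s := by
  refine ⟨(v + a) ᵥ* ((s⁻¹ : SL(2, k)) : Matrix (Fin 2) (Fin 2) k),
    z + y + v 0 * a 1 - v 1 * a 0, ?_⟩
  change _ = _ * jElt s 0 0
  rw [jElt_mul_jElt, jElt_mul_jElt, vecMul_vecMul, sl_inv_mul]
  simp

end Jacobi

section CellCoordinates

variable {k : Type*} [Field k]

lemma cellMatrix_ne_zero (g : openCell k) : -cellMatrix g 3 0 ≠ 0 := by
  obtain ⟨a, z, l, A, v, y, rfl⟩ := exists_eq_cell g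
  rw [cellMatrix_cell]
  simp [Matrix.mul_apply, Fin.sum_univ_four]

/-- The coordinate `λ` of `h(a, z) w'' m(λ, A) h(v, y) h(a, z)⁻¹`. -/
def cellScale (g : openCell k) : kˣ := Units.mk0 (-cellMatrix g 3 0) (cellMatrix_ne_zero g)

/-- The coordinate `A` of `h(a, z) w'' m(λ, A) h(v, y) h(a, z)⁻¹`, as a matrix. -/
def cellLeviMatrix (g : openCell k) : Matrix (Fin 2) (Fin 2) k :=
  !![cellMatrix g 1 1 - cellMatrix g 1 0 * cellMatrix g 3 1 / cellMatrix g 3 0,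
    cellMatrix g 1 2 - cellMatrix g 1 0 * cellMatrix g 3 2 / cellMatrix g 3 0;
    cellMatrix g 2 1 - cellMatrix g 2 0 * cellMatrix g 3 1 / cellMatrix g 3 0,
    cellMatrix g 2 2 - cellMatrix g 2 0 * cellMatrix g 3 2 / cellMatrix g 3 0]

/-- The coordinate `a` of `h(a, z) w'' m(λ, A) h(v, y) h(a, z)⁻¹`. -/
def cellShiftVec (g : openCell k) : Fin 2 → k :=
  ![-cellMatrix g 2 0 / cellMatrix g 3 0, cellMatrix g 1 0 / cellMatrix g 3 0]

/-- The coordinate `z` of `h(a, z) w'' m(λ, A) h(v, y) h(a, z)⁻¹`. -/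
def cellShiftCentre (g : openCell k) : k := cellMatrix g 0 0 / cellMatrix g 3 0

/-- The coordinate `v` of `h(a, z) w'' m(λ, A) h(v, y) h(a, z)⁻¹`. -/
def cellVec (g : openCell k) : Fin 2 → k :=
  ![(cellMatrix g 3 1 - cellMatrix g 2 0) / cellMatrix g 3 0,
    (cellMatrix g 3 2 + cellMatrix g 1 0) / cellMatrix g 3 0]

/-- The coordinate `y` of `h(a, z) w'' m(λ, A) h(v, y) h(a, z)⁻¹`. -/
def cellCentre (g : openCell k) : k :=
  cellMatrix g 3 3 / cellMatrix g 3 0 + cellShiftCentre g + cellVec g 0 * cellShiftVec g 1 -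
    cellVec g 1 * cellShiftVec g 0

variable (a : Fin 2 → k) (z : k) (l : kˣ) (A : GL (Fin 2) k) (v : Fin 2 → k) (y : k)

lemma cellMatrix_three_zero : cellMatrix (cell a z l A v y) 3 0 = -l := by
  rw [cellMatrix_cell]; simp [Matrix.mul_apply, Fin.sum_univ_four]

lemma cellScale_cell : cellScale (cell a z l A v y) = l :=
  Units.ext (by rw [cellScale, Units.val_mk0, cellMatrix_three_zero, neg_neg])

lemma cellLeviMatrix_cell : cellLeviMatrix (cell a z l A v y) = A := by
  have hl : (l : k) ≠ 0 := l.ne_zero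
  rw [cellLeviMatrix, cellMatrix_cell]
  ext i j
  fin_cases i <;> fin_cases j <;> simp [Matrix.mul_apply, Fin.sum_univ_four] <;> field_simp <;> ring

lemma cellShiftVec_cell : cellShiftVec (cell a z l A v y) = a := by
  have hl : (l : k) ≠ 0 := l.ne_zero
  rw [cellShiftVec, cellMatrix_cell]
  ext i
  fin_cases i <;> simp [Matrix.mul_apply, Fin.sum_univ_four]

lemma cellShiftCentre_cell : cellShiftCentre (cell a z l A v y) = z := by
  have hl : (l : k) ≠ 0 := l.ne_zero
  rw [cellShiftCentre, cellMatrix_cell]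
  simp [Matrix.mul_apply, Fin.sum_univ_four]

lemma cellVec_cell : cellVec (cell a z l A v y) = v := by
  have hl : (l : k) ≠ 0 := l.ne_zero
  rw [cellVec, cellMatrix_cell]
  ext i
  fin_cases i <;> simp [Matrix.mul_apply, Fin.sum_univ_four] <;> field_simp <;> ring

lemma cellCentre_cell : cellCentre (cell a z l A v y) = y := by
  have hl : (l : k) ≠ 0 := l.ne_zero
  rw [cellCentre, cellShiftCentre_cell, cellVec_cell, cellShiftVec_cell, cellMatrix_cell]
  simp [Matrix.mul_apply, Fin.sum_univ_four]
  ring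

/-- An invertible `2 × 2` matrix, with its inverse given by the adjugate. -/
def glOfDet (M : Matrix (Fin 2) (Fin 2) k) (hM : M.det ≠ 0) : GL (Fin 2) k where
  val := M
  inv := M.det⁻¹ • M.adjugate
  val_inv := by rw [Matrix.mul_smul, mul_adjugate, smul_smul, inv_mul_cancel₀ hM, one_smul]
  inv_val := by rw [Matrix.smul_mul, adjugate_mul, smul_smul, inv_mul_cancel₀ hM, one_smul]

lemma det_cellLeviMatrix_ne_zero (g : openCell k) : (cellLeviMatrix g).det ≠ 0 := by
  obtain ⟨a, z, l, A, v, y, rfl⟩ := exists_eq_cell g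
  rw [cellLeviMatrix_cell]
  exact (GeneralLinearGroup.det A).ne_zero

/-- The coordinate `A` of `h(a, z) w'' m(λ, A) h(v, y) h(a, z)⁻¹`. -/
def cellLevi (g : openCell k) : GL (Fin 2) k :=
  glOfDet (cellLeviMatrix g) (det_cellLeviMatrix_ne_zero g)

lemma cellLevi_cell : cellLevi (cell a z l A v y) = A := Units.ext (cellLeviMatrix_cell a z l A v y)

end CellCoordinates

/-! ### The topology of the open cell -/

section CellTopology

variable {k : Type*} [Field k] [TopologicalSpace k]

lemma continuous_of_continuous_val {Y : Type*} [TopologicalSpace Y] {f : Y → GSp4 k}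
    (hf : Continuous fun y => ((f y : GSp4 k) : GL (Fin 4) k).val)
    (hf' : Continuous fun y => (((f y)⁻¹ : GSp4 k) : GL (Fin 4) k).val) : Continuous f :=
  IsInducing.subtypeVal.continuous_iff.2 (Units.continuous_iff.2 ⟨hf, hf'⟩)

lemma continuous_cellMatrix : Continuous (cellMatrix : openCell k → _) :=
  Units.continuous_val.comp (continuous_subtype_val.comp continuous_subtype_val)

lemma continuous_cellMatrix_apply (i j : Fin 4) :
    Continuous fun g : openCell k => cellMatrix g i j :=
  continuous_cellMatrix.matrix_elem i j

variable [IsTopologicalRing k]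

lemma continuous_h : Continuous fun p : (Fin 2 → k) × k => h p.1 p.2 := by
  have hv : Continuous fun p : (Fin 2 → k) × k => ((h p.1 p.2 : GSp4 k) : GL (Fin 4) k).val := by
    change Continuous fun p : (Fin 2 → k) × k => !![1, p.1 0, p.1 1, p.2;
      0, 1, 0, p.1 1; 0, 0, 1, -p.1 0; 0, 0, 0, 1]
    refine continuous_matrix fun i j => ?_
    fin_cases i <;> fin_cases j <;> simp <;> fun_prop
  refine continuous_of_continuous_val hv ?_
  simp only [h_inv]
  exact hv.comp (continuous_fst.neg.prodMk continuous_snd.neg)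

lemma continuous_m : Continuous fun p : kˣ × GL (Fin 2) k => m p.1 p.2 := by
  have hv : Continuous fun p : kˣ × GL (Fin 2) k => ((m p.1 p.2 : GSp4 k) : GL (Fin 4) k).val := by
    change Continuous fun p : kˣ × GL (Fin 2) k => !![(p.1 : k), 0, 0, 0;
      0, p.2 0 0, p.2 0 1, 0; 0, p.2 1 0, p.2 1 1, 0;
      0, 0, 0, (p.1 : k)⁻¹ * (p.2 : Matrix (Fin 2) (Fin 2) k).det]
    have h1 : Continuous fun p : kˣ × GL (Fin 2) k => (p.2 : Matrix (Fin 2) (Fin 2) k) :=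
      Units.continuous_val.comp continuous_snd
    have h2 : Continuous fun p : kˣ × GL (Fin 2) k => (p.1 : k) :=
      Units.continuous_val.comp continuous_fst
    have h3 : Continuous fun p : kˣ × GL (Fin 2) k => (p.1 : k)⁻¹ := by
      simp only [← Units.val_inv_eq_inv_val]
      exact Units.continuous_val.comp continuous_fst.inv
    have h4 : ∀ i j, Continuous fun p : kˣ × GL (Fin 2) k => p.2 i j := fun i j =>
      h1.matrix_elem i j
    have h5 := h3.mul h1.matrix_det
    refine continuous_matrix fun i j => ?_
    fin_cases i <;> fin_cases j <;>
      first | exact continuous_const | exact h2 | exact h5 | exact h4 _ _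
  refine continuous_of_continuous_val hv ?_
  simp only [m_inv]
  exact hv.comp (continuous_fst.inv.prodMk continuous_snd.inv)

lemma continuous_cell : Continuous fun p : (Fin 2 → k) × k × kˣ × GL (Fin 2) k × (Fin 2 → k) × k =>
    cell p.1 p.2.1 p.2.2.1 p.2.2.2.1 p.2.2.2.2.1 p.2.2.2.2.2 := by
  refine Continuous.subtype_mk ?_ _
  have h1 : Continuous fun p : (Fin 2 → k) × k × kˣ × GL (Fin 2) k × (Fin 2 → k) × k =>
      h p.1 p.2.1 := continuous_h.comp (continuous_fst.prodMk (continuous_fst.comp continuous_snd))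
  have h2 : Continuous fun p : (Fin 2 → k) × k × kˣ × GL (Fin 2) k × (Fin 2 → k) × k =>
      m p.2.2.1 p.2.2.2.1 :=
    continuous_m.comp (f := fun p : (Fin 2 → k) × k × kˣ × GL (Fin 2) k × (Fin 2 → k) × k =>
      (p.2.2.1, p.2.2.2.1)) (by fun_prop)
  have h3 : Continuous fun p : (Fin 2 → k) × k × kˣ × GL (Fin 2) k × (Fin 2 → k) × k =>
      h p.2.2.2.2.1 p.2.2.2.2.2 :=
    continuous_h.comp (f := fun p : (Fin 2 → k) × k × kˣ × GL (Fin 2) k × (Fin 2 → k) × k =>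
      (p.2.2.2.2.1, p.2.2.2.2.2)) (by fun_prop)
  exact (h1.mul ((continuous_const.mul h2).mul h3)).mul h1.inv

variable [ContinuousInv₀ k]

lemma continuous_cellMatrix_div {f : openCell k → k} (hf : Continuous f) :
    Continuous fun g => f g / cellMatrix g 3 0 :=
  hf.div (continuous_cellMatrix_apply 3 0) fun g h => cellMatrix_ne_zero g (by rw [h, neg_zero])

lemma continuous_cellScale : Continuous (cellScale : openCell k → kˣ) :=
  Units.continuous_iff.2 ⟨(continuous_cellMatrix_apply 3 0).neg,
    (continuous_cellMatrix_apply 3 0).neg.inv₀ cellMatrix_ne_zero⟩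

lemma continuous_cellLevi : Continuous (cellLevi : openCell k → GL (Fin 2) k) := by
  have hM := continuous_cellMatrix_apply (k := k)
  have h1 : Continuous (cellLeviMatrix : openCell k → _) := by
    refine continuous_matrix fun i j => ?_
    fin_cases i <;> fin_cases j
    · exact (hM 1 1).sub (continuous_cellMatrix_div ((hM 1 0).mul (hM 3 1)))
    · exact (hM 1 2).sub (continuous_cellMatrix_div ((hM 1 0).mul (hM 3 2)))
    · exact (hM 2 1).sub (continuous_cellMatrix_div ((hM 2 0).mul (hM 3 1)))
    · exact (hM 2 2).sub (continuous_cellMatrix_div ((hM 2 0).mul (hM 3 2)))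
  exact Units.continuous_iff.2 ⟨h1, (h1.matrix_det.inv₀ det_cellLeviMatrix_ne_zero).smul
    h1.matrix_adjugate⟩

lemma continuous_cellShiftVec : Continuous (cellShiftVec : openCell k → _) := by
  refine continuous_pi fun i => ?_
  fin_cases i
  · exact continuous_cellMatrix_div (continuous_cellMatrix_apply 2 0).neg
  · exact continuous_cellMatrix_div (continuous_cellMatrix_apply 1 0)

lemma continuous_cellShiftCentre : Continuous (cellShiftCentre : openCell k → k) :=
  continuous_cellMatrix_div (continuous_cellMatrix_apply 0 0)

lemma continuous_cellVec : Continuous (cellVec : openCell k → _) := by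
  refine continuous_pi fun i => ?_
  fin_cases i
  · exact continuous_cellMatrix_div
      ((continuous_cellMatrix_apply 3 1).sub (continuous_cellMatrix_apply 2 0))
  · exact continuous_cellMatrix_div
      ((continuous_cellMatrix_apply 3 2).add (continuous_cellMatrix_apply 1 0))

lemma continuous_cellCentre : Continuous (cellCentre : openCell k → k) := by
  have h1 : ∀ i, Continuous fun g : openCell k => cellVec g i := fun i =>
    (continuous_apply i).comp continuous_cellVec
  have h2 : ∀ i, Continuous fun g : openCell k => cellShiftVec g i := fun i =>
    (continuous_apply i).comp continuous_cellShiftVec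
  exact (((continuous_cellMatrix_div (continuous_cellMatrix_apply 3 3)).add
    continuous_cellShiftCentre).add ((h1 0).mul (h2 1))).sub ((h1 1).mul (h2 0))

/-- The coordinates of the open cell. -/
def cellHomeomorph (k : Type*) [Field k] [TopologicalSpace k] [IsTopologicalRing k]
    [ContinuousInv₀ k] :
    openCell k ≃ₜ (Fin 2 → k) × k × kˣ × GL (Fin 2) k × (Fin 2 → k) × k where
  toFun g := (cellShiftVec g, cellShiftCentre g, cellScale g, cellLevi g, cellVec g, cellCentre g)
  invFun p := cell p.1 p.2.1 p.2.2.1 p.2.2.2.1 p.2.2.2.2.1 p.2.2.2.2.2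
  left_inv g := by
    obtain ⟨a, z, l, A, v, y, rfl⟩ := exists_eq_cell g
    simp only [cellShiftVec_cell, cellShiftCentre_cell, cellScale_cell, cellLevi_cell, cellVec_cell,
      cellCentre_cell]
  right_inv p := by
    simp only [cellShiftVec_cell, cellShiftCentre_cell, cellScale_cell, cellLevi_cell, cellVec_cell,
      cellCentre_cell]
  continuous_toFun := continuous_cellShiftVec.prodMk (continuous_cellShiftCentre.prodMk
    (continuous_cellScale.prodMk (continuous_cellLevi.prodMk
      (continuous_cellVec.prodMk continuous_cellCentre))))
  continuous_invFun := continuous_cell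

instance instLocallyCompactSpaceCell [T2Space k] [LocallyCompactSpace k] :
    LocallyCompactSpace (openCell k) := by
  have : LocallyCompactSpace kˣ := Units.isClosedEmbedding_embedProduct.locallyCompactSpace
  exact (cellHomeomorph k).isClosedEmbedding.locallyCompactSpace

instance instTotallyDisconnectedSpaceCell [TotallyDisconnectedSpace k] :
    TotallyDisconnectedSpace (openCell k) := by
  have : TotallyDisconnectedSpace kˣ :=
    totallyDisconnectedSpace_of_injective Units.continuous_val Units.val_injective
  exact totallyDisconnectedSpace_of_injective (cellHomeomorph k).continuous
    (cellHomeomorph k).injective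

end CellTopology

/-! ### The action of `J` on the open cell -/

section Action

variable {k : Type*} [Field k]

lemma coe_jElt_one (a : Fin 2 → k) (z : k) : (jElt 1 a z : GSp4 k) = h a z := by
  change m 1 ((1 : SL(2, k)) : GL (Fin 2) k) * h a z = h a z
  rw [map_one, m_one, one_mul]

lemma coe_jSec (s : SL(2, k)) : (jSec k s : GSp4 k) = m 1 (s : GL (Fin 2) k) := by
  change m 1 (s : GL (Fin 2) k) * h 0 0 = _
  rw [h_zero, mul_one]

lemma tau_h (v : Fin 2 → k) (z : k) : tau (h v z) = h (d₂ k *ᵥ v) z := Subtype.ext (tauGL_h v z)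

lemma tau_m (l : kˣ) (A : GL (Fin 2) k) :
    tau (m l A) = m (l⁻¹ * GeneralLinearGroup.det A) ((d₁ k)⁻¹ * tr A * d₁ k) :=
  Subtype.ext (tauGL_m l A)

lemma tau_inv (g : GSp4 k) : tau g⁻¹ = (tau g)⁻¹ := by
  have h1 : tau (1 : GSp4 k) = 1 := by
    have h2 := tau_mul (1 : GSp4 k) 1
    rwa [mul_one, left_eq_mul] at h2
  rw [eq_inv_iff_mul_eq_one, ← tau_mul, mul_inv_cancel, h1]

lemma det_conj_tr (A : GL (Fin 2) k) :
    GeneralLinearGroup.det ((d₁ k)⁻¹ * tr A * d₁ k) = GeneralLinearGroup.det A := by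
  rw [map_mul, map_mul, map_inv, mul_comm, mul_inv_cancel_left]
  exact Units.ext (det_transpose _)

lemma tau_mem_J {g : GSp4 k} (hg : g ∈ J k) : tau g ∈ J k := by
  obtain ⟨s, v, z, rfl⟩ := hg
  have hdet : GeneralLinearGroup.det (s : GL (Fin 2) k) = 1 := Units.ext s.2
  obtain ⟨s', hs'⟩ : ∃ s' : SL(2, k),
      (s' : GL (Fin 2) k) = (d₁ k)⁻¹ * tr (s : GL (Fin 2) k) * d₁ k :=
    ⟨⟨_, congrArg Units.val ((det_conj_tr (s : GL (Fin 2) k)).trans hdet)⟩, Units.ext rfl⟩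
  rw [tau_mul, tau_m, tau_h, hdet, inv_one, mul_one, ← hs']
  exact (J k).mul_mem (coe_jElt_one (d₂ k *ᵥ v) z ▸ Subtype.prop _) (coe_jSec s' ▸ Subtype.prop _)

variable [TopologicalSpace k] [IsTopologicalRing k]

/-- The action of `J` on the open cell by conjugation. -/
instance jMulAction : MulAction (J k) (openCell k) where
  smul t g := conjCell t g
  one_smul g := Subtype.ext (by
    change (1 : GSp4 k) * g * (1 : GSp4 k)⁻¹ = g
    simp)
  mul_smul t t' g := Subtype.ext (by
    change (t * t' : GSp4 k) * g * (t * t' : GSp4 k)⁻¹ = t * (t' * g * (t' : GSp4 k)⁻¹) * _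
    simp [mul_assoc])

lemma coe_j_smul (t : J k) (g : openCell k) :
    ((t • g : openCell k) : GSp4 k) = t * g * (t : GSp4 k)⁻¹ :=
  rfl

instance jContinuousSMul : ContinuousSMul (J k) (openCell k) := by
  refine ⟨Continuous.subtype_mk ?_ _⟩
  have h1 : Continuous fun p : J k × openCell k => (p.1 : GSp4 k) :=
    continuous_subtype_val.comp continuous_fst
  exact (h1.mul (continuous_subtype_val.comp continuous_snd)).mul h1.inv

/-- In the coordinates of the open cell, `J` acts on `(A, v)` through `SL(2)`, and its unipotent
radical acts simply transitively on `(a, z)`. -/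
lemma exists_smul_cell (s : SL(2, k)) (b a v : Fin 2 → k) (x z y : k) (l : kˣ) (A : GL (Fin 2) k) :
    ∃ a' z', jElt s b x * jElt 1 a z = jElt 1 a' z' * jSec k s ∧
      jElt s b x • cell a z l A v y = cell a' z' l ((s : GL (Fin 2) k) * A * (s : GL (Fin 2) k)⁻¹)
        (v ᵥ* ((s⁻¹ : SL(2, k)) : Matrix (Fin 2) (Fin 2) k)) y := by
  obtain ⟨a', z', h1⟩ := jElt_mul_shift s b a x z
  refine ⟨a', z', h1, Subtype.ext ?_⟩
  have h2 : (jElt s b x : GSp4 k) * h a z = h a' z' * m 1 (s : GL (Fin 2) k) := by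
    rw [← coe_jElt_one, ← coe_jElt_one, ← coe_jSec]
    exact congrArg Subtype.val h1
  have h3 : m 1 (s : GL (Fin 2) k) * w'' k = w'' k * m 1 (s : GL (Fin 2) k) := by
    rw [w''_mul_m, show GeneralLinearGroup.det (s : GL (Fin 2) k) = 1 from Units.ext s.2, inv_one,
      one_mul]
  have h4 : h v y * (m 1 (s : GL (Fin 2) k))⁻¹ = (m 1 (s : GL (Fin 2) k))⁻¹ *
      h (v ᵥ* ((s⁻¹ : SL(2, k)) : Matrix (Fin 2) (Fin 2) k)) y := by
    have hs : ((s⁻¹ : SL(2, k)) : Matrix (Fin 2) (Fin 2) k).det = 1 := (s⁻¹).2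
    have h5 : ((s⁻¹ : SL(2, k)) : Matrix (Fin 2) (Fin 2) k) =
      (((s : GL (Fin 2) k)⁻¹ : GL (Fin 2) k) : Matrix (Fin 2) (Fin 2) k) := by rw [← map_inv]; rfl
    rw [h5] at hs
    rw [m_inv, inv_one, h_mul_m, hs, h5]
    simp
  have h6 : (jElt s b x : GSp4 k) * (h a z * (w'' k * m l A * h v y) * (h a z)⁻¹) *
      (jElt s b x : GSp4 k)⁻¹ = h a' z' * (m 1 (s : GL (Fin 2) k) * w'' k * m l A *
        (h v y * (m 1 (s : GL (Fin 2) k))⁻¹)) * (h a' z')⁻¹ := by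
    have h7 : (h a z)⁻¹ * (jElt s b x : GSp4 k)⁻¹ = (m 1 (s : GL (Fin 2) k))⁻¹ * (h a' z')⁻¹ := by
      rw [← _root_.mul_inv_rev, h2, _root_.mul_inv_rev]
    calc _ = ((jElt s b x : GSp4 k) * h a z) * (w'' k * m l A * h v y) *
          ((h a z)⁻¹ * (jElt s b x : GSp4 k)⁻¹) := by simp only [mul_assoc]
      _ = _ := by rw [h2, h7]; simp only [mul_assoc]
  change (jElt s b x : GSp4 k) * (h a z * (w'' k * m l A * h v y) * (h a z)⁻¹) *
    (jElt s b x : GSp4 k)⁻¹ = h a' z' * (w'' k * m l _ * h _ y) * (h a' z')⁻¹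
  rw [h6, h3, h4, m_inv, inv_one]
  have h8 : m l ((s : GL (Fin 2) k) * A * (s : GL (Fin 2) k)⁻¹) =
      m 1 (s : GL (Fin 2) k) * m l A * m 1 (s : GL (Fin 2) k)⁻¹ := by
    rw [m_mul, m_mul, one_mul, mul_one]
  rw [h8]
  simp only [mul_assoc]

/-- In the coordinates of the open cell, `τ` fixes `λ` and `y` and acts on `(A, v)`. -/
lemma exists_tauCell_cell (a v : Fin 2 → k) (z y : k) (l : kˣ) (A : GL (Fin 2) k) : ∃ a' z',
    tauCell k (cell a z l A v y) = cell a' z' l ((d₁ k)⁻¹ * tr A * d₁ k) (d₂ k *ᵥ v) y := by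
  obtain ⟨a', z', h1⟩ : ∃ a' z', (h (d₂ k *ᵥ a) z)⁻¹ * h (d₂ k *ᵥ v) y = h a' z' := by
    rw [h_inv, h_mul]; exact ⟨_, _, rfl⟩
  refine ⟨a', z', Subtype.ext ?_⟩
  change tau (h a z * (w'' k * m l A * h v y) * (h a z)⁻¹) =
    h a' z' * (w'' k * m l _ * h _ y) * (h a' z')⁻¹
  rw [← h1, tau_mul, tau_mul, tau_mul, tau_mul, tau_inv, tau_w'', tau_m, tau_h, tau_h, w''_mul_m,
    det_conj_tr]
  group

end Action

/-! ### The topology of `J` -/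

section Topology

variable {k : Type*} [Field k] [TopologicalSpace k]

lemma continuous_jMatrix_apply (i j : Fin 4) : Continuous fun t : J k => jMatrix t i j :=
  (Units.continuous_val.comp (continuous_subtype_val.comp continuous_subtype_val)).matrix_elem i j

lemma continuous_jProj : Continuous (jProj k) := by
  refine Continuous.subtype_mk (continuous_matrix fun i j => ?_) _
  fin_cases i <;> fin_cases j <;> exact continuous_jMatrix_apply _ _

variable [IsTopologicalRing k]

lemma continuous_jElt : Continuous fun p : SL(2, k) × (Fin 2 → k) × k => jElt p.1 p.2.1 p.2.2 := by
  refine Continuous.subtype_mk ?_ _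
  have h1 : Continuous fun p : SL(2, k) × (Fin 2 → k) × k => m (1 : kˣ) (p.1 : GL (Fin 2) k) :=
    continuous_m.comp (continuous_const.prodMk (continuous_toGL.comp continuous_fst))
  exact h1.mul (continuous_h.comp continuous_snd)

lemma continuous_jSec : Continuous (jSec k) := by
  have h1 : Continuous fun s : SL(2, k) => (s, (0 : Fin 2 → k), (0 : k)) :=
    continuous_id.prodMk continuous_const
  have h2 := continuous_jElt.comp h1
  exact h2

/-- The coordinates of `J`. -/
def jHomeomorph (k : Type*) [Field k] [TopologicalSpace k] [IsTopologicalRing k] :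
    J k ≃ₜ SL(2, k) × (Fin 2 → k) × k where
  toFun t := (jProj k t, ![jMatrix t 0 1, jMatrix t 0 2], jMatrix t 0 3)
  invFun p := jElt p.1 p.2.1 p.2.2
  left_inv t := by
    obtain ⟨s, v, z, rfl⟩ := exists_eq_jElt t
    simp only [jProj_jElt, jMatrix_jElt]
    congr 1
    ext i
    fin_cases i <;> simp
  right_inv p := by
    simp only [jProj_jElt, jMatrix_jElt]
    refine Prod.ext rfl (Prod.ext ?_ rfl)
    ext i
    fin_cases i <;> simp
  continuous_toFun := by
    refine continuous_jProj.prodMk (Continuous.prodMk (continuous_pi fun i => ?_)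
      (continuous_jMatrix_apply 0 3))
    fin_cases i <;> exact continuous_jMatrix_apply _ _
  continuous_invFun := continuous_jElt

instance instLocallyCompactSpaceJ [T2Space k] [LocallyCompactSpace k] :
    LocallyCompactSpace (J k) :=
  (jHomeomorph k).isClosedEmbedding.locallyCompactSpace

instance instTotallyDisconnectedSpaceJ [T2Space k] [TotallyDisconnectedSpace k] :
    TotallyDisconnectedSpace (J k) :=
  totallyDisconnectedSpace_of_injective (jHomeomorph k).continuous (jHomeomorph k).injective

end Topology

/-! ### The open cell as a space over `GL(2) × k²` -/

section Fibration

variable {k : Type*} [Field k]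

/-- The component in `GL(2) × k²` of an element of the open cell. The row vector `v`, on which
`SL(2)` acts by `v ↦ v s⁻¹`, is turned into the column `(-v₂, v₁)`. -/
def cellBase (g : openCell k) : GL (Fin 2) k × (Fin 2 → k) :=
  (cellLevi g, ![-cellVec g 1, cellVec g 0])

lemma coe_sl_inv (s : SL(2, k)) : ((s⁻¹ : SL(2, k)) : Matrix (Fin 2) (Fin 2) k) =
    !![s.1 1 1, -s.1 0 1; -s.1 1 0, s.1 0 0] :=
  adjugate_fin_two _

/-- The element of the unipotent radical of `J` that conjugates the point of the section below `g`
to `g`. -/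
def cellShift (g : openCell k) : J k := jElt 1 (cellShiftVec g) (cellShiftCentre g)

/-- The point of the open cell with parameter `(λ, y)` and component `b` in `GL(2) × k²`, and with
trivial component in the unipotent radical of `J`. -/
def cellPoint (l : kˣ × k) (b : GL (Fin 2) k × (Fin 2 → k)) : openCell k :=
  cell 0 0 l.1 b.1 ![b.2 1, -b.2 0] l.2

lemma cellBase_cell (a v : Fin 2 → k) (z y : k) (l : kˣ) (A : GL (Fin 2) k) :
    cellBase (cell a z l A v y) = (A, ![-v 1, v 0]) := by
  rw [cellBase, cellLevi_cell, cellVec_cell]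

lemma cellShift_cell (a v : Fin 2 → k) (z y : k) (l : kˣ) (A : GL (Fin 2) k) :
    cellShift (cell a z l A v y) = jElt 1 a z := by
  rw [cellShift, cellShiftVec_cell, cellShiftCentre_cell]

lemma cellBase_cellPoint (l : kˣ × k) (b : GL (Fin 2) k × (Fin 2 → k)) :
    cellBase (cellPoint l b) = b := by
  rw [cellPoint, cellBase_cell]
  refine Prod.ext rfl ?_
  ext i
  fin_cases i <;> simp

lemma cellShift_cellPoint (l : kˣ × k) (b : GL (Fin 2) k × (Fin 2 → k)) :
    cellShift (cellPoint l b) = 1 := by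
  rw [cellPoint, cellShift_cell, jElt_one]

variable [TopologicalSpace k] [IsTopologicalRing k]

lemma cellBase_smul (t : J k) (g : openCell k) :
    cellBase (t • g) = slAct (jProj k t) (cellBase g) := by
  obtain ⟨a, z, l, A, v, y, rfl⟩ := exists_eq_cell g
  obtain ⟨s, b, x, rfl⟩ := exists_eq_jElt t
  obtain ⟨a', z', -, h2⟩ := exists_smul_cell s b a v x z y l A
  rw [h2, jProj_jElt, cellBase_cell, cellBase_cell]
  refine Prod.ext rfl ?_
  rw [slAct_snd, mulVec_fin_two, coe_sl_inv]
  ext i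
  fin_cases i <;> simp [Matrix.vecMul, dotProduct, Fin.sum_univ_two] <;> ring

lemma cellShift_smul (t : J k) (g : openCell k) :
    cellShift (t • g) * jSec k (jProj k t) = t * cellShift g := by
  obtain ⟨a, z, l, A, v, y, rfl⟩ := exists_eq_cell g
  obtain ⟨s, b, x, rfl⟩ := exists_eq_jElt t
  obtain ⟨a', z', h1, h2⟩ := exists_smul_cell s b a v x z y l A
  rw [h2, jProj_jElt, cellShift_cell, cellShift_cell, h1]

lemma cellScale_smul (t : J k) (g : openCell k) : cellScale (t • g) = cellScale g := by
  obtain ⟨a, z, l, A, v, y, rfl⟩ := exists_eq_cell g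
  obtain ⟨s, b, x, rfl⟩ := exists_eq_jElt t
  obtain ⟨a', z', -, h2⟩ := exists_smul_cell s b a v x z y l A
  rw [h2, cellScale_cell, cellScale_cell]

lemma cellCentre_smul (t : J k) (g : openCell k) : cellCentre (t • g) = cellCentre g := by
  obtain ⟨a, z, l, A, v, y, rfl⟩ := exists_eq_cell g
  obtain ⟨s, b, x, rfl⟩ := exists_eq_jElt t
  obtain ⟨a', z', -, h2⟩ := exists_smul_cell s b a v x z y l A
  rw [h2, cellCentre_cell, cellCentre_cell]

lemma cellShift_smul_cellPoint (g : openCell k) :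
    cellShift g • cellPoint (cellScale g, cellCentre g) (cellBase g) = g := by
  obtain ⟨a, z, l, A, v, y, rfl⟩ := exists_eq_cell g
  have h1 : ![(![-v 1, v 0] : Fin 2 → k) 1, -(![-v 1, v 0] : Fin 2 → k) 0] = v := by
    ext i
    fin_cases i <;> simp
  rw [cellShift_cell, cellScale_cell, cellCentre_cell, cellBase_cell, cellPoint, h1]
  refine Subtype.ext ?_
  rw [coe_j_smul, coe_jElt_one]
  change h a z * (h 0 0 * (w'' k * m l A * h v y) * (h 0 0)⁻¹) * (h a z)⁻¹ =
    h a z * (w'' k * m l A * h v y) * (h a z)⁻¹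
  rw [h_zero, inv_one, one_mul, mul_one]

lemma jSec_smul_cellPoint (s : SL(2, k)) (l : kˣ × k) (b : GL (Fin 2) k × (Fin 2 → k)) :
    jSec k s • cellPoint l b = cellPoint l (slAct s b) := by
  have h0 : jProj k (jSec k s) = s := jProj_jElt s 0 0
  have h1 : cellShift (jSec k s • cellPoint l b) = 1 := by
    have h2 := cellShift_smul (jSec k s) (cellPoint l b)
    rwa [h0, cellShift_cellPoint, mul_one, mul_eq_right] at h2
  rw [← cellShift_smul_cellPoint (jSec k s • cellPoint l b), h1, one_smul, cellBase_smul, h0,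
    cellBase_cellPoint, cellScale_smul, cellCentre_smul]
  congr 1
  exact Prod.ext (cellScale_cell _ _ _ _ _ _) (cellCentre_cell _ _ _ _ _ _)

lemma continuous_cellPoint (l : kˣ × k) : Continuous (cellPoint l) := by
  have h1 : Continuous fun b : GL (Fin 2) k × (Fin 2 → k) => ![b.2 1, -b.2 0] := by
    refine continuous_pi fun i => ?_
    fin_cases i
    · exact (continuous_apply 1).comp continuous_snd
    · exact ((continuous_apply 0).comp continuous_snd).neg
  have h2 : Continuous fun b : GL (Fin 2) k × (Fin 2 → k) =>
      ((0 : Fin 2 → k), (0 : k), l.1, b.1, ![b.2 1, -b.2 0], l.2) :=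
    continuous_const.prodMk (continuous_const.prodMk
      (continuous_const.prodMk (continuous_fst.prodMk (h1.prodMk continuous_const))))
  have h3 := continuous_cell.comp h2
  exact h3

variable [ContinuousInv₀ k]

lemma continuous_cellShift : Continuous (cellShift : openCell k → J k) := by
  have h1 : Continuous fun g : openCell k => ((1 : SL(2, k)), cellShiftVec g, cellShiftCentre g) :=
    continuous_const.prodMk (continuous_cellShiftVec.prodMk continuous_cellShiftCentre)
  have h2 := continuous_jElt.comp h1
  exact h2

/-- The open cell as a space over `GL(2) × k²`, with parameter `(λ, y)`. -/
def cellFibration (k : Type*) [Field k] [TopologicalSpace k] [IsTopologicalRing k]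
    [ContinuousInv₀ k] : SLFibration k (J k) (openCell k) (kˣ × k) where
  proj := jProj k
  sec := jSec k
  param g := (cellScale g, cellCentre g)
  base := cellBase
  shift := cellShift
  point := cellPoint
  continuous_proj := continuous_jProj
  continuous_sec := continuous_jSec
  continuous_param := continuous_cellScale.prodMk continuous_cellCentre
  continuous_base := by
    refine continuous_cellLevi.prodMk (continuous_pi fun i => ?_)
    fin_cases i
    · exact ((continuous_apply 1).comp continuous_cellVec).neg
    · exact (continuous_apply 0).comp continuous_cellVec
  continuous_shift := continuous_cellShift
  continuous_point := continuous_cellPoint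
  proj_sec s := jProj_jElt s 0 0
  proj_shift _ := jProj_jElt 1 _ _
  shift_smul_point := cellShift_smul_cellPoint
  sec_smul_point := jSec_smul_cellPoint
  param_smul t g := Prod.ext (cellScale_smul t g) (cellCentre_smul t g)
  base_smul := cellBase_smul
  param_point l b := Prod.ext (cellScale_cell _ _ _ _ _ _) (cellCentre_cell _ _ _ _ _ _)
  base_point := cellBase_cellPoint
  shift_point := cellShift_cellPoint
  shift_smul := cellShift_smul

lemma isCompatible_cellFibration : (cellFibration k).IsCompatible (tauCell k) := by
  -- The column attached to `d₂ v` is minus `d₂` applied to the column attached to `v`.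
  refine ⟨fun g => ?_, fun g => ⟨-1, ?_⟩⟩
  · obtain ⟨a, z, l, A, v, y, rfl⟩ := exists_eq_cell g
    obtain ⟨a', z', h1⟩ := exists_tauCell_cell a v z y l A
    rw [h1]
    exact Prod.ext ((cellScale_cell _ _ _ _ _ _).trans (cellScale_cell _ _ _ _ _ _).symm)
      ((cellCentre_cell _ _ _ _ _ _).trans (cellCentre_cell _ _ _ _ _ _).symm)
  · obtain ⟨a, z, l, A, v, y, rfl⟩ := exists_eq_cell g
    obtain ⟨a', z', h1⟩ := exists_tauCell_cell a v z y l A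
    rw [h1]
    change cellBase _ = slAct (-1) (tauPrime k (cellBase _))
    rw [cellBase_cell, cellBase_cell]
    refine Prod.ext (Units.ext ?_) ?_
    · have h2 : (((-1 : SL(2, k))⁻¹ : SL(2, k)) : Matrix (Fin 2) (Fin 2) k) = -1 := by
        rw [coe_sl_inv]
        ext i j
        fin_cases i <;> fin_cases j <;> simp
      rw [slAct_fst, h2]
      simp [tauPrime]
    · rw [slAct_snd, tauPrime_snd, mulVec_fin_two]
      ext i
      fin_cases i <;> simp [d₂, Matrix.mulVec, dotProduct, Fin.sum_univ_two]

end Fibration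

/-- Conjugation by `t` after `τ` is `τ` after conjugation by `τ(t)⁻¹`, which lies in `J`. -/
lemma exists_smul_tauCell {k : Type*} [Field k] [TopologicalSpace k] [IsTopologicalRing k]
    (t : J k) : ∃ t' : J k, ∀ g, t • tauCell k g = tauCell k (t' • g) := by
  refine ⟨⟨(tau (t : GSp4 k))⁻¹, inv_mem (tau_mem_J t.2)⟩, fun g => Subtype.ext ?_⟩
  change (t : GSp4 k) * tau (g : GSp4 k) * (t : GSp4 k)⁻¹ =
    tau ((tau (t : GSp4 k))⁻¹ * (g : GSp4 k) * ((tau (t : GSp4 k))⁻¹)⁻¹)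
  rw [inv_inv, tau_mul, tau_mul, tau_inv, tau_tau, mul_assoc]

theorem isInvariant_tauCell {k : Type*} [Field k] [ValuativeRel k] [TopologicalSpace k]
    [IsNonarchimedeanLocalField k] (two_ne : (2 : k) ≠ 0) {T : Distribution (openCell k)}
    (hT : ∀ t : J k, T.IsInvariant (conjCell t)) : T.IsInvariant (tauCell k) := by
  refine isInvariant_of_testOn_le (G := J k)
    (SLFibration.testOn_univ_le two_ne isCompatible_cellFibration)
    (fun g => (tauCell k).left_inv g) exists_smul_tauCell fun t => ?_
  have h : Homeomorph.smul t = conjCell t := Homeomorph.ext fun _ => rfl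
  rw [h]
  exact hT t

end FourierJacobi

end

theorem mainTheorem8 {k : Type*} [Field k] [ValuativeRel k] [TopologicalSpace k]
    [IsNonarchimedeanLocalField k] (two_ne : (2 : k) ≠ 0) :
    (∀ T : FourierJacobi.Distribution (GL (Fin 2) k × (Fin 2 → k)),
      (∀ s : SL(2, k), T.IsInvariant (FourierJacobi.slAct s)) →
        T.IsInvariant (FourierJacobi.tauPrime k)) ∧
    (∀ ψ : AddChar k ℂ, Continuous ψ → ψ ≠ 1 →
      ∀ T : FourierJacobi.Distribution (FourierJacobi.openCell k),
        (∀ t : FourierJacobi.J k, T.IsInvariant (FourierJacobi.conjCell t)) →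
        (∀ z : k, T.map (FourierJacobi.leftZCell z) = ψ z • T) →
          T.IsInvariant (FourierJacobi.tauCell k)) := by
  exact ⟨fun _ hT => FourierJacobi.isInvariant_tauPrime two_ne hT,
    fun _ _ _ _ hT _ => FourierJacobi.isInvariant_tauCell two_ne hT⟩
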